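/- Let $\tilde M$ be a simply connected Riemannian symmetric space: a Riemannian manifold such that for every $q\in\tilde M$ there is an isometry $s_q$ of $\tilde M$ with $s_q(q)=q$ and $(ds_q)_q=-\mathrm{id}$. Let $G$ be its transvection group, i.e. the group of isometries generated by the products $s_qs_r$ with $q,r\in\tilde M$, and fix $p\in\tilde M$. Let $H=G_p$ be the isotropy group of $p$, and let $\mathfrak g$ and $\mathfrak h$ be the Lie algebras of $G$ and $H$; elements of $\mathfrak g$ are identified with their action fields on $\tilde M$. Then there is a complement $\mathfrak m$ of $\mathfrak h$ in $\mathfrak g$ with $[\mathfrak m,\mathfrak m]\subseteq\mathfrak h$ and $[\mathfrak m,\mathfrak h]\subseteq\mathfrak m$. For every such $\mathfrak m$ there is a unique $\mathfrak g$-valued one-form $\tilde\Omega_0:T\tilde M\to\mathfrak g$ satisfying $$\tilde\Omega_0\big(dg(X(p))\big)=\operatorname{Ad}_gX\qquad\text{for all } g\in G,\ X\in\mathfrak m$$ (the canonical virtual immersion of $\tilde M$). It is full, i.e. its image $\tilde\Omega_0(T\tilde M)$ spans $\mathfrak g$. Moreover $[\mathfrak m,\mathfrak m]=\mathfrak h$,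 where $[\mathfrak m,\mathfrak m]$ is the linear span of all brackets $[X,Y]$ with $X,Y\in\mathfrak m$. -/

import Mathlib

open Bundle
open scoped Manifold ContDiff

noncomputable section

namespace TransvectionGeometry

section Manifold

variable {E : Type*} [NormedAddCommGroup E] [NormedSpace ℝ E]
  {M : Type*} [TopologicalSpace M] [ChartedSpace E M]

variable (E M) in
/-- Vector fields on `M`, with no regularity built in; those in the Lie algebras below are smooth. -/
abbrev VectorFields : Type _ := (x : M) → TangentSpace 𝓘(ℝ, E) x

variable (E) in
/-- A Riemannian isometry of `M` onto itself: a diffeomorphism preserving the metric tensor. -/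
structure IsIsometry [RiemannianBundle (fun x : M ↦ TangentSpace 𝓘(ℝ, E) x)]
    (g : Equiv.Perm M) : Prop where
  contMDiff : ContMDiff 𝓘(ℝ, E) 𝓘(ℝ, E) ∞ g
  contMDiff_inv : ContMDiff 𝓘(ℝ, E) 𝓘(ℝ, E) ∞ (g⁻¹ : Equiv.Perm M)
  inner_map : ∀ (x : M) (v w : TangentSpace 𝓘(ℝ, E) x),
    inner ℝ (mfderiv 𝓘(ℝ, E) 𝓘(ℝ, E) g x v) (mfderiv 𝓘(ℝ, E) 𝓘(ℝ, E) g x w) = inner ℝ v w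

variable (E) in
/-- `s` is a (geodesic) symmetry, or reflection, at `p`: an isometry fixing `p` whose differential
at `p` is `-id`. -/
structure IsSymmetryAt [RiemannianBundle (fun x : M ↦ TangentSpace 𝓘(ℝ, E) x)]
    (p : M) (s : Equiv.Perm M) : Prop where
  isIsometry : IsIsometry E s
  map_self : s p = p
  mfderiv_eq : ∀ v : TangentSpace 𝓘(ℝ, E) p,
    mfderiv 𝓘(ℝ, E) 𝓘(ℝ, E) s p v = (-v : TangentSpace 𝓘(ℝ, E) p)

variable (E M) in
/-- The Riemannian manifold `M` is a symmetric space: there is a symmetry at each point. -/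
def IsSymmetricSpace [RiemannianBundle (fun x : M ↦ TangentSpace 𝓘(ℝ, E) x)] : Prop :=
  ∀ p : M, ∃ s : Equiv.Perm M, IsSymmetryAt E p s

variable (E M) in
/-- The group `G` generated by the transvections, that is, by the products of two reflections. -/
def transvectionGroup [RiemannianBundle (fun x : M ↦ TangentSpace 𝓘(ℝ, E) x)] :
    Subgroup (Equiv.Perm M) :=
  Subgroup.closure {t | ∃ (p q : M) (s s' : Equiv.Perm M),
    IsSymmetryAt E p s ∧ IsSymmetryAt E q s' ∧ t = s * s'}

/-- `X` is the velocity at time `0` of the curve `c` in the group `G`, which starts at the identity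
and is smooth (jointly in time and in the point it acts on). -/
structure IsVelocityOf (G : Subgroup (Equiv.Perm M)) (c : ℝ → Equiv.Perm M)
    (X : VectorFields E M) : Prop where
  mem : ∀ t, c t ∈ G
  map_zero : c 0 = 1
  contMDiff : ContMDiff (𝓘(ℝ, ℝ).prod 𝓘(ℝ, E)) 𝓘(ℝ, E) ∞ (fun z : ℝ × M ↦ c z.1 z.2)
  velocity : ∀ x : M, mfderiv 𝓘(ℝ, ℝ) 𝓘(ℝ, E) (fun t : ℝ ↦ c t x) 0 (1 : ℝ) = X (c 0 x)

theorem isVelocityOf_zero (G : Subgroup (Equiv.Perm M)) :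
    IsVelocityOf G (fun _ ↦ 1) (0 : VectorFields E M) where
  mem _ := G.one_mem
  map_zero := rfl
  contMDiff := contMDiff_snd
  velocity x := by
    have : mfderiv 𝓘(ℝ, ℝ) 𝓘(ℝ, E) (fun _ : ℝ ↦ x) 0 = 0 := mfderiv_const
    exact DFunLike.congr_fun this (1 : ℝ)

theorem IsVelocityOf.mdifferentiable {G : Subgroup (Equiv.Perm M)} {c : ℝ → Equiv.Perm M}
    {X : VectorFields E M} (h : IsVelocityOf G c X) :
    MDifferentiable (𝓘(ℝ, ℝ).prod 𝓘(ℝ, E)) 𝓘(ℝ, E) (fun z : ℝ × M ↦ c z.1 z.2) :=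
  h.contMDiff.mdifferentiable (by simp)

theorem IsVelocityOf.mdifferentiable_curve {G : Subgroup (Equiv.Perm M)} {c : ℝ → Equiv.Perm M}
    {X : VectorFields E M} (h : IsVelocityOf G c X) (x : M) :
    MDifferentiable 𝓘(ℝ, ℝ) 𝓘(ℝ, E) (fun t : ℝ ↦ c t x) :=
  h.mdifferentiable.comp (mdifferentiable_id.prodMk mdifferentiable_const)

theorem IsVelocityOf.smul {G : Subgroup (Equiv.Perm M)} {c : ℝ → Equiv.Perm M}
    {X : VectorFields E M} (h : IsVelocityOf G c X) (a : ℝ) :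
    IsVelocityOf G (fun t ↦ c (a * t)) (a • X) where
  mem t := h.mem _
  map_zero := by simp [h.map_zero]
  contMDiff := by
    have h1 : ContMDiff 𝓘(ℝ, ℝ) 𝓘(ℝ, ℝ) ∞ (fun t : ℝ ↦ a * t) :=
      (contDiff_const.mul contDiff_id).contMDiff
    exact h.contMDiff.comp ((h1.comp contMDiff_fst).prodMk contMDiff_snd)
  velocity x := by
    have h2 : HasMFDerivAt 𝓘(ℝ, ℝ) 𝓘(ℝ, ℝ) (fun t : ℝ ↦ a * t) 0
        (a • ContinuousLinearMap.id ℝ ℝ) :=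
      ((hasFDerivAt_id (0 : ℝ)).const_mul a).hasMFDerivAt
    have h3 := mfderiv_comp_apply_of_eq (I := 𝓘(ℝ, ℝ)) (I' := 𝓘(ℝ, ℝ)) (I'' := 𝓘(ℝ, E))
      (f := fun t : ℝ ↦ a * t) (g := fun t : ℝ ↦ c t x) (0 : ℝ)
      (h.mdifferentiable_curve x 0) h2.mdifferentiableAt (mul_zero a) (1 : ℝ)
    refine h3.trans ?_
    rw [h2.mfderiv]
    have h4 : ((a • ContinuousLinearMap.id ℝ ℝ : ℝ →L[ℝ] ℝ) (1 : ℝ)) = a • (1 : ℝ) := rfl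
    refine (congrArg (mfderiv 𝓘(ℝ, ℝ) 𝓘(ℝ, E) (fun t : ℝ ↦ c t x) 0) h4).trans ?_
    refine (ContinuousLinearMap.map_smul
      (mfderiv 𝓘(ℝ, ℝ) 𝓘(ℝ, E) (fun t : ℝ ↦ c t x) 0) a (1 : ℝ)).trans ?_
    refine (congrArg (fun w : E ↦ a • w) (h.velocity x)).trans ?_
    change a • (X (c 0 x) : E) = a • (X (c (a * 0) x) : E)
    rw [mul_zero]

theorem IsVelocityOf.add {G : Subgroup (Equiv.Perm M)} {c d : ℝ → Equiv.Perm M}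
    {X Y : VectorFields E M} (hc : IsVelocityOf G c X) (hd : IsVelocityOf G d Y) :
    IsVelocityOf G (fun t ↦ c t * d t) (X + Y) where
  mem t := G.mul_mem (hc.mem t) (hd.mem t)
  map_zero := by simp [hc.map_zero, hd.map_zero]
  contMDiff := hc.contMDiff.comp (contMDiff_fst.prodMk hd.contMDiff)
  velocity x := by
    have hF := hc.mdifferentiable (0, d 0 x)
    have hid : MDifferentiableAt 𝓘(ℝ, ℝ) 𝓘(ℝ, ℝ) (fun t : ℝ ↦ t) 0 := mdifferentiableAt_id
    have hD := hd.mdifferentiable_curve x 0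
    have h1 := mfderiv_comp_apply (I := 𝓘(ℝ, ℝ)) (I' := 𝓘(ℝ, ℝ).prod 𝓘(ℝ, E)) (I'' := 𝓘(ℝ, E))
      (f := fun t : ℝ ↦ (t, d t x)) (g := fun z : ℝ × M ↦ c z.1 z.2) (0 : ℝ)
      hF (hid.prodMk hD) (1 : ℝ)
    refine h1.trans ?_
    rw [mfderiv_prod_eq_add_apply hF, hid.mfderiv_prod hD]
    have h2 : mfderiv 𝓘(ℝ, ℝ) 𝓘(ℝ, ℝ) (fun t : ℝ ↦ t) 0 (1 : ℝ) = (1 : ℝ) :=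
      DFunLike.congr_fun (mfderiv_id (I := 𝓘(ℝ, ℝ)) (x := (0 : ℝ))) (1 : ℝ)
    have h3 : (fun y : M ↦ c 0 y) = id := by rw [hc.map_zero]; rfl
    have h4 : ∀ w : E, (mfderiv 𝓘(ℝ, E) 𝓘(ℝ, E) (fun y : M ↦ c 0 y) (d 0 x) : E → E) w = w := by
      intro w
      rw [h3]
      exact DFunLike.congr_fun (mfderiv_id (I := 𝓘(ℝ, E)) (x := d 0 x)) w
    have h5 : c 0 (d 0 x) = d 0 x := congrFun h3 _
    refine (congrArg₂ (fun u w : E ↦ u + w)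
      ((congrArg (mfderiv 𝓘(ℝ, ℝ) 𝓘(ℝ, E) (fun t : ℝ ↦ c t (d 0 x)) 0) h2).trans
        (hc.velocity (d 0 x)))
      ((h4 _).trans (hd.velocity x))).trans ?_
    exact congrArg (fun y : M ↦ (fun u w : E ↦ u + w) (X (c 0 (d 0 x))) (Y y)) h5.symm

variable (E) in
/-- The Lie algebra of a group `G` of transformations of `M`: the space of velocities at the
identity of the smooth curves in `G`. Since `G` acts effectively on `M`, the element `ξ` of its Lie
algebra is identified with its action field `x ↦ d/dt (exp tξ · x)` at `t = 0`; under this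
identification the Lie bracket is the opposite of the bracket of vector fields. -/
def lieAlgebraOf (G : Subgroup (Equiv.Perm M)) : Submodule ℝ (VectorFields E M) where
  carrier := {X | ∃ c, IsVelocityOf G c X}
  add_mem' := fun ⟨_, hc⟩ ⟨_, hd⟩ ↦ ⟨_, hc.add hd⟩
  zero_mem' := ⟨_, isVelocityOf_zero G⟩
  smul_mem' := fun a _ ⟨_, hc⟩ ↦ ⟨_, hc.smul a⟩

variable (E M) in
/-- The Lie algebra `𝔤` of the transvection group `G` of `M`. -/
def transvectionAlgebra [RiemannianBundle (fun x : M ↦ TangentSpace 𝓘(ℝ, E) x)] :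
    Submodule ℝ (VectorFields E M) :=
  lieAlgebraOf E (transvectionGroup E M)

variable (E) in
/-- The Lie algebra `𝔥` of the isotropy group `H = G_p`. -/
def isotropyAlgebra [RiemannianBundle (fun x : M ↦ TangentSpace 𝓘(ℝ, E) x)] (p : M) :
    Submodule ℝ (VectorFields E M) :=
  lieAlgebraOf E (transvectionGroup E M ⊓ MulAction.stabilizer (Equiv.Perm M) p)

/-- The linear span `[𝔞, 𝔟]` of the brackets `[X, Y]` with `X` in `𝔞` and `Y` in `𝔟`. -/
def bracketSpan (𝔞 𝔟 : Submodule ℝ (VectorFields E M)) : Submodule ℝ (VectorFields E M) :=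
  Submodule.span ℝ {Z | ∃ X ∈ 𝔞, ∃ Y ∈ 𝔟, Z = VectorField.mlieBracket 𝓘(ℝ, E) X Y}

/-- `𝔪` is a complement of `𝔥` in `𝔤` with `[𝔪, 𝔪] ⊆ 𝔥` and `[𝔪, 𝔥] ⊆ 𝔪`. -/
structure IsSymmetricComplement [RiemannianBundle (fun x : M ↦ TangentSpace 𝓘(ℝ, E) x)] (p : M)
    (𝔪 : Submodule ℝ (VectorFields E M)) : Prop where
  disjoint : isotropyAlgebra E p ⊓ 𝔪 = ⊥
  sup_eq : isotropyAlgebra E p ⊔ 𝔪 = transvectionAlgebra E M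
  bracket_self : bracketSpan 𝔪 𝔪 ≤ isotropyAlgebra E p
  bracket_isotropy : bracketSpan 𝔪 (isotropyAlgebra E p) ≤ 𝔪

/-- The adjoint action on action fields: the push-forward of `X` by `g`, that is, its pull-back
by `g⁻¹`. -/
def Ad (g : Equiv.Perm M) (X : VectorFields E M) : VectorFields E M :=
  VectorField.mpullback 𝓘(ℝ, E) 𝓘(ℝ, E) (g⁻¹ : Equiv.Perm M) X

variable (E M) in
/-- One-forms on `M` with values in the vector space `V`. -/
abbrev OneForm (V : Type*) [AddCommGroup V] [Module ℝ V] : Type _ :=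
  (x : M) → TangentSpace 𝓘(ℝ, E) x →ₗ[ℝ] V

/-- A `V`-valued one-form is full if its image spans `V`. -/
def IsFull {V : Type*} [AddCommGroup V] [Module ℝ V] (Ω : OneForm E M V) : Prop :=
  Submodule.span ℝ {u : V | ∃ (x : M) (v : TangentSpace 𝓘(ℝ, E) x), u = Ω x v} = ⊤

/-- `Ω` is the canonical `𝔤`-valued one-form: under the identification of the tangent bundle with
`G ×_H 𝔪` sending the class of `(g, X)` to `dg (X p)`, it maps the class of `(g, X)` to `Ad g X`. -/
def IsCanonicalForm [RiemannianBundle (fun x : M ↦ TangentSpace 𝓘(ℝ, E) x)] (p : M)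
    (𝔪 : Submodule ℝ (VectorFields E M)) (Ω : OneForm E M (transvectionAlgebra E M)) : Prop :=
  ∀ g ∈ transvectionGroup E M, ∀ X ∈ 𝔪,
    (Ω (g p) (mfderiv 𝓘(ℝ, E) 𝓘(ℝ, E) g p (X p)) : VectorFields E M) = Ad g X

end Manifold

end TransvectionGeometry

end

open TransvectionGeometry

open Bundle
open scoped Manifold ContDiff

noncomputable section

/-! Algebra. Write `ev` for evaluation at `p`, `B` for the metric on `T_pM` and `σ` for `Ad` of the
symmetry `s_p`. Then `σ` is an involution of 𝔤, and 𝔥 is both its fixed space and the kernel of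
`ev`. It acts on `T_pM` by skew endomorphisms, and effectively, because a Killing field is
determined by its 1-jet. The `-1`-eigenspace of `σ` is a complement of the required kind, and it is
the only one: for any 𝔪 as in the theorem, `B (ev [X + σX, Y]) (ev W)` on 𝔪 is symmetric in `X, Y`
and skew in `Y, W`, hence zero, so `X + σX = 0` by effectiveness (`map_eq_neg_of_mem_complement`).

For `[𝔪, 𝔪] = 𝔥`, the Killing form is used. If `Z` in 𝔥 satisfies `κ(Z, Z) = 0`, then `Z = 0`,
because `ad Z` is skew for a positive definite form on 𝔤 (`eq_zero_of_killingForm_self`). If `R`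
lies in the radical of `κ`, so does `R + σ_q R`, which is fixed by the involution `σ_q` at `q`.
Hence `σ_q R = -R` for every point `q`, every product of two symmetries fixes `R`, and `R` is
central because such products generate `G` (`lie_eq_zero_of_killingForm_eq_zero`). Finally, if `Z`
in 𝔥 is `κ`-orthogonal to `[𝔪, 𝔪]`, then `[Z, 𝔪]` lies in the radical and is central, so `|[Z,
X](p)|² = -⟨X(p), [Z, [Z, X]](p)⟩ = 0` and `Z = 0`. A dimension count concludes
(`ker_le_of_lie_mem`).

The canonical form exists because the isotropy group commutes with `s_p` and so preserves 𝔪. It is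
unique because `G` is transitive and 𝔪 maps onto `T_pM`. Its image spans a space containing all
`Ad_g 𝔪`; the derivatives of these translates give `[𝔪, 𝔪] = 𝔥`, whence fullness.

Analysis. The facts about 𝔤 used above are derived from one principle: the second derivative of a
local isometry is a smooth function of its 1-jet (Koszul formula), so along segments the 1-jet
solves a smooth ODE. Hence `g(x) = Φ(q, x - q, g(q), Dg(q))` in charts, with `Φ` smooth and
independent of `g` (`exists_contDiff_eq_of_isIsometry`). This gives rigidity of isometries and
Killing fields, finite dimension of 𝔤, and joint smoothness of `(q, x) ↦ s_q(x)`. Differentiating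
`s_q(q) = q` shows that `q ↦ s_q(p)` has derivative `2` at `p`; the inverse function theorem then
provides midpoints, and with them transitivity of `G`, surjectivity of `ev` and the identification
of its kernel with 𝔥. -/

namespace TransvectionGeometry


/-! ### Smooth dependence of an ODE on its initial value. -/

section Flow

universe u

variable {W V : Type u} [NormedAddCommGroup W] [NormedSpace ℝ W] [NormedAddCommGroup V]
  [NormedSpace ℝ V]

set_option synthInstance.maxHeartbeats 200000 in
/-- Pointwise evaluation of a curve of linear maps on a curve of vectors. -/
def evalCurve (W V : Type u) [NormedAddCommGroup W] [NormedSpace ℝ W] [NormedAddCommGroup V]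
    [NormedSpace ℝ V] :
    C(unitInterval, W →L[ℝ] V) →L[ℝ] C(unitInterval, W) →L[ℝ] C(unitInterval, V) :=
  LinearMap.mkContinuous₂
    (LinearMap.mk₂ ℝ (fun (β : C(unitInterval, W →L[ℝ] V)) (γ : C(unitInterval, W)) ↦
      (⟨fun t ↦ β t (γ t), by fun_prop⟩ : C(unitInterval, V)))
      (fun _ _ _ ↦ by ext; simp) (fun _ _ _ ↦ by ext; simp) (fun _ _ _ ↦ by ext; simp)
      (fun _ _ _ ↦ by ext; simp)) 1 (fun β γ ↦ by
      rw [ContinuousMap.norm_le _ (by positivity)]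
      intro t
      simp only [LinearMap.mk₂_apply, ContinuousMap.coe_mk, one_mul]
      exact (ContinuousLinearMap.le_opNorm _ _).trans (by
        gcongr
        · exact β.norm_coe_le_norm t
        · exact γ.norm_coe_le_norm t))

set_option synthInstance.maxHeartbeats 200000 in
@[simp] theorem evalCurve_apply (β : C(unitInterval, W →L[ℝ] V)) (γ : C(unitInterval, W))
    (t : unitInterval) : evalCurve W V β γ t = β t (γ t) := rfl

/-- Compact support makes the derivative uniformly continuous, so the mean value inequality gives
one `δ` for all base points `w`. This uniformity is what turns a pointwise Taylor estimate into one
in the sup norm on curves. -/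
theorem exists_uniform_taylor {f : W → V} (hf : ContDiff ℝ 1 f) (hc : HasCompactSupport f)
    {ε : ℝ} (hε : 0 < ε) :
    ∃ δ > 0, ∀ w k : W, ‖k‖ < δ → ‖f (w + k) - f w - fderiv ℝ f w k‖ ≤ ε * ‖k‖ := by
  have huc : UniformContinuous (fderiv ℝ f) :=
    (hc.fderiv (𝕜 := ℝ)).uniformContinuous_of_continuous (hf.continuous_fderiv (by simp))
  obtain ⟨δ, hδ, h⟩ := Metric.uniformContinuous_iff.1 huc ε hε
  refine ⟨δ, hδ, fun w k hk ↦ ?_⟩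
  have := (convex_ball w δ).norm_image_sub_le_of_norm_fderiv_le' (𝕜 := ℝ) (f := f) (C := ε)
    (φ := fderiv ℝ f w) (x := w) (y := w + k)
    (fun x _ ↦ (hf.differentiable (by simp)).differentiableAt)
    (fun x hx ↦ by
      have := h (a := x) (b := w) (by simpa using hx)
      rw [dist_eq_norm] at this
      exact this.le) (by simp [hδ]) (by simpa using hk)
  simpa using this

/-- The Taylor remainder is uniform along the curve, so `α ↦ f ∘ α` is differentiable in the sup
norm, with derivative the pointwise application of `Df ∘ α`. -/
theorem hasFDerivAt_comp_curve {f : W → V} (hf : ContDiff ℝ 1 f) (hc : HasCompactSupport f)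
    (α : C(unitInterval, W)) :
    HasFDerivAt (fun α : C(unitInterval, W) ↦ (⟨f, hf.continuous⟩ : C(W, V)).comp α)
      (evalCurve W V ((⟨fderiv ℝ f, hf.continuous_fderiv (by simp)⟩ : C(W, W →L[ℝ] V)).comp α))
      α := by
  rw [hasFDerivAt_iff_isLittleO_nhds_zero, Asymptotics.isLittleO_iff]
  intro ε hε
  obtain ⟨δ, hδ, h⟩ := exists_uniform_taylor hf hc hε
  filter_upwards [Metric.ball_mem_nhds _ hδ] with k hk
  rw [ContinuousMap.norm_le _ (by positivity)]
  intro t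
  have hk' : ‖k‖ < δ := by simpa using hk
  have := h (α t) (k t) ((k.norm_coe_le_norm t).trans_lt hk')
  refine le_trans (by simpa using this) ?_
  gcongr
  exact k.norm_coe_le_norm t

-- The derivative of `α ↦ f ∘ α` is a fixed continuous linear map applied to `α ↦ Df ∘ α`, an
-- operator of the same kind with another target. The induction on `n` therefore has to vary `V`.
set_option synthInstance.maxHeartbeats 200000 in
theorem contDiff_comp_curve (n : ℕ) {V : Type u} [NormedAddCommGroup V] [NormedSpace ℝ V]
    {f : W → V} (hf : ContDiff ℝ ∞ f) (hc : HasCompactSupport f) :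
    ContDiff ℝ n (fun α : C(unitInterval, W) ↦ (⟨f, hf.continuous⟩ : C(W, V)).comp α) := by
  induction n generalizing V with
  | zero => exact contDiff_zero.2 (ContinuousMap.continuous_postcomp _)
  | succ n ih =>
    have h1 : ContDiff ℝ 1 f := hf.of_le (by exact_mod_cast le_top)
    have hd := fun α ↦ hasFDerivAt_comp_curve h1 hc α
    push_cast
    rw [contDiff_succ_iff_fderiv]
    refine ⟨fun α ↦ (hd α).differentiableAt, by simp, ?_⟩
    have hf' : ContDiff ℝ ∞ (fderiv ℝ f) := hf.fderiv_right (by simp)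
    have hE : ContDiff ℝ n (evalCurve W V) := ContinuousLinearMap.contDiff _
    have := hE.comp (ih hf' (hc.fderiv (𝕜 := ℝ)))
    convert this using 1
    ext1 α
    exact (hd α).fderiv

/-- The primitive of a continuous curve that vanishes at `0`. -/
def primitive (W : Type u) [NormedAddCommGroup W] [NormedSpace ℝ W] :
    C(unitInterval, W) →L[ℝ] C(unitInterval, W) :=
  LinearMap.mkContinuous
    { toFun := fun α ↦ ⟨fun t ↦ ∫ s in (0 : ℝ)..t, Set.IccExtend zero_le_one α s, by
          have h : Continuous (Set.IccExtend (zero_le_one (α := ℝ)) α) := α.continuous.Icc_extend'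
          exact (intervalIntegral.continuous_primitive (fun a b ↦ h.intervalIntegrable a b) 0).comp
            continuous_subtype_val⟩
      map_add' := fun α β ↦ by
        ext t
        have h : Continuous (Set.IccExtend (zero_le_one (α := ℝ)) α) := α.continuous.Icc_extend'
        have h' : Continuous (Set.IccExtend (zero_le_one (α := ℝ)) β) := β.continuous.Icc_extend'
        exact intervalIntegral.integral_add (h.intervalIntegrable _ _) (h'.intervalIntegrable _ _)
      map_smul' := fun a α ↦ by
        ext t
        exact intervalIntegral.integral_smul a _ } 1 (fun α ↦ by
    rw [ContinuousMap.norm_le _ (by positivity)]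
    intro t
    have := intervalIntegral.norm_integral_le_of_norm_le_const (a := 0) (b := (t : ℝ)) (C := ‖α‖)
      (f := Set.IccExtend (zero_le_one (α := ℝ)) α) (fun x _ ↦ α.norm_coe_le_norm _)
    refine this.trans ?_
    rw [sub_zero, abs_of_nonneg t.2.1, one_mul]
    exact mul_le_of_le_one_right (norm_nonneg _) t.2.2)

theorem primitive_apply (α : C(unitInterval, W)) (t : unitInterval) :
    primitive W α t = ∫ s in (0 : ℝ)..t, Set.IccExtend zero_le_one α s := rfl

theorem norm_primitive_le : ‖primitive W‖ ≤ 1 :=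
  LinearMap.mkContinuous_norm_le _ zero_le_one _

/-- The time-one map of a smooth compactly supported vector field with small Lipschitz constant. -/
theorem exists_contDiff_timeOne_of_lipschitz [CompleteSpace W] {f : W → W} (hf : ContDiff ℝ ∞ f)
    (hc : HasCompactSupport f) (hL : LipschitzWith (1 / 2) f) :
    ∃ φ : W → W, ContDiff ℝ ∞ φ ∧ ∀ γ : ℝ → W,
      (∀ t ∈ Set.Icc (0 : ℝ) 1, HasDerivWithinAt γ (f (γ t)) (Set.Icc 0 1) t) →
      φ (γ 0) = γ 1 := by
  set fc : C(W, W) := ⟨f, hf.continuous⟩ with hfc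
  set T : C(unitInterval, W) → C(unitInterval, W) := fun α ↦ primitive W (fc.comp α) with hT
  have hTs : ContDiff ℝ ∞ T := by
    rw [contDiff_infty]
    exact fun n ↦ (primitive W).contDiff.comp (contDiff_comp_curve n hf hc)
  have hTL : LipschitzWith (1 / 2) T := by
    refine LipschitzWith.of_dist_le_mul fun α β ↦ ?_
    rw [dist_eq_norm, hT]
    simp only
    rw [← map_sub]
    refine ((primitive W).le_of_opNorm_le norm_primitive_le _).trans ?_
    rw [one_mul, ContinuousMap.norm_le _ (by positivity)]
    intro t
    have := hL.dist_le_mul (α t) (β t)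
    rw [dist_eq_norm] at this
    refine this.trans ?_
    gcongr
    exact ContinuousMap.dist_apply_le_dist t
  -- A curve `α` on `[0, 1]` solves the equation with initial value `w` exactly when `α - T α` is
  -- the constant curve `w`. So the time-one map is `w ↦ (S⁻¹ w)(1)`, and it remains to invert `S`
  -- smoothly.
  set S : C(unitInterval, W) → C(unitInterval, W) := fun α ↦ α - T α with hS
  have hSs : ContDiff ℝ ∞ S := contDiff_id.sub hTs
  have hA : ApproximatesLinearOn S
      ((ContinuousLinearEquiv.refl ℝ C(unitInterval, W) :
        C(unitInterval, W) ≃L[ℝ] C(unitInterval, W)) : C(unitInterval, W) →L[ℝ] C(unitInterval, W))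
      Set.univ (1 / 2) := by
    intro α _ β _
    have := hTL.dist_le_mul α β
    rw [dist_eq_norm, dist_eq_norm] at this
    have h2 : S α - S β - (α - β) = - (T α - T β) := by simp only [hS]; abel
    simp only [ContinuousLinearEquiv.coe_refl, ContinuousLinearMap.coe_id', id_eq]
    rw [h2, norm_neg]
    exact this
  have hcc : Subsingleton C(unitInterval, W) ∨ (1 / 2 : NNReal) <
      ‖((ContinuousLinearEquiv.refl ℝ C(unitInterval, W)).symm :
        C(unitInterval, W) →L[ℝ] C(unitInterval, W))‖₊⁻¹ := by
    rcases subsingleton_or_nontrivial C(unitInterval, W) with h | h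
    · exact Or.inl h
    · right
      have : ((ContinuousLinearEquiv.refl ℝ C(unitInterval, W)).symm :
        C(unitInterval, W) →L[ℝ] C(unitInterval, W)) = ContinuousLinearMap.id ℝ _ := rfl
      rw [this, ContinuousLinearMap.nnnorm_id]
      rw [← NNReal.coe_lt_coe]; norm_num
  let Sh := hA.toHomeomorph _ hcc
  have hSh : (Sh : C(unitInterval, W) → C(unitInterval, W)) = S := rfl
  have hlt : ∀ α, ‖fderiv ℝ T α‖ < 1 := fun α ↦
    (norm_fderiv_le_of_lipschitz ℝ hTL).trans_lt (by norm_num)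
  -- The derivative of `S` is `1 - T'` with `‖T'‖ ≤ 1/2`, hence invertible by the Neumann series at
  -- every curve.
  have hinv : ContDiff ℝ ∞ Sh.symm := by
    refine Sh.contDiff_symm (f₀' := fun α ↦
      ContinuousLinearEquiv.unitsEquiv ℝ _ (Units.oneSub (fderiv ℝ T α) (hlt α))) (fun α ↦ ?_)
      (hSh ▸ hSs)
    rw [hSh]
    exact (hasFDerivAt_id α).sub (hTs.differentiable (by simp) α).hasFDerivAt
  let cst : W →L[ℝ] C(unitInterval, W) := ContinuousLinearMap.const ℝ unitInterval
  let ev : C(unitInterval, W) →L[ℝ] W := ContinuousMap.evalCLM ℝ (1 : unitInterval)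
  refine ⟨fun w ↦ ev (Sh.symm (cst w)), ev.contDiff.comp (hinv.comp cst.contDiff), ?_⟩
  intro γ hγ
  have hcont : ContinuousOn γ (Set.Icc 0 1) := fun t ht ↦ (hγ t ht).continuousWithinAt
  let α : C(unitInterval, W) := ⟨fun t ↦ γ t, hcont.domRestrict⟩
  have key : S α = cst (γ 0) := by
    ext t
    have h0 : ∫ s in (0 : ℝ)..t, f (γ s) = γ t - γ 0 := by
      have hsub : Set.uIcc 0 (t : ℝ) ⊆ Set.Icc 0 1 := by
        rw [Set.uIcc_of_le t.2.1]; exact Set.Icc_subset_Icc_right t.2.2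
      refine intervalIntegral.integral_eq_sub_of_hasDeriv_right (hcont.mono hsub)
        (f' := fun s ↦ f (γ s)) ?_ ?_
      · intro s hs
        rw [min_eq_left t.2.1, max_eq_right t.2.1] at hs
        have hs1 : s < 1 := hs.2.trans_le t.2.2
        refine ((hγ s ⟨hs.1.le, hs1.le⟩).hasDerivAt ?_).hasDerivWithinAt
        exact Icc_mem_nhds hs.1 hs1
      · exact ((hf.continuous.comp_continuousOn hcont).mono hsub).intervalIntegrable
    have h1 : T α t = ∫ s in (0 : ℝ)..t, f (γ s) := by
      rw [hT]
      simp only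
      rw [primitive_apply]
      refine intervalIntegral.integral_congr fun s hs ↦ ?_
      rw [Set.uIcc_of_le t.2.1] at hs
      have hs' : s ∈ Set.Icc (0 : ℝ) 1 := ⟨hs.1, hs.2.trans t.2.2⟩
      rw [Set.IccExtend_of_mem _ _ hs']
      rfl
    have h2 : S α t = γ t - T α t := rfl
    have h3 : cst (γ 0) t = γ 0 := rfl
    rw [h2, h3, h1, h0, sub_sub_cancel]
  have : Sh.symm (cst (γ 0)) = α := by rw [← key, ← hSh, Sh.symm_apply_apply]
  change ev (Sh.symm (cst (γ 0))) = _
  rw [this]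
  rfl

/-- The time-one map of a smooth compactly supported vector field is smooth. -/
theorem exists_contDiff_timeOne [CompleteSpace W] {f : W → W} (hf : ContDiff ℝ ∞ f)
    (hc : HasCompactSupport f) :
    ∃ φ : W → W, ContDiff ℝ ∞ φ ∧ ∀ γ : ℝ → W,
      (∀ t ∈ Set.Icc (0 : ℝ) 1, HasDerivWithinAt γ (f (γ t)) (Set.Icc 0 1) t) →
      φ (γ 0) = γ 1 := by
  obtain ⟨C, hC⟩ := hf.lipschitzWith_of_hasCompactSupport hc (by simp)
  -- With `N > 2C` the field `f / N` has Lipschitz constant at most `1/2`. Its time-one map follows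
  -- `f` for time `1/N`, so the `N`-th iterate is the time-one map of `f`.
  obtain ⟨N, hN⟩ := exists_nat_gt (2 * (C : ℝ))
  have hN0 : (0 : ℝ) < N := lt_of_le_of_lt (by positivity) hN
  have hL : LipschitzWith (1 / 2) (fun w ↦ (N : ℝ)⁻¹ • f w) := by
    refine LipschitzWith.of_dist_le_mul fun x y ↦ ?_
    rw [dist_smul₀, Real.norm_of_nonneg (by positivity)]
    have h1 := hC.dist_le_mul x y
    calc (N : ℝ)⁻¹ * dist (f x) (f y) ≤ (N : ℝ)⁻¹ * (C * dist x y) := by gcongr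
      _ = ((N : ℝ)⁻¹ * C) * dist x y := by ring
      _ ≤ _ := by
        gcongr
        push_cast
        rw [inv_mul_le_iff₀ hN0]
        linarith
  obtain ⟨φ, hφ, h⟩ := exists_contDiff_timeOne_of_lipschitz
    (f := fun w ↦ (N : ℝ)⁻¹ • f w) (hf.const_smul _) (hc.smul_left (f := fun _ ↦ (N : ℝ)⁻¹)) hL
  refine ⟨φ^[N], ?_, fun γ hγ ↦ ?_⟩
  · have : ∀ k : ℕ, ContDiff ℝ ∞ φ^[k] := by
      intro k
      induction k with
      | zero => exact contDiff_id
      | succ k ih => rw [Function.iterate_succ]; exact ih.comp hφ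
    exact this N
  have hk : ∀ k : ℕ, k ≤ N → φ^[k] (γ 0) = γ (k / N) := by
    intro k
    induction k with
    | zero => simp
    | succ k ih =>
      intro hkN
      rw [Function.iterate_succ_apply', ih (by omega)]
      have hkN' : (k : ℝ) + 1 ≤ N := by exact_mod_cast hkN
      have hm : Set.MapsTo (fun t : ℝ ↦ (k + t) / N) (Set.Icc 0 1) (Set.Icc 0 1) := by
        intro t ht
        refine ⟨by have := ht.1; positivity, ?_⟩
        rw [div_le_one hN0]
        linarith [ht.2]
      have := h (fun t ↦ γ ((k + t) / N)) (fun t ht ↦ by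
        have h1 : HasDerivWithinAt (fun t : ℝ ↦ (k + t) / N) (N : ℝ)⁻¹ (Set.Icc 0 1) t := by
          have := (((hasDerivAt_id t).const_add (k : ℝ)).div_const (N : ℝ)).hasDerivWithinAt
            (s := Set.Icc 0 1)
          simpa using this
        exact (hγ _ (hm ht)).scomp t h1 hm)
      simpa using this
  simpa [hN0.ne'] using hk N le_rfl

end Flow

/-! ### Local isometries between metrics on open sets of `E` as solutions of an ODE. -/

section LocalIsometry

open scoped Topology

section Instances

variable {E : Type*} [NormedAddCommGroup E] [NormedSpace ℝ E]

instance instNormedAddCommGroupDual : NormedAddCommGroup (E →L[ℝ] ℝ) :=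
  ContinuousLinearMap.toNormedAddCommGroup

instance instNormedSpaceDual : NormedSpace ℝ (E →L[ℝ] ℝ) :=
  ContinuousLinearMap.toNormedSpace

instance instNormedAddCommGroupBilin : NormedAddCommGroup (E →L[ℝ] E →L[ℝ] ℝ) :=
  ContinuousLinearMap.toNormedAddCommGroup

instance instNormedSpaceBilin : NormedSpace ℝ (E →L[ℝ] E →L[ℝ] ℝ) :=
  ContinuousLinearMap.toNormedSpace

instance instNormedAddCommGroupTrilin : NormedAddCommGroup (E →L[ℝ] E →L[ℝ] E →L[ℝ] ℝ) :=
  ContinuousLinearMap.toNormedAddCommGroup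

instance instNormedSpaceTrilin : NormedSpace ℝ (E →L[ℝ] E →L[ℝ] E →L[ℝ] ℝ) :=
  ContinuousLinearMap.toNormedSpace

instance instNormedAddCommGroupEnd : NormedAddCommGroup (E →L[ℝ] E) :=
  ContinuousLinearMap.toNormedAddCommGroup

instance instNormedSpaceEnd : NormedSpace ℝ (E →L[ℝ] E) :=
  ContinuousLinearMap.toNormedSpace

end Instances

/-- A smooth compactly supported cutoff which is `1` on a compact subset of an open set, applied to
a function that is smooth there. -/
theorem exists_contDiff_hasCompactSupport_eqOn {W V : Type*} [NormedAddCommGroup W]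
    [NormedSpace ℝ W] [FiniteDimensional ℝ W] [NormedAddCommGroup V] [NormedSpace ℝ V]
    {O K : Set W} (hO : IsOpen O) (hK : IsCompact K) (hKO : K ⊆ O) {f : W → V}
    (hf : ∀ w ∈ O, ContDiffAt ℝ ∞ f w) :
    ∃ g : W → V, ContDiff ℝ ∞ g ∧ HasCompactSupport g ∧ Set.EqOn g f K := by
  obtain ⟨K', hK', hKK', hK'O⟩ := exists_compact_between hK hO hKO
  obtain ⟨χ, h1, h0, -⟩ := exists_contMDiffMap_one_nhds_of_subset_interior 𝓘(ℝ, W) (n := (⊤ : ℕ∞))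
    hK.isClosed hKK'
  have hχ : ContDiff ℝ ∞ χ := χ.contMDiff.contDiff
  refine ⟨fun w ↦ χ w • f w, ?_, ?_, ?_⟩
  · rw [contDiff_iff_contDiffAt]
    intro w
    by_cases hw : w ∈ O
    · exact hχ.contDiffAt.smul (hf w hw)
    · have : K'ᶜ ∈ 𝓝 w := hK'.isClosed.isOpen_compl.mem_nhds fun h ↦ hw (hK'O h)
      refine (contDiffAt_const (c := (0 : V))).congr_of_eventuallyEq ?_
      filter_upwards [this] with z hz
      rw [h0 z hz, zero_smul]
  · refine HasCompactSupport.intro hK' fun w hw ↦ ?_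
    rw [h0 w hw, zero_smul]
  · intro w hw
    have : χ w = 1 := h1.self_of_nhdsSet w hw
    simp [this]

variable {E : Type*} [NormedAddCommGroup E] [NormedSpace ℝ E]

/-- `G` is a smooth Riemannian metric on the subset `U` of the vector space `E`. -/
structure IsMetricOn (G : E → E →L[ℝ] E →L[ℝ] ℝ) (U : Set E) : Prop where
  isOpen : IsOpen U
  contDiffAt : ∀ x ∈ U, ContDiffAt ℝ ∞ G x
  symm : ∀ x ∈ U, ∀ v w, G x v w = G x w v
  pos : ∀ x ∈ U, ∀ v, v ≠ 0 → 0 < G x v v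

/-- The combination of first derivatives of the metric that occurs in the Koszul formula. -/
def koszul (D : E →L[ℝ] E →L[ℝ] E →L[ℝ] ℝ) (u : E) : E →L[ℝ] E →L[ℝ] ℝ :=
  D u + D.flip u - (D.flip u).flip

/-- The second derivative in direction `u` of a local isometry from `G₁` to `G₂`, as a function of
the point, the direction, the value and the first derivative. -/
def isometryField (G₁ G₂ : E → E →L[ℝ] E →L[ℝ] ℝ) (z : E × E × E × (E →L[ℝ] E)) : E →L[ℝ] E :=
  (1 / 2 : ℝ) • (z.2.2.2 ∘L (G₁ z.1).inverse ∘L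
    (koszul (fderiv ℝ G₁ z.1) z.2.1 -
      (koszul (fderiv ℝ G₂ z.2.2.1) (z.2.2.2 z.2.1)).bilinearComp z.2.2.2 z.2.2.2))

theorem IsMetricOn.exists_equiv [FiniteDimensional ℝ E] {G : E → E →L[ℝ] E →L[ℝ] ℝ} {U : Set E}
    (hG : IsMetricOn G U) {x : E} (hx : x ∈ U) :
    ∃ e : E ≃L[ℝ] (E →L[ℝ] ℝ), (e : E →L[ℝ] _) = G x := by
  have hinj : Function.Injective (G x) := by
    rw [injective_iff_map_eq_zero]
    intro v hv
    by_contra h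
    have := hG.pos x hx v h
    simp [hv] at this
  have hfin : Module.finrank ℝ E = Module.finrank ℝ (E →L[ℝ] ℝ) := by
    rw [← (LinearMap.toContinuousLinearMap : (E →ₗ[ℝ] ℝ) ≃ₗ[ℝ] E →L[ℝ] ℝ).finrank_eq]
    exact (Subspace.dual_finrank_eq (K := ℝ) (V := E)).symm
  refine ⟨(LinearEquiv.ofInjectiveOfFinrankEq (G x : E →ₗ[ℝ] E →L[ℝ] ℝ) hinj
    hfin).toContinuousLinearEquiv, ?_⟩
  ext; rfl

theorem contDiffAt_isometryField [FiniteDimensional ℝ E] {G₁ G₂ : E → E →L[ℝ] E →L[ℝ] ℝ}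
    {U V : Set E} (h₁ : IsMetricOn G₁ U) (h₂ : IsMetricOn G₂ V) {z : E × E × E × (E →L[ℝ] E)}
    (hx : z.1 ∈ U) (hy : z.2.2.1 ∈ V) : ContDiffAt ℝ ∞ (isometryField G₁ G₂) z := by
  have hD₁ : ContDiffAt ℝ ∞ (fun z : E × E × E × (E →L[ℝ] E) ↦ fderiv ℝ G₁ z.1) z :=
    ((h₁.contDiffAt _ hx).fderiv_right (m := ∞) (by simp)).comp z contDiffAt_fst
  have hp : ContDiff ℝ ∞ (fun z : E × E × E × (E →L[ℝ] E) ↦ z.2.2.1) := by fun_prop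
  have hA : ContDiff ℝ ∞ (fun z : E × E × E × (E →L[ℝ] E) ↦ z.2.2.2) := by fun_prop
  have hu : ContDiff ℝ ∞ (fun z : E × E × E × (E →L[ℝ] E) ↦ z.2.1) := by fun_prop
  have hD₂ : ContDiffAt ℝ ∞ (fun z : E × E × E × (E →L[ℝ] E) ↦ fderiv ℝ G₂ z.2.2.1) z :=
    ((h₂.contDiffAt _ hy).fderiv_right (m := ∞) (by simp)).comp z hp.contDiffAt
  have hflip : ∀ {f : E × E × E × (E →L[ℝ] E) → E →L[ℝ] E →L[ℝ] ℝ}, ContDiffAt ℝ ∞ f z →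
      ContDiffAt ℝ ∞ (fun z ↦ (f z).flip) z := fun {f} hf ↦
    (ContinuousLinearMap.flipₗᵢ ℝ E E ℝ).contDiff.contDiffAt.comp z hf
  have hflip' : ∀ {f : E × E × E × (E →L[ℝ] E) → E →L[ℝ] E →L[ℝ] E →L[ℝ] ℝ},
      ContDiffAt ℝ ∞ f z → ContDiffAt ℝ ∞ (fun z ↦ (f z).flip) z := fun {f} hf ↦
    (ContinuousLinearMap.flipₗᵢ ℝ E E (E →L[ℝ] ℝ)).contDiff.contDiffAt.comp z hf
  have hK : ∀ {D : E × E × E × (E →L[ℝ] E) → E →L[ℝ] E →L[ℝ] E →L[ℝ] ℝ}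
      {u : E × E × E × (E →L[ℝ] E) → E}, ContDiffAt ℝ ∞ D z → ContDiffAt ℝ ∞ u z →
      ContDiffAt ℝ ∞ (fun z ↦ koszul (D z) (u z)) z := fun {D u} hD hu ↦ by
    have h1 := hD.clm_apply hu
    have h2 := (hflip' hD).clm_apply hu
    exact (h1.add h2).sub (hflip h2)
  have hinv : ContDiffAt ℝ ∞ (fun z : E × E × E × (E →L[ℝ] E) ↦ (G₁ z.1).inverse) z := by
    obtain ⟨e, he⟩ := h₁.exists_equiv hx
    have h1 : ContDiffAt ℝ ∞ (ContinuousLinearMap.inverse : (E →L[ℝ] E →L[ℝ] ℝ) → _) (G₁ z.1) :=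
      he ▸ contDiffAt_map_inverse e
    exact h1.comp z ((h₁.contDiffAt _ hx).comp z contDiffAt_fst)
  have hN := hK hD₂ (hA.contDiffAt.clm_apply hu.contDiffAt)
  have hN' : ContDiffAt ℝ ∞ (fun z : E × E × E × (E →L[ℝ] E) ↦
      (koszul (fderiv ℝ G₂ z.2.2.1) (z.2.2.2 z.2.1)).bilinearComp z.2.2.2 z.2.2.2) z :=
    hflip ((hflip (hN.clm_comp hA.contDiffAt)).clm_comp hA.contDiffAt)
  exact (hA.contDiffAt.clm_comp (hinv.clm_comp ((hK hD₁ hu.contDiffAt).sub hN'))).const_smul _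

/-- The second derivative of a local isometry is determined by its one-jet. -/
theorem fderiv_fderiv_eq_isometryField [FiniteDimensional ℝ E] {G₁ G₂ : E → E →L[ℝ] E →L[ℝ] ℝ}
    {U V : Set E} (h₁ : IsMetricOn G₁ U) (h₂ : IsMetricOn G₂ V) {g : E → E} {x : E}
    (hg : ContDiffAt ℝ ∞ g x) (hx : x ∈ U) (hy : g x ∈ V)
    (hiso : ∀ᶠ z in 𝓝 x, ∀ v w, G₂ (g z) (fderiv ℝ g z v) (fderiv ℝ g z w) = G₁ z v w) (u : E) :
    fderiv ℝ (fderiv ℝ g) x u = isometryField G₁ G₂ (x, u, g x, fderiv ℝ g x) := by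
  set A := fderiv ℝ g x with hA
  set H := fderiv ℝ (fderiv ℝ g) x with hH
  have hdA : HasFDerivAt (fderiv ℝ g) H x :=
    ((hg.fderiv_right (m := ∞) (by simp)).differentiableAt (by simp)).hasFDerivAt
  have hdg : HasFDerivAt g A x := (hg.differentiableAt (by simp)).hasFDerivAt
  have hdG₁ : HasFDerivAt G₁ (fderiv ℝ G₁ x) x :=
    ((h₁.contDiffAt _ hx).differentiableAt (by simp)).hasFDerivAt
  have hdG₂ : HasFDerivAt G₂ (fderiv ℝ G₂ (g x)) (g x) :=
    ((h₂.contDiffAt _ hy).differentiableAt (by simp)).hasFDerivAt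
  have hsymm : ∀ u v, H u v = H v u := hg.isSymmSndFDerivAt (by
    rw [minSmoothness_of_isRCLikeNormedField]
    exact WithTop.coe_le_coe.2 (le_top (a := (2 : ℕ∞))))
  -- The isometry identity, differentiated in the direction `u`.
  have key : ∀ u v w, fderiv ℝ G₂ (g x) (A u) (A v) (A w) + G₂ (g x) (H u v) (A w) +
      G₂ (g x) (A v) (H u w) = fderiv ℝ G₁ x u v w := by
    intro u v w
    have hl : HasFDerivAt (fun z ↦ G₂ (g z) (fderiv ℝ g z v) (fderiv ℝ g z w)) _ x :=
      ((hdG₂.comp x hdg).clm_apply (hdA.clm_apply (hasFDerivAt_const v x))).clm_apply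
        (hdA.clm_apply (hasFDerivAt_const w x))
    have hr : HasFDerivAt (fun z ↦ G₁ z v w) _ x :=
      (hdG₁.clm_apply (hasFDerivAt_const v x)).clm_apply (hasFDerivAt_const w x)
    have := hl.unique (hr.congr_of_eventuallyEq (hiso.mono fun z hz ↦ hz v w))
    have := DFunLike.congr_fun this u
    simp at this
    rw [← this]
    ring
  have hsy := h₂.symm _ hy
  ext v
  set R := koszul (fderiv ℝ G₁ x) u - (koszul (fderiv ℝ G₂ (g x)) (A u)).bilinearComp A A with hR
  -- The Koszul trick: adding two of the cyclic versions of `key` and subtracting the third, the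
  -- symmetry of `H` isolates the term with `H u v`.
  have hRa : ∀ w, 2 * G₂ (g x) (H u v) (A w) = R v w := by
    intro w
    have e1 := key u v w
    have e2 := key v u w
    have e3 := key w u v
    have : R v w = (fderiv ℝ G₁ x u v w + fderiv ℝ G₁ x v u w - fderiv ℝ G₁ x w u v) -
      (fderiv ℝ G₂ (g x) (A u) (A v) (A w) + fderiv ℝ G₂ (g x) (A v) (A u) (A w) -
        fderiv ℝ G₂ (g x) (A w) (A u) (A v)) := rfl
    rw [this, ← e1, ← e2, ← e3, hsymm w u, hsymm w v, hsymm v u, hsy (A v) (H u w),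
      hsy (A u) (H v w)]
    ring
  have hG₁ : ∀ v w, G₂ (g x) (A v) (A w) = G₁ x v w := hiso.self_of_nhds
  obtain ⟨e, he⟩ := h₁.exists_equiv hx
  have hinv : ∀ l, G₁ x ((G₁ x).inverse l) = l := by
    intro l
    rw [← he, ContinuousLinearMap.inverse_equiv]
    exact e.apply_symm_apply l
  have hval : isometryField G₁ G₂ (x, u, g x, A) v = (1 / 2 : ℝ) • A ((G₁ x).inverse (R v)) := rfl
  rw [hval]
  set ζ := (G₁ x).inverse (R v) with hζ
  have hinj : Function.Injective A := by
    rw [injective_iff_map_eq_zero]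
    intro w hw
    by_contra h
    have := h₁.pos x hx w h
    rw [← hG₁, hw] at this
    simp at this
  have hsurj : Function.Surjective A :=
    (LinearMap.injective_iff_surjective (f := (A : E →ₗ[ℝ] E))).1 hinj
  -- `A` is onto, so the difference of the two sides can be tested against itself.
  obtain ⟨w, hw⟩ := hsurj (H u v - (1 / 2 : ℝ) • A ζ)
  by_contra hne
  have hpos := h₂.pos _ hy _ (sub_ne_zero.2 hne)
  have h0 : G₂ (g x) (H u v - (1 / 2 : ℝ) • A ζ) (A w) = 0 := by
    rw [map_sub, map_smul, sub_apply, smul_apply, hG₁,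
      hζ, hinv, ← hRa w, smul_eq_mul]
    ring
  rw [hw] at h0
  exact hpos.ne' h0

/-- Compactness of `K` times the unit sphere, and homogeneity. Together with the upper bound it
controls the operator norm of the derivative of every isometry, so that all 1-jets stay in one
compact set. -/
theorem IsMetricOn.exists_lower_bound [FiniteDimensional ℝ E] {G : E → E →L[ℝ] E →L[ℝ] ℝ}
    {U K : Set E} (hG : IsMetricOn G U) (hK : IsCompact K) (hKU : K ⊆ U) :
    ∃ c > 0, ∀ x ∈ K, ∀ v, c * ‖v‖ ^ 2 ≤ G x v v := by
  have hcont : ContinuousOn (fun z : E × E ↦ G z.1 z.2 z.2) (K ×ˢ Metric.sphere (0 : E) 1) := by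
    have hGc : ContinuousOn (fun z : E × E ↦ G z.1) (K ×ˢ Metric.sphere (0 : E) 1) :=
      ContinuousOn.comp (g := G) (t := K)
        (fun x hx ↦ (hG.contDiffAt x (hKU hx)).continuousAt.continuousWithinAt)
        continuousOn_fst fun z hz ↦ hz.1
    exact (hGc.clm_apply continuousOn_snd).clm_apply continuousOn_snd
  obtain ⟨c, hc, h⟩ : ∃ c > 0, ∀ z ∈ K ×ˢ Metric.sphere (0 : E) 1, c ≤ G z.1 z.2 z.2 := by
    rcases (K ×ˢ Metric.sphere (0 : E) 1).eq_empty_or_nonempty with h | h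
    · exact ⟨1, one_pos, by simp [h]⟩
    · obtain ⟨z, hz, hmin⟩ := (hK.prod (isCompact_sphere (0 : E) 1)).exists_isMinOn h hcont
      refine ⟨G z.1 z.2 z.2, hG.pos _ (hKU hz.1) _ ?_, fun w hw ↦ hmin hw⟩
      have := hz.2
      rw [mem_sphere_zero_iff_norm] at this
      exact norm_ne_zero_iff.1 (this ▸ one_ne_zero)
  refine ⟨c, hc, fun x hx v ↦ ?_⟩
  rcases eq_or_ne v 0 with rfl | hv
  · simp
  have hn : ‖v‖ ≠ 0 := norm_ne_zero_iff.2 hv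
  have := h (x, ‖v‖⁻¹ • v) ⟨hx, by simp [norm_smul, hn]⟩
  simp only [map_smul, smul_apply, smul_eq_mul] at this
  calc c * ‖v‖ ^ 2 ≤ (‖v‖⁻¹ * (‖v‖⁻¹ * G x v v)) * ‖v‖ ^ 2 := by gcongr
    _ = G x v v := by field_simp

theorem IsMetricOn.exists_upper_bound {G : E → E →L[ℝ] E →L[ℝ] ℝ}
    {U K : Set E} (hG : IsMetricOn G U) (hK : IsCompact K) (hKU : K ⊆ U) :
    ∃ C > 0, ∀ x ∈ K, ∀ v, G x v v ≤ C * ‖v‖ ^ 2 := by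
  have hcont : ContinuousOn (fun x ↦ G x) K :=
    fun x hx ↦ (hG.contDiffAt x (hKU hx)).continuousAt.continuousWithinAt
  obtain ⟨C, hC⟩ := hK.exists_bound_of_continuousOn hcont
  refine ⟨max C 1, by positivity, fun x hx v ↦ ?_⟩
  calc G x v v ≤ ‖G x v v‖ := le_abs_self _
    _ ≤ ‖G x‖ * ‖v‖ * ‖v‖ := (G x).le_opNorm₂ v v
    _ ≤ max C 1 * ‖v‖ * ‖v‖ := by
      gcongr
      exact (hC x hx).trans (le_max_left _ _)
    _ = _ := by ring

/-- A local isometry between balls is a smooth function, independent of the isometry, of its one-jet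
at a point. -/
theorem exists_contDiff_eq_of_isometry [FiniteDimensional ℝ E] {G₁ G₂ : E → E →L[ℝ] E →L[ℝ] ℝ}
    {U V : Set E} (h₁ : IsMetricOn G₁ U) (h₂ : IsMetricOn G₂ V) {x₀ y₀ : E} {r r' : ℝ}
    (hr : Metric.closedBall x₀ r ⊆ U) (hr' : Metric.closedBall y₀ r' ⊆ V) :
    ∃ Φ : E × E × E × (E →L[ℝ] E) → E, ContDiff ℝ ∞ Φ ∧ ∀ g : E → E,
      (∀ x ∈ Metric.ball x₀ r, ContDiffAt ℝ ∞ g x) →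
      Set.MapsTo g (Metric.ball x₀ r) (Metric.ball y₀ r') →
      (∀ x ∈ Metric.ball x₀ r, ∀ v w, G₂ (g x) (fderiv ℝ g x v) (fderiv ℝ g x w) = G₁ x v w) →
      ∀ q ∈ Metric.ball x₀ r, ∀ x ∈ Metric.ball x₀ r, g x = Φ (q, x - q, g q, fderiv ℝ g q) := by
  obtain ⟨c, hc, hcl⟩ := h₂.exists_lower_bound (isCompact_closedBall y₀ r') hr'
  obtain ⟨C, hC, hCu⟩ := h₁.exists_upper_bound (isCompact_closedBall x₀ r) hr
  -- From `c ‖Dg v‖² ≤ G₂(Dg v, Dg v) = G₁(v, v) ≤ C ‖v‖²`, this bounds `‖Dg‖` for every isometry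
  -- `g`. The set `K` below then contains all jets met along segments; `2 * r` bounds the direction
  -- `x - q`.
  set L := √(C / c) with hL
  set K : Set (E × E × E × (E →L[ℝ] E)) := Metric.closedBall x₀ r ×ˢ Metric.closedBall 0 (2 * r) ×ˢ
    Metric.closedBall y₀ r' ×ˢ Metric.closedBall 0 L with hKdef
  have hK : IsCompact K := (isCompact_closedBall _ _).prod ((isCompact_closedBall _ _).prod
    ((isCompact_closedBall _ _).prod (isCompact_closedBall _ _)))
  set O : Set (E × E × E × (E →L[ℝ] E)) := {z | z.1 ∈ U ∧ z.2.2.1 ∈ V} with hOdef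
  have hO : IsOpen O := (h₁.isOpen.preimage continuous_fst).inter
    (h₂.isOpen.preimage (by fun_prop))
  have hKO : K ⊆ O := fun z hz ↦ ⟨hr hz.1, hr' hz.2.2.1⟩
  -- The state is (point, direction, value, derivative): the direction is constant, the value moves
  -- by `Dg u` and the derivative by the Koszul field. The cutoff makes the field global without
  -- changing it on `K`.
  obtain ⟨f, hf, hfc, hfK⟩ := exists_contDiff_hasCompactSupport_eqOn hO hK hKO
    (f := fun z : E × E × E × (E →L[ℝ] E) ↦
      ((z.2.1, 0, z.2.2.2 z.2.1, isometryField G₁ G₂ z) : E × E × E × (E →L[ℝ] E)))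
    (fun z hz ↦ by
      have h3 := contDiffAt_isometryField h₁ h₂ hz.1 hz.2
      have h4 : ContDiffAt ℝ ∞ (fun z : E × E × E × (E →L[ℝ] E) ↦ z.2.2.2 z.2.1) z := by fun_prop
      have h5 : ContDiffAt ℝ ∞ (fun z : E × E × E × (E →L[ℝ] E) ↦ z.2.1) z := by fun_prop
      exact h5.prodMk (contDiffAt_const.prodMk (h4.prodMk h3)))
  obtain ⟨φ, hφ, hsol⟩ := exists_contDiff_timeOne hf hfc
  refine ⟨fun z ↦ (φ z).2.2.1, by fun_prop, fun g hg hmaps hiso q hq x hx ↦ ?_⟩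
  have hseg : ∀ t ∈ Set.Icc (0 : ℝ) 1, q + t • (x - q) ∈ Metric.ball x₀ r := by
    intro t ht
    exact (convex_ball x₀ r).add_smul_sub_mem hq hx ht
  have hbound : ∀ z ∈ Metric.ball x₀ r, ‖fderiv ℝ g z‖ ≤ L := by
    intro z hz
    refine ContinuousLinearMap.opNorm_le_bound _ (Real.sqrt_nonneg _) fun v ↦ ?_
    have e1 := hcl _ (Metric.ball_subset_closedBall (hmaps hz)) (fderiv ℝ g z v)
    rw [hiso z hz] at e1
    have e2 := e1.trans (hCu _ (Metric.ball_subset_closedBall hz) v)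
    rw [hL, ← Real.sqrt_sq (norm_nonneg v), ← Real.sqrt_mul (by positivity)]
    refine Real.le_sqrt_of_sq_le ?_
    rw [div_mul_eq_mul_div, le_div_iff₀ hc]
    linarith
  -- The jet of `g` along the segment from `q` to `x` is an integral curve; the third component of
  -- its endpoint is `g x`.
  have := hsol (fun t ↦ (q + t • (x - q), x - q, g (q + t • (x - q)),
    fderiv ℝ g (q + t • (x - q)))) (fun t ht ↦ by
      have hz := hseg t ht
      have hmem : ((q + t • (x - q), x - q, g (q + t • (x - q)),
          fderiv ℝ g (q + t • (x - q))) : E × E × E × (E →L[ℝ] E)) ∈ K := by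
        refine ⟨Metric.ball_subset_closedBall hz, ?_, Metric.ball_subset_closedBall (hmaps hz), ?_⟩
        · have e1 : dist x x₀ < r := hx
          have e2 : dist q x₀ < r := hq
          have := dist_triangle_right x q x₀
          simp only [Metric.mem_closedBall, dist_zero_right, ← dist_eq_norm]
          linarith
        · simpa using hbound _ hz
      rw [hfK hmem]
      have hline : HasDerivAt (fun t : ℝ ↦ q + t • (x - q)) (x - q) t := by
        simpa using ((hasDerivAt_id t).smul_const (x - q)).const_add q
      have hd1 := ((hg _ hz).differentiableAt (by simp)).hasFDerivAt.comp_hasDerivAt t hline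
      have hd2 := ((((hg _ hz).fderiv_right (m := ∞) (by simp)).differentiableAt
        (by simp)).hasFDerivAt).comp_hasDerivAt t hline
      rw [fderiv_fderiv_eq_isometryField h₁ h₂ (hg _ hz)
        (hr (Metric.ball_subset_closedBall hz)) (hr' (Metric.ball_subset_closedBall (hmaps hz)))
        (Filter.eventually_of_mem (Metric.isOpen_ball.mem_nhds hz) hiso)] at hd2
      have hd2' : HasDerivAt (fun t : ℝ ↦ fderiv ℝ g (q + t • (x - q))) _ t := hd2
      have hd1' : HasDerivAt (fun t : ℝ ↦ g (q + t • (x - q))) _ t := hd1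
      exact (hline.prodMk ((hasDerivAt_const t (x - q)).prodMk
        (hd1'.prodMk hd2'))).hasDerivWithinAt)
  simp only [zero_smul, add_zero, one_smul, add_sub_cancel] at this
  exact (congrArg (fun z ↦ z.2.2.1) this).symm

end LocalIsometry

/-! ### Derivatives of maps of manifolds as operators on the model spaces. -/

section TDeriv

open scoped Topology

/-- The derivative of a map between manifolds, as a linear map between the model spaces. -/
def tderiv (E F : Type*) [NormedAddCommGroup E] [NormedSpace ℝ E] [NormedAddCommGroup F]
    [NormedSpace ℝ F] {M N : Type*} [TopologicalSpace M] [ChartedSpace E M] [TopologicalSpace N]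
    [ChartedSpace F N] (f : M → N) (x : M) : E →L[ℝ] F :=
  mfderiv 𝓘(ℝ, E) 𝓘(ℝ, F) f x

variable {E F F' : Type*} [NormedAddCommGroup E] [NormedSpace ℝ E] [NormedAddCommGroup F]
  [NormedSpace ℝ F] [NormedAddCommGroup F'] [NormedSpace ℝ F']
  {M N P : Type*} [TopologicalSpace M] [ChartedSpace E M] [TopologicalSpace N] [ChartedSpace F N]
  [TopologicalSpace P] [ChartedSpace F' P]

theorem tderiv_comp {f : M → N} {g : N → P} {x : M}
    (hg : MDifferentiableAt 𝓘(ℝ, F) 𝓘(ℝ, F') g (f x))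
    (hf : MDifferentiableAt 𝓘(ℝ, E) 𝓘(ℝ, F) f x) :
    tderiv E F' (g ∘ f) x = (tderiv F F' g (f x)).comp (tderiv E F f x) :=
  mfderiv_comp x hg hf

theorem tderiv_comp_apply {f : M → N} {g : N → P} {x : M}
    (hg : MDifferentiableAt 𝓘(ℝ, F) 𝓘(ℝ, F') g (f x))
    (hf : MDifferentiableAt 𝓘(ℝ, E) 𝓘(ℝ, F) f x) (v : E) :
    tderiv E F' (g ∘ f) x v = tderiv F F' g (f x) (tderiv E F f x v) := by
  rw [tderiv_comp hg hf]; rfl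

@[simp] theorem tderiv_id (x : M) : tderiv E E (id : M → M) x = ContinuousLinearMap.id ℝ E :=
  mfderiv_id

@[simp] theorem tderiv_const (x : M) (y : N) :
    tderiv E F (fun _ : M ↦ y) x = 0 :=
  mfderiv_const

theorem tderiv_congr {f g : M → N} {x : M} (h : f =ᶠ[𝓝 x] g) :
    tderiv E F f x = tderiv E F g x :=
  h.mfderiv_eq

theorem tderiv_eq_fderiv (f : E → F) (x : E) : tderiv E F f x = fderiv ℝ f x :=
  mfderiv_eq_fderiv

end TDeriv

/-! ### The metric and the isometries in charts. -/

section ChartMetric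

open scoped Topology

variable {E : Type*} [NormedAddCommGroup E] [NormedSpace ℝ E]
  {M : Type*} [TopologicalSpace M] [ChartedSpace E M]

theorem contMDiffAt_extChartAt_symm [IsManifold 𝓘(ℝ, E) ∞ M] {x₀ : M} {z : E}
    (hz : z ∈ (extChartAt 𝓘(ℝ, E) x₀).target) :
    ContMDiffAt 𝓘(ℝ, E) 𝓘(ℝ, E) ∞ (extChartAt 𝓘(ℝ, E) x₀).symm z :=
  (contMDiffOn_extChartAt_symm x₀ z hz).contMDiffAt ((isOpen_extChartAt_target x₀).mem_nhds hz)

theorem contMDiffAt_extChartAt_of_mem [IsManifold 𝓘(ℝ, E) ∞ M] {x₀ x : M}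
    (hx : x ∈ (extChartAt 𝓘(ℝ, E) x₀).source) :
    ContMDiffAt 𝓘(ℝ, E) 𝓘(ℝ, E) ∞ (extChartAt 𝓘(ℝ, E) x₀) x := by
  rw [extChartAt_source] at hx
  exact contMDiffAt_extChartAt' hx

theorem tderiv_extChartAt_symm_comp [IsManifold 𝓘(ℝ, E) ∞ M] {x₀ x : M}
    (hx : x ∈ (extChartAt 𝓘(ℝ, E) x₀).source) (v : E) :
    tderiv E E (extChartAt 𝓘(ℝ, E) x₀).symm (extChartAt 𝓘(ℝ, E) x₀ x)
      (tderiv E E (extChartAt 𝓘(ℝ, E) x₀) x v) = v := by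
  have h1 := (contMDiffAt_extChartAt_symm ((extChartAt 𝓘(ℝ, E) x₀).map_source hx)).mdifferentiableAt
    (by simp)
  have h2 := (contMDiffAt_extChartAt_of_mem hx).mdifferentiableAt (by simp)
  have h4 : (extChartAt 𝓘(ℝ, E) x₀).symm ∘ (extChartAt 𝓘(ℝ, E) x₀) =ᶠ[𝓝 x] id := by
    filter_upwards [(isOpen_extChartAt_source x₀).mem_nhds hx] with y hy
    exact (extChartAt 𝓘(ℝ, E) x₀).left_inv hy
  rw [← tderiv_comp_apply h1 h2, tderiv_congr h4, tderiv_id]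
  rfl

theorem tderiv_extChartAt_comp_symm [IsManifold 𝓘(ℝ, E) ∞ M] {x₀ : M} {z : E}
    (hz : z ∈ (extChartAt 𝓘(ℝ, E) x₀).target) (v : E) :
    tderiv E E (extChartAt 𝓘(ℝ, E) x₀) ((extChartAt 𝓘(ℝ, E) x₀).symm z)
      (tderiv E E (extChartAt 𝓘(ℝ, E) x₀).symm z v) = v := by
  have h1 := (contMDiffAt_extChartAt_symm hz).mdifferentiableAt (by simp)
  have h2 := (contMDiffAt_extChartAt_of_mem
    ((extChartAt 𝓘(ℝ, E) x₀).map_target hz)).mdifferentiableAt (by simp)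
  have h4 : (extChartAt 𝓘(ℝ, E) x₀) ∘ (extChartAt 𝓘(ℝ, E) x₀).symm =ᶠ[𝓝 z] id := by
    filter_upwards [(isOpen_extChartAt_target x₀).mem_nhds hz] with y hy
    exact (extChartAt 𝓘(ℝ, E) x₀).right_inv hy
  rw [← tderiv_comp_apply h2 h1, tderiv_congr h4, tderiv_id]
  rfl

/-- The expression of a map in the charts around `x₀` and `y₀`. -/
def chartRep (E : Type*) [NormedAddCommGroup E] [NormedSpace ℝ E] [ChartedSpace E M] (x₀ y₀ : M)
    (g : M → M) : E → E :=
  extChartAt 𝓘(ℝ, E) y₀ ∘ g ∘ (extChartAt 𝓘(ℝ, E) x₀).symm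

theorem chartRep_apply {x₀ y₀ x : M} (g : M → M) (hx : x ∈ (extChartAt 𝓘(ℝ, E) x₀).source) :
    chartRep E x₀ y₀ g (extChartAt 𝓘(ℝ, E) x₀ x) = extChartAt 𝓘(ℝ, E) y₀ (g x) := by
  simp only [chartRep, Function.comp_apply, (extChartAt 𝓘(ℝ, E) x₀).left_inv hx]

theorem contDiffAt_chartRep [IsManifold 𝓘(ℝ, E) ∞ M] {x₀ y₀ : M} {g : M → M} {z : E}
    (hg : ContMDiff 𝓘(ℝ, E) 𝓘(ℝ, E) ∞ g) (hz : z ∈ (extChartAt 𝓘(ℝ, E) x₀).target)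
    (hy : g ((extChartAt 𝓘(ℝ, E) x₀).symm z) ∈ (extChartAt 𝓘(ℝ, E) y₀).source) :
    ContDiffAt ℝ ∞ (chartRep E x₀ y₀ g) z := by
  rw [← contMDiffAt_iff_contDiffAt]
  exact (contMDiffAt_extChartAt_of_mem hy).comp z (hg.contMDiffAt.comp z
    (contMDiffAt_extChartAt_symm hz))

theorem fderiv_chartRep [IsManifold 𝓘(ℝ, E) ∞ M] {x₀ y₀ : M} {g : M → M} {z : E}
    (hg : ContMDiff 𝓘(ℝ, E) 𝓘(ℝ, E) ∞ g) (hz : z ∈ (extChartAt 𝓘(ℝ, E) x₀).target)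
    (hy : g ((extChartAt 𝓘(ℝ, E) x₀).symm z) ∈ (extChartAt 𝓘(ℝ, E) y₀).source) (v : E) :
    fderiv ℝ (chartRep E x₀ y₀ g) z v =
      tderiv E E (extChartAt 𝓘(ℝ, E) y₀) (g ((extChartAt 𝓘(ℝ, E) x₀).symm z))
        (tderiv E E g ((extChartAt 𝓘(ℝ, E) x₀).symm z)
          (tderiv E E (extChartAt 𝓘(ℝ, E) x₀).symm z v)) := by
  have h1 := (contMDiffAt_extChartAt_symm hz).mdifferentiableAt (by simp)
  have h2 : MDifferentiableAt 𝓘(ℝ, E) 𝓘(ℝ, E) g ((extChartAt 𝓘(ℝ, E) x₀).symm z) :=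
    hg.contMDiffAt.mdifferentiableAt (by simp)
  have h3 := (contMDiffAt_extChartAt_of_mem hy).mdifferentiableAt (by simp)
  rw [← tderiv_eq_fderiv, ← tderiv_comp_apply h2 h1]
  exact tderiv_comp_apply (f := g ∘ (extChartAt 𝓘(ℝ, E) x₀).symm) h3 (h2.comp z h1) v

/-- The tangent map of the inverse chart applied to a constant field. Inner products of such
coordinate fields are the coefficients of the metric in the chart, which become smooth in this way.
-/
theorem contMDiffOn_mfderiv_extChartAt_symm [IsManifold 𝓘(ℝ, E) ∞ M] (x₀ : M) (v : E) :
    ContMDiffOn 𝓘(ℝ, E) 𝓘(ℝ, E).tangent ∞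
      (fun z : E ↦ (⟨(extChartAt 𝓘(ℝ, E) x₀).symm z,
        tderiv E E (extChartAt 𝓘(ℝ, E) x₀).symm z v⟩ : TangentBundle 𝓘(ℝ, E) M))
      (extChartAt 𝓘(ℝ, E) x₀).target := by
  have h1 := (contMDiffOn_extChartAt_symm (I := 𝓘(ℝ, E)) (n := ∞) x₀).contMDiffOn_tangentMapWithin
    (m := ∞) (by simp) (isOpen_extChartAt_target x₀).uniqueMDiffOn
  have h2 : ContMDiff 𝓘(ℝ, E) 𝓘(ℝ, E).tangent ∞
      (fun z : E ↦ (⟨z, v⟩ : TangentBundle 𝓘(ℝ, E) E)) :=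
    contMDiff_vectorSpace_iff_contDiff.2 contDiff_const
  have h3 := h1.comp (s := (extChartAt 𝓘(ℝ, E) x₀).target) h2.contMDiffOn (fun z hz ↦ hz)
  refine h3.congr fun z hz ↦ ?_
  simp only [Function.comp_apply, tangentMapWithin]
  rw [mfderivWithin_of_isOpen (isOpen_extChartAt_target x₀) hz]
  rfl

variable [RiemannianBundle (fun x : M ↦ TangentSpace 𝓘(ℝ, E) x)]

variable (E) in
/-- The metric tensor at `x`, as a bilinear form on the model space. -/
def metricForm (x : M) : E →L[ℝ] E →L[ℝ] ℝ :=
  (innerSL ℝ : TangentSpace 𝓘(ℝ, E) x →L[ℝ] TangentSpace 𝓘(ℝ, E) x →L[ℝ] ℝ)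

theorem metricForm_symm (x : M) (v w : E) : metricForm E x v w = metricForm E x w v :=
  real_inner_comm (F := TangentSpace 𝓘(ℝ, E) x) _ _

theorem metricForm_pos (x : M) {v : E} (hv : v ≠ 0) : 0 < metricForm E x v v :=
  (real_inner_self_pos (F := TangentSpace 𝓘(ℝ, E) x)).2 hv

/-- The metric tensor in the chart around `x₀`. -/
def chartMetric (x₀ : M) (z : E) : E →L[ℝ] E →L[ℝ] ℝ :=
  (metricForm E ((extChartAt 𝓘(ℝ, E) x₀).symm z)).bilinearComp
    (tderiv E E (extChartAt 𝓘(ℝ, E) x₀).symm z) (tderiv E E (extChartAt 𝓘(ℝ, E) x₀).symm z)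

theorem chartMetric_apply (x₀ : M) (z v w : E) : chartMetric x₀ z v w =
    metricForm E ((extChartAt 𝓘(ℝ, E) x₀).symm z) (tderiv E E (extChartAt 𝓘(ℝ, E) x₀).symm z v)
      (tderiv E E (extChartAt 𝓘(ℝ, E) x₀).symm z w) := rfl

theorem contDiffOn_chartMetric [FiniteDimensional ℝ E] [IsManifold 𝓘(ℝ, E) ∞ M]
    [IsContMDiffRiemannianBundle 𝓘(ℝ, E) ∞ E (fun x : M ↦ TangentSpace 𝓘(ℝ, E) x)] (x₀ : M) :
    ContDiffOn ℝ ∞ (chartMetric (E := E) x₀) (extChartAt 𝓘(ℝ, E) x₀).target := by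
  refine contDiffOn_clm_apply.2 fun v ↦ contDiffOn_clm_apply.2 fun w ↦ ?_
  rw [← contMDiffOn_iff_contDiffOn]
  exact ContMDiffOn.inner_bundle (F := E) (E := fun x : M ↦ TangentSpace 𝓘(ℝ, E) x)
    (contMDiffOn_mfderiv_extChartAt_symm x₀ v) (contMDiffOn_mfderiv_extChartAt_symm x₀ w)

theorem chartMetric_symm (x₀ : M) (z v w : E) : chartMetric x₀ z v w = chartMetric x₀ z w v := by
  rw [chartMetric_apply, chartMetric_apply, metricForm_symm]

theorem chartMetric_pos [IsManifold 𝓘(ℝ, E) ∞ M] {x₀ : M} {z : E}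
    (hz : z ∈ (extChartAt 𝓘(ℝ, E) x₀).target) {v : E} (hv : v ≠ 0) : 0 < chartMetric x₀ z v v := by
  rw [chartMetric_apply]
  refine metricForm_pos _ fun h ↦ hv ?_
  rw [← tderiv_extChartAt_comp_symm hz v, h, map_zero]

theorem isMetricOn_chartMetric [FiniteDimensional ℝ E] [IsManifold 𝓘(ℝ, E) ∞ M]
    [IsContMDiffRiemannianBundle 𝓘(ℝ, E) ∞ E (fun x : M ↦ TangentSpace 𝓘(ℝ, E) x)] (x₀ : M) :
    IsMetricOn (chartMetric (E := E) x₀) (extChartAt 𝓘(ℝ, E) x₀).target where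
  isOpen := isOpen_extChartAt_target x₀
  symm x _ v w := chartMetric_symm x₀ x v w
  pos _ hx _ hv := chartMetric_pos hx hv
  contDiffAt _ hx := (contDiffOn_chartMetric x₀).contDiffAt
    ((isOpen_extChartAt_target x₀).mem_nhds hx)

theorem IsIsometry.metricForm_map {g : Equiv.Perm M} (hg : IsIsometry E g) (x : M) (v w : E) :
    metricForm E (g x) (tderiv E E g x v) (tderiv E E g x w) = metricForm E x v w :=
  hg.inner_map x v w

theorem fderiv_chartRep_of_mem_source [IsManifold 𝓘(ℝ, E) ∞ M] {x₀ y₀ q : M}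
    {g : Equiv.Perm M} (hg : IsIsometry E g)
    (hq : q ∈ (extChartAt 𝓘(ℝ, E) x₀).source) (hy : g q ∈ (extChartAt 𝓘(ℝ, E) y₀).source) (v : E) :
    fderiv ℝ (chartRep E x₀ y₀ g) (extChartAt 𝓘(ℝ, E) x₀ q) v =
      tderiv E E (extChartAt 𝓘(ℝ, E) y₀) (g q) (tderiv E E g q
        (tderiv E E (extChartAt 𝓘(ℝ, E) x₀).symm (extChartAt 𝓘(ℝ, E) x₀ q) v)) := by
  have hl := (extChartAt 𝓘(ℝ, E) x₀).left_inv hq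
  rw [fderiv_chartRep hg.contMDiff ((extChartAt 𝓘(ℝ, E) x₀).map_source hq) (by rwa [hl]), hl]

theorem IsIsometry.chartMetric_map [IsManifold 𝓘(ℝ, E) ∞ M] {g : Equiv.Perm M} (hg : IsIsometry E g)
    {x₀ y₀ : M} {z : E} (hz : z ∈ (extChartAt 𝓘(ℝ, E) x₀).target)
    (hy : g ((extChartAt 𝓘(ℝ, E) x₀).symm z) ∈ (extChartAt 𝓘(ℝ, E) y₀).source) (v w : E) :
    chartMetric y₀ (chartRep E x₀ y₀ g z) (fderiv ℝ (chartRep E x₀ y₀ g) z v)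
      (fderiv ℝ (chartRep E x₀ y₀ g) z w) = chartMetric x₀ z v w := by
  have hval : (extChartAt 𝓘(ℝ, E) y₀).symm (chartRep E x₀ y₀ g z) =
      g ((extChartAt 𝓘(ℝ, E) x₀).symm z) := (extChartAt 𝓘(ℝ, E) y₀).left_inv hy
  have h : ∀ v, tderiv E E (extChartAt 𝓘(ℝ, E) y₀).symm (chartRep E x₀ y₀ g z)
      (fderiv ℝ (chartRep E x₀ y₀ g) z v) = tderiv E E g ((extChartAt 𝓘(ℝ, E) x₀).symm z)
        (tderiv E E (extChartAt 𝓘(ℝ, E) x₀).symm z v) := by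
    intro v
    rw [fderiv_chartRep hg.contMDiff hz hy]
    exact tderiv_extChartAt_symm_comp hy _
  rw [chartMetric_apply, h, h, hval, hg.metricForm_map, chartMetric_apply]

end ChartMetric

/-! ### Isometries do not increase the distance. -/

section Distance

variable {E : Type*} [NormedAddCommGroup E] [NormedSpace ℝ E]
  {M : Type*} [EMetricSpace M] [ChartedSpace E M]
  [RiemannianBundle (fun x : M ↦ TangentSpace 𝓘(ℝ, E) x)]

theorem IsIsometry.norm_map {g : Equiv.Perm M} (hg : IsIsometry E g) (x : M)
    (v : TangentSpace 𝓘(ℝ, E) x) : ‖mfderiv 𝓘(ℝ, E) 𝓘(ℝ, E) g x v‖ = ‖v‖ := by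
  rw [norm_eq_sqrt_real_inner, norm_eq_sqrt_real_inner, hg.inner_map]

/-- The image of a curve has the same length, and the distance is the infimum of lengths. -/
theorem IsIsometry.edist_map_le [IsManifold 𝓘(ℝ, E) ∞ M]
    [IsContMDiffRiemannianBundle 𝓘(ℝ, E) ∞ E (fun x : M ↦ TangentSpace 𝓘(ℝ, E) x)]
    [IsRiemannianManifold 𝓘(ℝ, E) M] {g : Equiv.Perm M} (hg : IsIsometry E g) (x y : M) :
    edist (g x) (g y) ≤ edist x y := by
  have _ : IsManifold 𝓘(ℝ, E) 1 M := IsManifold.of_le (n := ∞) (by simp)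
  rw [IsRiemannianManifold.out (I := 𝓘(ℝ, E)) x y,
    IsRiemannianManifold.out (I := 𝓘(ℝ, E)) (g x) (g y)]
  refine le_of_forall_gt fun r hr ↦ ?_
  obtain ⟨γ, h0, h1, hγ, hlen⟩ := Manifold.exists_lt_of_riemannianEDist_lt hr
  have hg1 : ContMDiff 𝓘(ℝ, E) 𝓘(ℝ, E) 1 g := hg.contMDiff.of_le (by simp)
  refine (Manifold.riemannianEDist_le_pathELength (hg1.comp_contMDiffOn hγ) (by simp [h0])
    (by simp [h1]) zero_le_one).trans_lt (lt_of_le_of_lt (le_of_eq ?_) hlen)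
  rw [Manifold.pathELength_eq_lintegral_mfderiv_Ioo, Manifold.pathELength_eq_lintegral_mfderiv_Ioo]
  refine MeasureTheory.setLIntegral_congr_fun measurableSet_Ioo fun t ht ↦ ?_
  have hγt : MDifferentiableAt 𝓘(ℝ, ℝ) 𝓘(ℝ, E) γ t :=
    ((hγ t ⟨ht.1.le, ht.2.le⟩).contMDiffAt (Icc_mem_nhds ht.1 ht.2)).mdifferentiableAt (by simp)
  have := mfderiv_comp_apply t (hg1.mdifferentiable (by simp) (γ t)) hγt (1 : ℝ)
  refine (congrArg _ this).trans ?_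
  simp only [← ofReal_norm]
  congr 1
  exact hg.norm_map _ _

end Distance

/-! ### Isometries are determined by their 1-jets, and families of them inherit the smoothness of
these. -/

section Rigidity

open scoped Topology

variable {E : Type*} [NormedAddCommGroup E] [NormedSpace ℝ E] [FiniteDimensional ℝ E]
  {M : Type*} [EMetricSpace M] [ChartedSpace E M] [IsManifold 𝓘(ℝ, E) ∞ M]
  [RiemannianBundle (fun x : M ↦ TangentSpace 𝓘(ℝ, E) x)]
  [IsContMDiffRiemannianBundle 𝓘(ℝ, E) ∞ E (fun x : M ↦ TangentSpace 𝓘(ℝ, E) x)]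
  [IsRiemannianManifold 𝓘(ℝ, E) M]

/-- Near `x₀`, the isometries that map `x₀` close to `y₀` are expressed by one smooth function of
the point and of their one-jet at another point. -/
theorem exists_contDiff_eq_of_isIsometry (x₀ y₀ : M) :
    ∃ U ∈ 𝓝 x₀, IsOpen U ∧ U ⊆ (extChartAt 𝓘(ℝ, E) x₀).source ∧ ∃ ε > 0,
      ∃ Φ : E × E × E × (E →L[ℝ] E) → E, ContDiff ℝ ∞ Φ ∧
      ∀ g : Equiv.Perm M, IsIsometry E g → (∃ z ∈ U, edist (g z) y₀ < ε) →
        ∀ x ∈ U, g x ∈ (extChartAt 𝓘(ℝ, E) y₀).source ∧ ∀ q ∈ U,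
          extChartAt 𝓘(ℝ, E) y₀ (g x) = Φ (extChartAt 𝓘(ℝ, E) x₀ q,
            extChartAt 𝓘(ℝ, E) x₀ x - extChartAt 𝓘(ℝ, E) x₀ q, extChartAt 𝓘(ℝ, E) y₀ (g q),
            fderiv ℝ (chartRep E x₀ y₀ g) (extChartAt 𝓘(ℝ, E) x₀ q)) := by
  set φ := extChartAt 𝓘(ℝ, E) x₀ with hφ
  set ψ := extChartAt 𝓘(ℝ, E) y₀ with hψ
  obtain ⟨r', hr'0, hr'⟩ := Metric.nhds_basis_closedBall.mem_iff.1
    ((isOpen_extChartAt_target (I := 𝓘(ℝ, E)) y₀).mem_nhds (mem_extChartAt_target y₀))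
  have hV : ψ.source ∩ ψ ⁻¹' Metric.ball (ψ y₀) r' ∈ 𝓝 y₀ :=
    Filter.inter_mem (extChartAt_source_mem_nhds y₀)
      ((continuousAt_extChartAt y₀).preimage_mem_nhds (Metric.ball_mem_nhds _ hr'0))
  obtain ⟨δ, hδ0, hδ⟩ := EMetric.mem_nhds_iff.1 hV
  -- Points of `U` will be within `δ/4` of `x₀`, hence within `δ/2` of each other. If `g` sends one
  -- of them within `δ/2` of `y₀`, it sends all of `U` into the `δ`-ball, and so into the chart ball
  -- around `y₀`.
  have hδ2 : 0 < δ / 2 := ENNReal.half_pos hδ0.ne'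
  have hδ4 : 0 < δ / 2 / 2 := ENNReal.half_pos hδ2.ne'
  have hsymm : φ.symm ⁻¹' Metric.eball x₀ (δ / 2 / 2) ∈ 𝓝 (φ x₀) := by
    refine (continuousAt_extChartAt_symm x₀).preimage_mem_nhds ?_
    rw [extChartAt_to_inv]
    exact Metric.eball_mem_nhds _ hδ4
  obtain ⟨r, hr0, hr⟩ := Metric.nhds_basis_closedBall.mem_iff.1 (Filter.inter_mem
    ((isOpen_extChartAt_target (I := 𝓘(ℝ, E)) x₀).mem_nhds (mem_extChartAt_target x₀)) hsymm)
  obtain ⟨Φ, hΦ, hsol⟩ := exists_contDiff_eq_of_isometry (isMetricOn_chartMetric (E := E) x₀)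
    (isMetricOn_chartMetric (E := E) y₀) (fun z hz ↦ (hr hz).1) hr'
  have hUo : IsOpen (φ.source ∩ φ ⁻¹' Metric.ball (φ x₀) r) :=
    (continuousOn_extChartAt x₀).isOpen_inter_preimage (isOpen_extChartAt_source x₀)
      Metric.isOpen_ball
  have hxU : x₀ ∈ φ.source ∩ φ ⁻¹' Metric.ball (φ x₀) r :=
    ⟨mem_extChartAt_source x₀, Metric.mem_ball_self hr0⟩
  refine ⟨_, hUo.mem_nhds hxU, hUo, Set.inter_subset_left, δ / 2, hδ2, Φ, hΦ, ?_⟩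
  rintro g hg ⟨z, hz, hgz⟩
  have hball : ∀ x ∈ φ.source ∩ φ ⁻¹' Metric.ball (φ x₀) r, edist x x₀ < δ / 2 / 2 := by
    intro x hx
    have := (hr (Metric.ball_subset_closedBall hx.2)).2
    rw [Set.mem_preimage, φ.left_inv hx.1] at this
    exact this
  have hgU : ∀ x ∈ φ.source ∩ φ ⁻¹' Metric.ball (φ x₀) r,
      g x ∈ ψ.source ∩ ψ ⁻¹' Metric.ball (ψ y₀) r' := by
    intro x hx
    refine hδ ?_
    have h1 : edist x z < δ / 2 := by
      refine (edist_triangle_right x z x₀).trans_lt ?_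
      rw [← ENNReal.add_halves (δ / 2)]
      exact ENNReal.add_lt_add (hball x hx) (hball z hz)
    refine Metric.mem_eball.2 ((edist_triangle (g x) (g z) y₀).trans_lt ?_)
    rw [← ENNReal.add_halves δ]
    exact ENNReal.add_lt_add ((hg.edist_map_le x z).trans_lt h1) hgz
  have hmem : ∀ z ∈ Metric.ball (φ x₀) r, φ.symm z ∈ φ.source ∩ φ ⁻¹' Metric.ball (φ x₀) r := by
    intro z hz
    have hzt := (hr (Metric.ball_subset_closedBall hz)).1
    refine ⟨φ.map_target hzt, ?_⟩
    rw [Set.mem_preimage, φ.right_inv hzt]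
    exact hz
  intro x hx
  refine ⟨(hgU x hx).1, fun q hq ↦ ?_⟩
  have := hsol (chartRep E x₀ y₀ g)
    (fun z hz ↦ contDiffAt_chartRep hg.contMDiff (hr (Metric.ball_subset_closedBall hz)).1
      (hgU _ (hmem z hz)).1)
    (fun z hz ↦ (hgU _ (hmem z hz)).2)
    (fun z hz ↦ hg.chartMetric_map (hr (Metric.ball_subset_closedBall hz)).1
      (hgU _ (hmem z hz)).1)
    (φ q) hq.2 (φ x) hx.2
  rw [chartRep_apply _ hx.1, chartRep_apply _ hq.1] at this
  exact this

/-- Isometries of a connected manifold with the same one-jet at a point are equal. -/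
theorem IsIsometry.eq_of_tderiv_eq [PreconnectedSpace M] {g g' : Equiv.Perm M}
    (hg : IsIsometry E g) (hg' : IsIsometry E g') {p : M} (h0 : g p = g' p)
    (h1 : tderiv E E g p = tderiv E E g' p) : g = g' := by
  -- The neighbourhood `U` does not depend on the base point `q` of the jet. This makes the set of
  -- local agreement closed: near a limit point there is a `q` in `U` where the 1-jets agree.
  have key : ∀ x₀, g x₀ = g' x₀ → ∃ U ∈ 𝓝 x₀, ∀ q ∈ U, g q = g' q →
      tderiv E E g q = tderiv E E g' q → ∀ x ∈ U, g x = g' x := by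
    intro x₀ hx₀
    obtain ⟨U, hU, -, hUs, ε, hε, Φ, -, h⟩ := exists_contDiff_eq_of_isIsometry (E := E) x₀ (g x₀)
    refine ⟨U, hU, fun q hq e0 e1 x hx ↦ ?_⟩
    have hg1 := h g hg ⟨x₀, mem_of_mem_nhds hU, by simpa using hε⟩
    have hg2 := h g' hg' ⟨x₀, mem_of_mem_nhds hU, by simpa [hx₀] using hε⟩
    refine (extChartAt 𝓘(ℝ, E) (g x₀)).injOn (hg1 x hx).1 (hg2 x hx).1 ?_
    rw [(hg1 x hx).2 q hq, (hg2 x hx).2 q hq, e0]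
    congr 4
    ext v
    rw [fderiv_chartRep_of_mem_source hg (hUs hq) (hg1 q hq).1,
      fderiv_chartRep_of_mem_source hg' (hUs hq) (hg2 q hq).1, e1, e0]
  have hcont : Continuous g := hg.contMDiff.continuous
  have hcont' : Continuous g' := hg'.contMDiff.continuous
  have hclopen : IsClopen {x : M | g =ᶠ[𝓝 x] g'} := by
    refine ⟨isClosed_of_closure_subset fun x₀ hx₀ ↦ ?_, isOpen_setOfPred_eventually_nhds⟩
    have hx : g x₀ = g' x₀ := by
      have hsub : {x : M | g =ᶠ[𝓝 x] g'} ⊆ {x | g x = g' x} := fun x hx ↦ hx.self_of_nhds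
      exact closure_minimal hsub (isClosed_eq hcont hcont') hx₀
    obtain ⟨U, hU, h⟩ := key x₀ hx
    obtain ⟨q, hqU, hq⟩ := mem_closure_iff_nhds.1 hx₀ U hU
    exact Filter.eventually_of_mem hU (h q hqU hq.self_of_nhds (tderiv_congr hq))
  have hne : {x : M | g =ᶠ[𝓝 x] g'}.Nonempty := by
    obtain ⟨U, hU, h⟩ := key p h0
    exact ⟨p, Filter.eventually_of_mem hU (h p (mem_of_mem_nhds hU) h0 h1)⟩
  have huniv := hclopen.eq_univ hne
  ext x
  have : x ∈ {x : M | g =ᶠ[𝓝 x] g'} := huniv ▸ Set.mem_univ x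
  exact this.self_of_nhds

variable {N : Type*} [NormedAddCommGroup N] [NormedSpace ℝ N]

/-- A family of isometries whose one-jets along a smooth curve of base points are smooth is jointly
smooth near these points. -/
theorem eventually_contMDiffAt_of_jet {F : N → Equiv.Perm M} (hF : ∀ n, IsIsometry E (F n)) {n₀ : N}
    {x₀ y₀ : M} (hy : F n₀ x₀ = y₀) :
    ∃ U ∈ 𝓝 x₀, ∀ ξ : N → M, ξ n₀ ∈ U →
      (∀ᶠ n in 𝓝 n₀, ContMDiffAt 𝓘(ℝ, N) 𝓘(ℝ, E) ∞ ξ n) →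
      (∀ᶠ n in 𝓝 n₀, ContMDiffAt 𝓘(ℝ, N) 𝓘(ℝ, E) ∞ (fun n ↦ F n (ξ n)) n) →
      (∀ᶠ n in 𝓝 n₀, ContDiffAt ℝ ∞
        (fun n ↦ fderiv ℝ (chartRep E x₀ y₀ (F n)) (extChartAt 𝓘(ℝ, E) x₀ (ξ n))) n) →
      ∀ᶠ z in 𝓝 (n₀, x₀), ContMDiffAt (𝓘(ℝ, N).prod 𝓘(ℝ, E)) 𝓘(ℝ, E) ∞
        (fun z : N × M ↦ F z.1 z.2) z := by
  obtain ⟨U, hU, hUo, hUs, ε, hε, Φ, hΦ, h⟩ := exists_contDiff_eq_of_isIsometry (E := E) x₀ y₀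
  -- The ball keeps the image of the base point close to `y₀`, since `F n₀` does not increase
  -- distances.
  refine ⟨U ∩ Metric.eball x₀ ε, Filter.inter_mem hU (Metric.eball_mem_nhds _ hε), ?_⟩
  rintro ξ ⟨hξU, hξε⟩ h1 h2 h3
  have hUξ : ∀ᶠ n in 𝓝 n₀, ξ n ∈ U :=
    h1.self_of_nhds.continuousAt.preimage_mem_nhds (hUo.mem_nhds hξU)
  have hε' : ∀ᶠ n in 𝓝 n₀, edist (F n (ξ n)) y₀ < ε := by
    have : F n₀ (ξ n₀) ∈ Metric.eball y₀ ε :=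
      Metric.mem_eball.2 (hy ▸ ((hF n₀).edist_map_le _ _).trans_lt hξε)
    exact h2.self_of_nhds.continuousAt.preimage_mem_nhds (Metric.isOpen_eball.mem_nhds this)
  have hall := (((h1.and h2).and h3).and (hUξ.and hε')).eventually_nhds
  have hprod : ∀ᶠ z in 𝓝 (n₀, x₀), _ ∧ z.2 ∈ U := Filter.Eventually.and
    (continuous_fst.tendsto (n₀, x₀) |>.eventually hall)
    (continuous_snd.tendsto (n₀, x₀) |>.eventually (hUo.mem_nhds (mem_of_mem_nhds hU)))
  filter_upwards [hprod] with z hz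
  obtain ⟨hzn, hzU⟩ := hz
  obtain ⟨⟨⟨z1, z2⟩, z3⟩, zU, zε⟩ := hzn.self_of_nhds
  have hs1 := h (F z.1) (hF z.1) ⟨ξ z.1, zU, zε⟩
  have heq : (fun w : N × M ↦ F w.1 w.2) =ᶠ[𝓝 z] (fun w : N × M ↦ (extChartAt 𝓘(ℝ, E) y₀).symm
      (Φ (extChartAt 𝓘(ℝ, E) x₀ (ξ w.1), extChartAt 𝓘(ℝ, E) x₀ w.2 - extChartAt 𝓘(ℝ, E) x₀ (ξ w.1),
        extChartAt 𝓘(ℝ, E) y₀ (F w.1 (ξ w.1)),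
        fderiv ℝ (chartRep E x₀ y₀ (F w.1)) (extChartAt 𝓘(ℝ, E) x₀ (ξ w.1))))) := by
    filter_upwards [continuous_fst.tendsto z |>.eventually hzn,
      continuous_snd.tendsto z |>.eventually (hUo.mem_nhds hzU)] with w hw hwU
    obtain ⟨-, wU, wε⟩ := hw
    have := h (F w.1) (hF w.1) ⟨ξ w.1, wU, wε⟩ w.2 hwU
    rw [← this.2 _ wU]
    exact ((extChartAt 𝓘(ℝ, E) y₀).left_inv this.1).symm
  refine ContMDiffAt.congr_of_eventuallyEq ?_ heq
  have c1 : ContMDiffAt (𝓘(ℝ, N).prod 𝓘(ℝ, E)) 𝓘(ℝ, E) ∞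
      (fun w : N × M ↦ extChartAt 𝓘(ℝ, E) x₀ (ξ w.1)) z :=
    (contMDiffAt_extChartAt_of_mem (hUs zU)).comp z (z1.comp z contMDiffAt_fst)
  have c2 : ContMDiffAt (𝓘(ℝ, N).prod 𝓘(ℝ, E)) 𝓘(ℝ, E) ∞
      (fun w : N × M ↦ extChartAt 𝓘(ℝ, E) x₀ w.2) z :=
    (contMDiffAt_extChartAt_of_mem (hUs hzU)).comp z contMDiffAt_snd
  have c3 : ContMDiffAt (𝓘(ℝ, N).prod 𝓘(ℝ, E)) 𝓘(ℝ, E) ∞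
      (fun w : N × M ↦ extChartAt 𝓘(ℝ, E) y₀ (F w.1 (ξ w.1))) z :=
    (contMDiffAt_extChartAt_of_mem (hs1 _ zU).1).comp z (z2.comp z contMDiffAt_fst)
  have c4 : ContMDiffAt (𝓘(ℝ, N).prod 𝓘(ℝ, E)) 𝓘(ℝ, E →L[ℝ] E) ∞
      (fun w : N × M ↦ fderiv ℝ (chartRep E x₀ y₀ (F w.1)) (extChartAt 𝓘(ℝ, E) x₀ (ξ w.1))) z :=
    z3.contMDiffAt.comp z contMDiffAt_fst
  have c5 := c1.prodMk_space ((c2.sub c1).prodMk_space (c3.prodMk_space c4))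
  have c6 := hΦ.contMDiff.contMDiffAt.comp z c5
  refine ContMDiffAt.comp z (contMDiffAt_extChartAt_symm ?_) c6
  have := (hs1 z.2 hzU).2 _ zU
  exact (congrArg (· ∈ (extChartAt 𝓘(ℝ, E) y₀).target) this).mp
    ((extChartAt 𝓘(ℝ, E) y₀).map_source (hs1 z.2 hzU).1)

/-- A family of isometries which is jointly smooth near one point is so near all points. -/
theorem eventually_contMDiffAt_of_eventually [PreconnectedSpace M] {F : N → Equiv.Perm M}
    (hF : ∀ n, IsIsometry E (F n)) {n₀ : N} {x₁ : M}
    (h : ∀ᶠ z in 𝓝 (n₀, x₁), ContMDiffAt (𝓘(ℝ, N).prod 𝓘(ℝ, E)) 𝓘(ℝ, E) ∞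
        (fun z : N × M ↦ F z.1 z.2) z) (x₀ : M) :
    ∀ᶠ z in 𝓝 (n₀, x₀), ContMDiffAt (𝓘(ℝ, N).prod 𝓘(ℝ, E)) 𝓘(ℝ, E) ∞
        (fun z : N × M ↦ F z.1 z.2) z := by
  set S : Set M := {x | ∀ᶠ z in 𝓝 (n₀, x), ContMDiffAt (𝓘(ℝ, N).prod 𝓘(ℝ, E)) 𝓘(ℝ, E) ∞
        (fun z : N × M ↦ F z.1 z.2) z} with hS
  have hopen : IsOpen S :=
    isOpen_setOfPred_eventually_nhds.preimage (Continuous.prodMk_right n₀)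
  have hclosed : IsClosed S := by
    refine isClosed_of_closure_subset fun y hy ↦ ?_
    obtain ⟨U, hU, hfam⟩ := eventually_contMDiffAt_of_jet hF (n₀ := n₀) (x₀ := y) rfl
    -- At a nearby point `q` where joint smoothness is known, the 1-jet of `F n` at `q` is smooth in
    -- `n`. It serves as the initial data that carry the smoothness to `y`.
    obtain ⟨q, ⟨⟨hqU, hqs⟩, hqt⟩, hq⟩ := mem_closure_iff_nhds.1 hy _
      (Filter.inter_mem (Filter.inter_mem hU
      (extChartAt_source_mem_nhds (I := 𝓘(ℝ, E)) y))
      ((hF n₀).contMDiff.continuous.continuousAt.preimage_mem_nhds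
        (extChartAt_source_mem_nhds (I := 𝓘(ℝ, E)) (F n₀ y))))
    have hpair : Filter.Tendsto (fun n : N ↦ (n, q)) (𝓝 n₀) (𝓝 (n₀, q)) :=
      (Continuous.prodMk_left q).tendsto n₀
    have hFq : ∀ᶠ n in 𝓝 n₀, ContMDiffAt 𝓘(ℝ, N) 𝓘(ℝ, E) ∞ (fun n ↦ F n q) n := by
      filter_upwards [hpair.eventually hq] with n hn
      exact ContMDiffAt.comp (x := n) (f := fun n ↦ (n, q)) (g := fun z : N × M ↦ F z.1 z.2) hn
        (contMDiffAt_id.prodMk contMDiffAt_const)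
    refine hfam (fun _ ↦ q) hqU (Filter.Eventually.of_forall fun _ ↦ contMDiffAt_const) hFq ?_
    have hsrc : ∀ᶠ n in 𝓝 n₀, F n q ∈ (extChartAt 𝓘(ℝ, E) (F n₀ y)).source :=
      hFq.self_of_nhds.continuousAt.preimage_mem_nhds ((isOpen_extChartAt_source _).mem_nhds hqt)
    filter_upwards [hpair.eventually hq, hsrc] with n hn hns
    refine ContDiffAt.fderiv (n := ∞) (f := fun n ↦ chartRep E y (F n₀ y) (F n))
      (g := fun _ ↦ extChartAt 𝓘(ℝ, E) y q) ?_ contDiffAt_const (by simp)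
    rw [← contMDiffAt_iff_contDiffAt]
    have hqt' := (extChartAt 𝓘(ℝ, E) y).map_source hqs
    have c1 : ContMDiffAt 𝓘(ℝ, N × E) (𝓘(ℝ, N).prod 𝓘(ℝ, E)) ∞
        (fun w : N × E ↦ (w.1, (extChartAt 𝓘(ℝ, E) y).symm w.2)) (n, extChartAt 𝓘(ℝ, E) y q) :=
      ContMDiffAt.prodMk (contDiff_fst.contMDiff.contMDiffAt) (ContMDiffAt.comp
        (n, extChartAt 𝓘(ℝ, E) y q) (contMDiffAt_extChartAt_symm hqt')
          contDiff_snd.contMDiff.contMDiffAt)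
    have c2 : ContMDiffAt 𝓘(ℝ, N × E) 𝓘(ℝ, E) ∞
        (fun w : N × E ↦ F w.1 ((extChartAt 𝓘(ℝ, E) y).symm w.2)) (n, extChartAt 𝓘(ℝ, E) y q) :=
      ContMDiffAt.comp (g := fun z : N × M ↦ F z.1 z.2) (n, extChartAt 𝓘(ℝ, E) y q)
        (by simpa only [(extChartAt 𝓘(ℝ, E) y).left_inv hqs] using hn) c1
    exact ContMDiffAt.comp (n, extChartAt 𝓘(ℝ, E) y q) (contMDiffAt_extChartAt_of_mem
      (by simpa only [Function.comp_apply, (extChartAt 𝓘(ℝ, E) y).left_inv hqs] using hns)) c2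
  have := IsClopen.eq_univ ⟨hclosed, hopen⟩ ⟨x₁, h⟩
  exact Set.eq_univ_iff_forall.1 this x₀

end Rigidity

/-! ### Isometries, symmetries and the transvection group. -/

section IsometryGroup

variable {E : Type*} [NormedAddCommGroup E] [NormedSpace ℝ E]
  {M : Type*} [TopologicalSpace M] [ChartedSpace E M]

theorem tderiv_one (x : M) (v : E) : tderiv E E (1 : Equiv.Perm M) x v = v := by
  rw [Equiv.Perm.coe_one, tderiv_id]; rfl

variable [RiemannianBundle (fun x : M ↦ TangentSpace 𝓘(ℝ, E) x)]

theorem isIsometry_of_metricForm {g : Equiv.Perm M} (h1 : ContMDiff 𝓘(ℝ, E) 𝓘(ℝ, E) ∞ g)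
    (h2 : ContMDiff 𝓘(ℝ, E) 𝓘(ℝ, E) ∞ (g⁻¹ : Equiv.Perm M))
    (h3 : ∀ (x : M) (v w : E), metricForm E (g x) (tderiv E E g x v) (tderiv E E g x w) =
      metricForm E x v w) : IsIsometry E g :=
  ⟨h1, h2, h3⟩

theorem IsIsometry.mdifferentiableAt {g : Equiv.Perm M} (hg : IsIsometry E g) (x : M) :
    MDifferentiableAt 𝓘(ℝ, E) 𝓘(ℝ, E) g x :=
  hg.contMDiff.contMDiffAt.mdifferentiableAt (by simp)

theorem IsIsometry.mdifferentiableAt_inv {g : Equiv.Perm M} (hg : IsIsometry E g) (x : M) :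
    MDifferentiableAt 𝓘(ℝ, E) 𝓘(ℝ, E) (g⁻¹ : Equiv.Perm M) x :=
  hg.contMDiff_inv.contMDiffAt.mdifferentiableAt (by simp)

theorem IsIsometry.tderiv_mul {g g' : Equiv.Perm M} (hg : IsIsometry E g) (hg' : IsIsometry E g')
    (x : M) (v : E) :
    tderiv E E (g * g' : Equiv.Perm M) x v = tderiv E E g (g' x) (tderiv E E g' x v) := by
  rw [Equiv.Perm.coe_mul, tderiv_comp_apply (hg.mdifferentiableAt _) (hg'.mdifferentiableAt _)]

theorem IsIsometry.one : IsIsometry E (1 : Equiv.Perm M) :=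
  isIsometry_of_metricForm contMDiff_id contMDiff_id fun x v w ↦ by
    rw [tderiv_one, tderiv_one]; rfl

theorem IsIsometry.mul {g g' : Equiv.Perm M} (hg : IsIsometry E g) (hg' : IsIsometry E g') :
    IsIsometry E (g * g') :=
  isIsometry_of_metricForm (hg.contMDiff.comp hg'.contMDiff)
    (by rw [mul_inv_rev]; exact hg'.contMDiff_inv.comp hg.contMDiff_inv) fun x v w ↦ by
    rw [hg.tderiv_mul hg', hg.tderiv_mul hg', Equiv.Perm.mul_apply, hg.metricForm_map,
      hg'.metricForm_map]

theorem IsIsometry.tderiv_apply_inv {g : Equiv.Perm M} (hg : IsIsometry E g) (x : M) (v : E) :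
    tderiv E E g (g⁻¹ x) (tderiv E E (g⁻¹ : Equiv.Perm M) x v) = v := by
  rw [← tderiv_comp_apply (hg.mdifferentiableAt _) (hg.mdifferentiableAt_inv _),
    ← Equiv.Perm.coe_mul, mul_inv_cancel, tderiv_one]

theorem IsIsometry.tderiv_inv_apply {g : Equiv.Perm M} (hg : IsIsometry E g) (x : M) (v : E) :
    tderiv E E (g⁻¹ : Equiv.Perm M) (g x) (tderiv E E g x v) = v := by
  rw [← tderiv_comp_apply (hg.mdifferentiableAt_inv _) (hg.mdifferentiableAt _),
    ← Equiv.Perm.coe_mul, inv_mul_cancel, tderiv_one]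

theorem IsIsometry.inv {g : Equiv.Perm M} (hg : IsIsometry E g) : IsIsometry E g⁻¹ :=
  isIsometry_of_metricForm hg.contMDiff_inv (by rw [inv_inv]; exact hg.contMDiff) fun x v w ↦ by
    rw [← hg.metricForm_map, hg.tderiv_apply_inv, hg.tderiv_apply_inv, Equiv.Perm.coe_inv,
      Equiv.apply_symm_apply]

theorem IsSymmetryAt.tderiv_eq {p : M} {s : Equiv.Perm M} (hs : IsSymmetryAt E p s) (v : E) :
    tderiv E E s p v = -v :=
  hs.mfderiv_eq v

theorem IsSymmetryAt.conj {p : M} {s g : Equiv.Perm M} (hs : IsSymmetryAt E p s)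
    (hg : IsIsometry E g) : IsSymmetryAt E (g p) (g * s * g⁻¹) where
  isIsometry := (hg.mul hs.isIsometry).mul hg.inv
  map_self := by simp [hs.map_self]
  mfderiv_eq v := by
    have h1 := (hg.mul hs.isIsometry).tderiv_mul hg.inv (g p) v
    have h2 : g⁻¹ (g p) = p := by simp
    rw [hg.tderiv_mul hs.isIsometry, h2, hs.map_self, hs.tderiv_eq, map_neg] at h1
    have h3 := hg.tderiv_apply_inv (g p) v
    rw [h2] at h3
    rw [h3] at h1
    exact h1

theorem isIsometry_of_mem_transvectionGroup {g : Equiv.Perm M} (hg : g ∈ transvectionGroup E M) :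
    IsIsometry E g := by
  induction hg using Subgroup.closure_induction with
  | mem t ht =>
    obtain ⟨p, q, s, s', hs, hs', rfl⟩ := ht
    exact hs.isIsometry.mul hs'.isIsometry
  | one => exact IsIsometry.one
  | mul x y _ _ hx hy => exact hx.mul hy
  | inv x _ hx => exact hx.inv

/-- Conjugation by an isometry permutes the symmetries, hence the generators. It lets `s_p`, which
need not belong to the group, act on its Lie algebra. -/
theorem conj_mem_transvectionGroup {g t : Equiv.Perm M} (hg : IsIsometry E g)
    (ht : t ∈ transvectionGroup E M) : g * t * g⁻¹ ∈ transvectionGroup E M := by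
  induction ht using Subgroup.closure_induction with
  | mem t ht =>
    obtain ⟨p, q, s, s', hs, hs', rfl⟩ := ht
    exact Subgroup.subset_closure ⟨g p, g q, _, _, hs.conj hg, hs'.conj hg, by group⟩
  | one => simp
  | mul x y _ _ hx hy =>
    have := Subgroup.mul_mem _ hx hy
    simpa [mul_assoc] using this
  | inv x _ hx =>
    have := Subgroup.inv_mem _ hx
    simpa [mul_assoc] using this

/-- The symmetry at a point of a symmetric space. -/
def IsSymmetricSpace.symm (hM : IsSymmetricSpace E M) (p : M) : Equiv.Perm M :=
  Classical.choose (hM p)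

theorem IsSymmetricSpace.isSymmetryAt (hM : IsSymmetricSpace E M) (p : M) :
    IsSymmetryAt E p (hM.symm p) :=
  Classical.choose_spec (hM p)

theorem IsSymmetricSpace.isIsometry_symm (hM : IsSymmetricSpace E M) (p : M) :
    IsIsometry E (hM.symm p) :=
  (hM.isSymmetryAt p).isIsometry

theorem IsSymmetricSpace.symm_self (hM : IsSymmetricSpace E M) (p : M) : hM.symm p p = p :=
  (hM.isSymmetryAt p).map_self

theorem IsSymmetricSpace.symm_mul_symm_mem (hM : IsSymmetricSpace E M) (p q : M) :
    hM.symm p * hM.symm q ∈ transvectionGroup E M :=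
  Subgroup.subset_closure ⟨p, q, _, _, hM.isSymmetryAt p, hM.isSymmetryAt q, rfl⟩

end IsometryGroup

/-! ### Uniqueness of the symmetries and their smooth dependence on the centre. -/

section SymmetrySmooth

open scoped Topology

variable {E : Type*} [NormedAddCommGroup E] [NormedSpace ℝ E] [FiniteDimensional ℝ E]
  {M : Type*} [EMetricSpace M] [ChartedSpace E M] [IsManifold 𝓘(ℝ, E) ∞ M]
  [RiemannianBundle (fun x : M ↦ TangentSpace 𝓘(ℝ, E) x)]
  [IsContMDiffRiemannianBundle 𝓘(ℝ, E) ∞ E (fun x : M ↦ TangentSpace 𝓘(ℝ, E) x)]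
  [IsRiemannianManifold 𝓘(ℝ, E) M] [PreconnectedSpace M]

theorem IsSymmetryAt.unique {p : M} {s s' : Equiv.Perm M} (hs : IsSymmetryAt E p s)
    (hs' : IsSymmetryAt E p s') : s = s' :=
  hs.isIsometry.eq_of_tderiv_eq hs'.isIsometry (hs.map_self.trans hs'.map_self.symm)
    (by ext v; rw [hs.tderiv_eq, hs'.tderiv_eq])

theorem IsSymmetricSpace.conj_symm (hM : IsSymmetricSpace E M) {g : Equiv.Perm M}
    (hg : IsIsometry E g) (p : M) : g * hM.symm p * g⁻¹ = hM.symm (g p) :=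
  ((hM.isSymmetryAt p).conj hg).unique (hM.isSymmetryAt (g p))

theorem IsSymmetricSpace.symm_mul_self (hM : IsSymmetricSpace E M) (p : M) :
    hM.symm p * hM.symm p = 1 := by
  have hs := hM.isIsometry_symm p
  refine (hs.mul hs).eq_of_tderiv_eq IsIsometry.one (p := p) (by simp [hM.symm_self]) ?_
  ext v
  rw [hs.tderiv_mul hs, hM.symm_self, (hM.isSymmetryAt p).tderiv_eq,
    (hM.isSymmetryAt p).tderiv_eq, neg_neg, tderiv_one]

theorem IsSymmetricSpace.symm_symm_apply (hM : IsSymmetricSpace E M) (p x : M) :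
    hM.symm p (hM.symm p x) = x :=
  DFunLike.congr_fun (hM.symm_mul_self p) x

/-- The symmetry at `q` applied to `x` is a smooth function of `(q, x)`. -/
theorem IsSymmetricSpace.contMDiff_symm (hM : IsSymmetricSpace E M) :
    ContMDiff (𝓘(ℝ, E).prod 𝓘(ℝ, E)) 𝓘(ℝ, E) ∞ (fun z : M × M ↦ hM.symm z.1 z.2) := by
  rintro ⟨q₀, x₀⟩
  set φ := extChartAt 𝓘(ℝ, E) q₀ with hφ
  set F : E → Equiv.Perm M := fun n ↦ hM.symm (φ.symm n) with hFdef
  have hF : ∀ n, IsIsometry E (F n) := fun n ↦ hM.isIsometry_symm _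
  have hq : φ.symm (φ q₀) = q₀ := extChartAt_to_inv q₀
  have hF0 : F (φ q₀) q₀ = q₀ := by simp only [hFdef, hq, hM.symm_self]
  have htar : ∀ᶠ n in 𝓝 (φ q₀), n ∈ φ.target :=
    (isOpen_extChartAt_target q₀).mem_nhds (mem_extChartAt_target q₀)
  obtain ⟨U, hU, h⟩ := eventually_contMDiffAt_of_jet hF hF0
  have h1 : ∀ᶠ n in 𝓝 (φ q₀), ContMDiffAt 𝓘(ℝ, E) 𝓘(ℝ, E) ∞ φ.symm n :=
    htar.mono fun n hn ↦ contMDiffAt_extChartAt_symm hn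
  -- The base point moves with the centre: the symmetry at `q` has value `q` and derivative `-id` at
  -- `q`, so in the chart these 1-jets depend smoothly on `q`.
  have hstart := h φ.symm (by rw [hq]; exact mem_of_mem_nhds hU) h1
    (by simpa only [hFdef, hM.symm_self] using h1) (by
      have : ∀ᶠ n in 𝓝 (φ q₀), (fun n ↦ fderiv ℝ (chartRep E q₀ q₀ (F n)) (φ (φ.symm n))) =ᶠ[𝓝 n]
          fun _ ↦ -ContinuousLinearMap.id ℝ E := by
        refine Filter.Eventually.eventually_nhds (htar.mono fun n hn ↦ ?_)
        ext v
        have hsrc := φ.map_target hn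
        have hfix : F n (φ.symm n) = φ.symm n := hM.symm_self _
        rw [fderiv_chartRep_of_mem_source (hF n) hsrc (by rwa [hfix]), hfix, φ.right_inv hn,
          (hM.isSymmetryAt (φ.symm n)).tderiv_eq, map_neg, tderiv_extChartAt_comp_symm hn]
        rfl
      filter_upwards [this] with n hn
      exact contDiffAt_const.congr_of_eventuallyEq hn)
  have hext := (eventually_contMDiffAt_of_eventually hF hstart x₀).self_of_nhds
  have hcomp : ContMDiffAt (𝓘(ℝ, E).prod 𝓘(ℝ, E)) 𝓘(ℝ, E) ∞
      (fun z : M × M ↦ F (φ z.1) z.2) (q₀, x₀) :=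
    ContMDiffAt.comp (g := fun z : E × M ↦ F z.1 z.2) (f := fun z : M × M ↦ (φ z.1, z.2)) (q₀, x₀)
      hext (((contMDiffAt_extChartAt (I := 𝓘(ℝ, E)) (x := q₀)).comp (q₀, x₀) contMDiffAt_fst).prodMk
        contMDiffAt_snd)
  refine hcomp.congr_of_eventuallyEq ?_
  have hs : ∀ᶠ z in 𝓝 (q₀, x₀), z.1 ∈ φ.source :=
    continuous_fst.tendsto (q₀, x₀) |>.eventually (extChartAt_source_mem_nhds q₀)
  filter_upwards [hs] with z hz
  simp only [hFdef, φ.left_inv hz]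

end SymmetrySmooth

/-! ### Interchanging the time derivative and the space derivative. -/

section MixedDerivative

open scoped Topology

variable {E F : Type*} [NormedAddCommGroup E] [NormedSpace ℝ E] [NormedAddCommGroup F]
  [NormedSpace ℝ F]

/-- Symmetry of the second derivative. Applied to a curve of isometries, it says that the
derivatives of the isometries move with velocity the derivative of the velocity field. -/
theorem hasDerivAt_fderiv_partial {f : ℝ × E → F} {z : E} (hf : ContDiffAt ℝ 2 f (0, z)) :
    HasDerivAt (fun t : ℝ ↦ fderiv ℝ (fun y ↦ f (t, y)) z)
      (fderiv ℝ (fun y ↦ fderiv ℝ f (0, y) (1, 0)) z) 0 := by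
  have hd : ∀ᶠ u in 𝓝 ((0 : ℝ), z), DifferentiableAt ℝ f u := by
    filter_upwards [hf.eventually (by simp)] with u hu
    exact hu.differentiableAt (by simp)
  have hD : HasFDerivAt (fderiv ℝ f) (fderiv ℝ (fderiv ℝ f) (0, z)) (0, z) :=
    ((hf.fderiv_right (m := 1) (by norm_num)).differentiableAt (by simp)).hasFDerivAt
  have hsymm : IsSymmSndFDerivAt ℝ f (0, z) := hf.isSymmSndFDerivAt (by simp)
  have h1 : (fun t : ℝ ↦ fderiv ℝ (fun y ↦ f (t, y)) z) =ᶠ[𝓝 0]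
      fun t ↦ (fderiv ℝ f (t, z)).comp (ContinuousLinearMap.inr ℝ ℝ E) := by
    have : Filter.Tendsto (fun t : ℝ ↦ (t, z)) (𝓝 0) (𝓝 (0, z)) :=
      (continuous_id.prodMk continuous_const).tendsto 0
    filter_upwards [this.eventually hd] with t ht
    exact (ht.hasFDerivAt.comp z (hasFDerivAt_prodMk_right t z)).fderiv
  have h2 : HasDerivAt (fun t : ℝ ↦ fderiv ℝ f (t, z)) (fderiv ℝ (fderiv ℝ f) (0, z) (1, 0)) 0 :=
    hD.comp_hasDerivAt 0 ((hasDerivAt_id (0 : ℝ)).prodMk (hasDerivAt_const (0 : ℝ) z))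
  have h3 : HasFDerivAt (fun y ↦ fderiv ℝ f (0, y) (1, 0))
      (((fderiv ℝ (fderiv ℝ f) (0, z)).flip (1, 0)).comp (ContinuousLinearMap.inr ℝ ℝ E)) z := by
    have h4 : HasFDerivAt (fun y ↦ fderiv ℝ f (0, y))
        ((fderiv ℝ (fderiv ℝ f) (0, z)).comp (ContinuousLinearMap.inr ℝ ℝ E)) z :=
      hD.comp z (hasFDerivAt_prodMk_right (0 : ℝ) z)
    refine (h4.clm_apply (hasFDerivAt_const ((1 : ℝ), (0 : E)) z)).congr_fderiv ?_
    ext v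
    simp
  have h5 : HasDerivAt (fun t : ℝ ↦ (fderiv ℝ f (t, z)).comp (ContinuousLinearMap.inr ℝ ℝ E))
      ((fderiv ℝ (fderiv ℝ f) (0, z) (1, 0)).comp (ContinuousLinearMap.inr ℝ ℝ E)) 0 :=
    (ContinuousLinearMap.hasFDerivAt
      ((ContinuousLinearMap.compL ℝ E (ℝ × E) F).flip (ContinuousLinearMap.inr ℝ ℝ E)))
        |>.comp_hasDerivAt 0 h2
  refine (h5.congr_of_eventuallyEq h1).congr_deriv ?_
  rw [h3.fderiv]
  ext v
  exact hsymm.eq _ _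

end MixedDerivative

/-! ### Vector fields and their brackets in charts. -/

section FieldRep

open scoped Topology

variable {E : Type*} [NormedAddCommGroup E] [NormedSpace ℝ E]
  {M : Type*} [TopologicalSpace M] [ChartedSpace E M]

/-- The value of a vector field at `x`, as an element of the model space. -/
def evalAt (x : M) : VectorFields E M →ₗ[ℝ] E where
  toFun X := X x
  map_add' _ _ := rfl
  map_smul' _ _ := rfl

theorem evalAt_apply (x : M) (X : VectorFields E M) : evalAt x X = X x := rfl

theorem VectorFields.ext_evalAt {X Y : VectorFields E M} (h : ∀ x, evalAt x X = evalAt x Y) :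
    X = Y :=
  funext h

/-- The expression of a vector field in the chart around `x₀`. -/
def fieldRep (x₀ : M) : VectorFields E M →ₗ[ℝ] (E → E) where
  toFun X z := tderiv E E (extChartAt 𝓘(ℝ, E) x₀) ((extChartAt 𝓘(ℝ, E) x₀).symm z)
    (evalAt ((extChartAt 𝓘(ℝ, E) x₀).symm z) X)
  map_add' X Y := by
    ext z
    simp
  map_smul' a X := by
    ext z
    simp

theorem fieldRep_apply (x₀ : M) (X : VectorFields E M) (z : E) : fieldRep x₀ X z =
    tderiv E E (extChartAt 𝓘(ℝ, E) x₀) ((extChartAt 𝓘(ℝ, E) x₀).symm z)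
      (evalAt ((extChartAt 𝓘(ℝ, E) x₀).symm z) X) := rfl

theorem fieldRep_extChartAt {x₀ x : M} (X : VectorFields E M)
    (hx : x ∈ (extChartAt 𝓘(ℝ, E) x₀).source) : fieldRep x₀ X (extChartAt 𝓘(ℝ, E) x₀ x) =
    tderiv E E (extChartAt 𝓘(ℝ, E) x₀) x (evalAt x X) := by
  rw [fieldRep_apply, (extChartAt 𝓘(ℝ, E) x₀).left_inv hx]

theorem fieldRep_eq_zero_iff [IsManifold 𝓘(ℝ, E) ∞ M] {x₀ x : M} (X : VectorFields E M)
    (hx : x ∈ (extChartAt 𝓘(ℝ, E) x₀).source) :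
    fieldRep x₀ X (extChartAt 𝓘(ℝ, E) x₀ x) = 0 ↔ evalAt x X = 0 := by
  rw [fieldRep_extChartAt X hx]
  refine ⟨fun h ↦ ?_, fun h ↦ by rw [h, map_zero]⟩
  rw [← tderiv_extChartAt_symm_comp hx (evalAt x X), h, map_zero]

theorem tderiv_extChartAt_self [IsManifold 𝓘(ℝ, E) ∞ M] (x : M) (v : E) :
    tderiv E E (extChartAt 𝓘(ℝ, E) x) x v = v := by
  have _ : IsManifold 𝓘(ℝ, E) 1 M := IsManifold.of_le (n := ∞) (by simp)
  exact DFunLike.congr_fun (mfderiv_extChartAt_self (I := 𝓘(ℝ, E)) (x := x)) v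

theorem tderiv_extChartAt_symm_self [IsManifold 𝓘(ℝ, E) ∞ M] (x : M) (v : E) :
    tderiv E E (extChartAt 𝓘(ℝ, E) x).symm (extChartAt 𝓘(ℝ, E) x x) v = v := by
  have := tderiv_extChartAt_symm_comp (mem_extChartAt_source (I := 𝓘(ℝ, E)) x) v
  rwa [tderiv_extChartAt_self] at this

theorem fieldRep_extChartAt_self [IsManifold 𝓘(ℝ, E) ∞ M] (x : M) (X : VectorFields E M) :
    fieldRep x X (extChartAt 𝓘(ℝ, E) x x) = evalAt x X := by
  rw [fieldRep_extChartAt X (mem_extChartAt_source x), tderiv_extChartAt_self]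

theorem mpullback_extChartAt_symm [IsManifold 𝓘(ℝ, E) ∞ M] (X : VectorFields E M) {x₀ : M} {z : E}
    (hz : z ∈ (extChartAt 𝓘(ℝ, E) x₀).target) :
    VectorField.mpullbackWithin 𝓘(ℝ, E) 𝓘(ℝ, E) (extChartAt 𝓘(ℝ, E) x₀).symm X Set.univ z =
      fieldRep x₀ X z := by
  rw [VectorField.mpullbackWithin_univ, VectorField.mpullback_apply]
  have hs := (extChartAt 𝓘(ℝ, E) x₀).map_target hz
  have h : ContinuousLinearMap.inverse (tderiv E E (extChartAt 𝓘(ℝ, E) x₀).symm z) =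
      tderiv E E (extChartAt 𝓘(ℝ, E) x₀) ((extChartAt 𝓘(ℝ, E) x₀).symm z) := by
    refine ContinuousLinearMap.inverse_eq ?_ ?_
    · ext v
      have := tderiv_extChartAt_symm_comp hs v
      rwa [(extChartAt 𝓘(ℝ, E) x₀).right_inv hz] at this
    · ext v
      exact tderiv_extChartAt_comp_symm hz v
  exact DFunLike.congr_fun h (X ((extChartAt 𝓘(ℝ, E) x₀).symm z))

/-- The chart centred at `x` has identity differential at `x`, so the coordinate formula for the
bracket needs no change of frame there. -/
theorem mlieBracket_eq_fieldRep [IsManifold 𝓘(ℝ, E) ∞ M] (X Y : VectorFields E M) (x : M) :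
    evalAt x (VectorField.mlieBracket 𝓘(ℝ, E) X Y) =
      fderiv ℝ (fieldRep x Y) (extChartAt 𝓘(ℝ, E) x x) (evalAt x X) -
        fderiv ℝ (fieldRep x X) (extChartAt 𝓘(ℝ, E) x x) (evalAt x Y) := by
  have h1 : ∀ Z : VectorFields E M, VectorField.mpullbackWithin 𝓘(ℝ, E) 𝓘(ℝ, E)
      (extChartAt 𝓘(ℝ, E) x).symm Z Set.univ =ᶠ[𝓝 (extChartAt 𝓘(ℝ, E) x x)] fieldRep x Z := by
    intro Z
    filter_upwards [(isOpen_extChartAt_target x).mem_nhds (mem_extChartAt_target x)] with z hz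
    exact mpullback_extChartAt_symm Z hz
  have h2 : ContinuousLinearMap.inverse (tderiv E E (extChartAt 𝓘(ℝ, E) x) x) =
      ContinuousLinearMap.id ℝ E := by
    have : tderiv E E (extChartAt 𝓘(ℝ, E) x) x = ContinuousLinearMap.id ℝ E := by
      ext v
      exact tderiv_extChartAt_self x v
    rw [this, ContinuousLinearMap.inverse_id]
  have h3 : ∀ Z : VectorFields E M, fieldRep x Z (extChartAt 𝓘(ℝ, E) x x) = evalAt x Z := fun Z ↦
    fieldRep_extChartAt_self x Z
  rw [evalAt_apply, ← VectorField.mlieBracketWithin_univ, VectorField.mlieBracketWithin_apply]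
  refine (DFunLike.congr_fun h2 _).trans ?_
  rw [ModelWithCorners.range_eq_univ, Set.preimage_univ, Set.univ_inter]
  refine (congrFun VectorField.lieBracketWithin_univ _).trans ?_
  refine ((h1 X).lieBracket_vectorField_eq (h1 Y)).trans ?_
  change fderiv ℝ (fieldRep x Y) _ (fieldRep x X _) - fderiv ℝ (fieldRep x X) _ (fieldRep x Y _) = _
  rw [h3, h3]

end FieldRep

/-! ### Velocities of curves of transformations. -/

section Velocity

open scoped Topology

variable {E : Type*} [NormedAddCommGroup E] [NormedSpace ℝ E]
  {M : Type*} [TopologicalSpace M] [ChartedSpace E M]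
  {G : Subgroup (Equiv.Perm M)} {c : ℝ → Equiv.Perm M} {X : VectorFields E M}

/-- The expression of a curve of transformations in the chart around `x₀`. -/
def curveRep (E : Type*) [NormedAddCommGroup E] [NormedSpace ℝ E] [ChartedSpace E M] (x₀ : M)
    (c : ℝ → Equiv.Perm M) (u : ℝ × E) : E :=
  chartRep E x₀ x₀ (c u.1) u.2

theorem IsVelocityOf.tderiv_curve (h : IsVelocityOf G c X) (x : M) :
    tderiv ℝ E (fun t : ℝ ↦ c t x) 0 1 = evalAt x X := by
  refine (h.velocity x).trans ?_
  rw [h.map_zero]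
  rfl

theorem IsVelocityOf.contMDiff_curve (h : IsVelocityOf G c X) (x : M) :
    ContMDiff 𝓘(ℝ, ℝ) 𝓘(ℝ, E) ∞ (fun t ↦ c t x) :=
  h.contMDiff.comp (contMDiff_id.prodMk contMDiff_const)

/-- The velocity at `0` sees only `ρ 0 = 0` and `ρ' 0 = 1`. A bounded `ρ` confines the curve to
small times while keeping it defined on all of `ℝ`. -/
theorem IsVelocityOf.reparametrize {G : Subgroup (Equiv.Perm M)} {c : ℝ → Equiv.Perm M}
    {X : VectorFields E M} (hc : IsVelocityOf G c X) {ρ : ℝ → ℝ} (hρ : ContDiff ℝ ∞ ρ)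
    (hρ0 : ρ 0 = 0) (hρ1 : HasDerivAt ρ 1 0) : IsVelocityOf G (fun t ↦ c (ρ t)) X where
  mem t := hc.mem _
  map_zero := by rw [hρ0, hc.map_zero]
  contMDiff := hc.contMDiff.comp ((hρ.contMDiff.comp contMDiff_fst).prodMk contMDiff_snd)
  velocity x := by
    have h1 := tderiv_comp_apply (f := ρ) (hc.mdifferentiable_curve x (ρ 0))
      hρ1.differentiableAt.mdifferentiableAt (1 : ℝ)
    refine h1.trans ?_
    rw [tderiv_eq_fderiv, fderiv_apply_one_eq_deriv, hρ1.deriv, hρ0, hc.tderiv_curve, hc.map_zero]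
    rfl

variable [IsManifold 𝓘(ℝ, E) ∞ M]

theorem IsVelocityOf.contDiffAt_curveRep (h : IsVelocityOf G c X) {x₀ : M} {z : E}
    (hz : z ∈ (extChartAt 𝓘(ℝ, E) x₀).target) : ContDiffAt ℝ ∞ (curveRep E x₀ c) (0, z) := by
  have h1 : ContMDiffAt (𝓘(ℝ, ℝ).prod 𝓘(ℝ, E)) 𝓘(ℝ, E) ∞
      (fun u : ℝ × E ↦ c u.1 ((extChartAt 𝓘(ℝ, E) x₀).symm u.2)) (0, z) :=
    (h.contMDiff.contMDiffAt).comp (0, z) (contMDiffAt_fst.prodMk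
      ((contMDiffAt_extChartAt_symm hz).comp (0, z) contMDiffAt_snd))
  have h2 : ContMDiffAt 𝓘(ℝ, E) 𝓘(ℝ, E) ∞ (extChartAt 𝓘(ℝ, E) x₀)
      (c 0 ((extChartAt 𝓘(ℝ, E) x₀).symm z)) := by
    refine contMDiffAt_extChartAt_of_mem ?_
    simp only [h.map_zero, Equiv.Perm.coe_one, id]
    exact (extChartAt 𝓘(ℝ, E) x₀).map_target hz
  have h3 := h2.comp (0, z) h1
  rw [← contMDiffAt_iff_contDiffAt, modelWithCornersSelf_prod, ← chartedSpaceSelf_prod]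
  exact h3

theorem IsVelocityOf.hasDerivAt_extChartAt (h : IsVelocityOf G c X) {x₀ x : M}
    (hx : x ∈ (extChartAt 𝓘(ℝ, E) x₀).source) :
    HasDerivAt (fun t ↦ extChartAt 𝓘(ℝ, E) x₀ (c t x))
      (fieldRep x₀ X (extChartAt 𝓘(ℝ, E) x₀ x)) 0 := by
  have h1 : MDifferentiableAt 𝓘(ℝ, E) 𝓘(ℝ, E) (extChartAt 𝓘(ℝ, E) x₀) (c 0 x) :=
    (contMDiffAt_extChartAt_of_mem (by simpa [h.map_zero] using hx)).mdifferentiableAt (by simp)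
  have h2 := h.mdifferentiable_curve x 0
  have h3 : DifferentiableAt ℝ (extChartAt 𝓘(ℝ, E) x₀ ∘ fun t ↦ c t x) 0 :=
    (h1.comp 0 h2).differentiableAt
  have h4 := h3.hasDerivAt
  have h5 := tderiv_comp_apply (f := fun t ↦ c t x) h1 h2 (1 : ℝ)
  rw [tderiv_eq_fderiv, h.tderiv_curve, fderiv_apply_one_eq_deriv] at h5
  rw [h5, h.map_zero] at h4
  rw [fieldRep_extChartAt X hx]
  exact h4

theorem IsVelocityOf.fderiv_curveRep (h : IsVelocityOf G c X) {x₀ : M} {z : E}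
    (hz : z ∈ (extChartAt 𝓘(ℝ, E) x₀).target) :
    fderiv ℝ (curveRep E x₀ c) (0, z) (1, 0) = fieldRep x₀ X z := by
  have h1 : HasDerivAt (fun t ↦ curveRep E x₀ c (t, z)) (fderiv ℝ (curveRep E x₀ c) (0, z) (1, 0))
      0 :=
    HasFDerivAt.comp_hasDerivAt (f := fun t : ℝ ↦ (t, z)) 0
      ((h.contDiffAt_curveRep hz).differentiableAt (by simp)).hasFDerivAt
      ((hasDerivAt_id (0 : ℝ)).prodMk (hasDerivAt_const (0 : ℝ) z))
  have h2 := h.hasDerivAt_extChartAt ((extChartAt 𝓘(ℝ, E) x₀).map_target hz)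
  rw [(extChartAt 𝓘(ℝ, E) x₀).right_inv hz] at h2
  exact h1.unique h2

theorem IsVelocityOf.contDiffAt_fieldRep (h : IsVelocityOf G c X) {x₀ : M} {z : E}
    (hz : z ∈ (extChartAt 𝓘(ℝ, E) x₀).target) : ContDiffAt ℝ ∞ (fieldRep x₀ X) z := by
  have h1 : ContDiffAt ℝ ∞ (fun y ↦ fderiv ℝ (curveRep E x₀ c) (0, y) (1, 0)) z :=
    ContDiffAt.clm_apply (ContDiffAt.comp (g := fderiv ℝ (curveRep E x₀ c)) z
      ((h.contDiffAt_curveRep hz).fderiv_right (by simp))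
      (contDiffAt_const.prodMk contDiffAt_id)) contDiffAt_const
  refine h1.congr_of_eventuallyEq ?_
  filter_upwards [(isOpen_extChartAt_target x₀).mem_nhds hz] with y hy
  exact (h.fderiv_curveRep hy).symm

theorem IsVelocityOf.hasDerivAt_fderiv_chartRep (h : IsVelocityOf G c X) {x₀ : M} {z : E}
    (hz : z ∈ (extChartAt 𝓘(ℝ, E) x₀).target) :
    HasDerivAt (fun t ↦ fderiv ℝ (chartRep E x₀ x₀ (c t)) z) (fderiv ℝ (fieldRep x₀ X) z) 0 := by
  have h1 := hasDerivAt_fderiv_partial ((h.contDiffAt_curveRep hz).of_le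
    (WithTop.coe_le_coe.2 (le_top (a := (2 : ℕ∞)))) : ContDiffAt ℝ 2 (curveRep E x₀ c) (0, z))
  refine h1.congr_deriv (Filter.EventuallyEq.fderiv_eq ?_)
  filter_upwards [(isOpen_extChartAt_target x₀).mem_nhds hz] with y hy
  exact h.fderiv_curveRep hy

/-- The field is the tangent map of `(t, x) ↦ c t x` applied to the smooth section `(∂/∂t, 0)` at `t
= 0`. -/
theorem IsVelocityOf.contMDiff_field (h : IsVelocityOf G c X) :
    ContMDiff 𝓘(ℝ, E) 𝓘(ℝ, E).tangent ∞
      (fun x ↦ (⟨x, X x⟩ : TangentBundle 𝓘(ℝ, E) M)) := by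
  have h1 := h.contMDiff.contMDiff_tangentMap (m := ∞) (by simp)
  have h2 : ContMDiff 𝓘(ℝ, E) (𝓘(ℝ, ℝ).tangent.prod 𝓘(ℝ, E).tangent) ∞
      (fun x : M ↦ ((⟨0, (1 : ℝ)⟩ : TangentBundle 𝓘(ℝ, ℝ) ℝ),
        (⟨x, (0 : E)⟩ : TangentBundle 𝓘(ℝ, E) M))) :=
    contMDiff_const.prodMk (Bundle.contMDiff_zeroSection ℝ (TangentSpace 𝓘(ℝ, E) (M := M)))
  have h3 := h1.comp ((contMDiff_equivTangentBundleProd_symm (n := ∞)).comp h2)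
  refine h3.congr fun x ↦ ?_
  have h4 : ∀ (y : M) (w : E), x = y → (X x : E) = w →
      (⟨x, X x⟩ : TangentBundle 𝓘(ℝ, E) M) = ⟨y, w⟩ := by
    rintro y w rfl rfl
    rfl
  refine h4 _ _ (by simp [h.map_zero]) ?_
  have hF := h.mdifferentiable (0, x)
  refine Eq.trans ?_ (mfderiv_prod_eq_add_apply hF).symm
  refine (h.tderiv_curve x).symm.trans ?_
  exact (add_zero _).symm.trans (congrArg (fun w : E ↦ tderiv ℝ E (fun t : ℝ ↦ c t x) 0 1 + w)
    (_root_.map_zero (tderiv E E (fun y : M ↦ c 0 y) x)).symm)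

end Velocity

section VelocitySpace

open scoped Topology

variable {E : Type*} [NormedAddCommGroup E] [NormedSpace ℝ E]
  {M : Type*} [TopologicalSpace M] [ChartedSpace E M] [IsManifold 𝓘(ℝ, E) ∞ M]
  {G : Subgroup (Equiv.Perm M)}

theorem contDiffAt_fieldRep {X : VectorFields E M} (hX : X ∈ lieAlgebraOf E G) {x₀ : M} {z : E}
    (hz : z ∈ (extChartAt 𝓘(ℝ, E) x₀).target) : ContDiffAt ℝ ∞ (fieldRep x₀ X) z := by
  obtain ⟨c, hc⟩ := hX
  exact hc.contDiffAt_fieldRep hz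

theorem differentiableAt_fieldRep {X : VectorFields E M} (hX : X ∈ lieAlgebraOf E G) (x : M) :
    DifferentiableAt ℝ (fieldRep x X) (extChartAt 𝓘(ℝ, E) x x) :=
  (contDiffAt_fieldRep hX (mem_extChartAt_target x)).differentiableAt (by simp)

theorem contMDiff_of_mem_lieAlgebraOf {X : VectorFields E M} (hX : X ∈ lieAlgebraOf E G) :
    ContMDiff 𝓘(ℝ, E) 𝓘(ℝ, E).tangent ∞ (fun x ↦ (⟨x, X x⟩ : TangentBundle 𝓘(ℝ, E) M)) := by
  obtain ⟨c, hc⟩ := hX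
  exact hc.contMDiff_field

theorem mdifferentiableAt_of_mem_lieAlgebraOf {X : VectorFields E M} (hX : X ∈ lieAlgebraOf E G)
    (x : M) : MDifferentiableAt 𝓘(ℝ, E) 𝓘(ℝ, E).tangent
      (fun x ↦ (⟨x, X x⟩ : TangentBundle 𝓘(ℝ, E) M)) x :=
  (contMDiff_of_mem_lieAlgebraOf hX).contMDiffAt.mdifferentiableAt (by simp)

end VelocitySpace

theorem minSmoothness_le_infty (n : ℕ) : minSmoothness ℝ n ≤ ∞ := by
  rw [minSmoothness_of_isRCLikeNormedField]
  exact WithTop.coe_le_coe.2 (le_top (a := (n : ℕ∞)))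

/-! ### The adjoint action of isometries. -/

section Adjoint

open scoped Topology

variable {E : Type*} [NormedAddCommGroup E] [NormedSpace ℝ E]
  {M : Type*} [TopologicalSpace M] [ChartedSpace E M]

/-- The adjoint action as a linear map. -/
def adMap (g : Equiv.Perm M) : VectorFields E M →ₗ[ℝ] VectorFields E M where
  toFun := Ad g
  map_add' _ _ := VectorField.mpullback_add
  map_smul' _ _ := VectorField.mpullback_const_smul

theorem adMap_apply (g : Equiv.Perm M) (X : VectorFields E M) : adMap g X = Ad g X := rfl

variable [RiemannianBundle (fun x : M ↦ TangentSpace 𝓘(ℝ, E) x)]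

theorem IsIsometry.inverse_tderiv_inv {g : Equiv.Perm M} (hg : IsIsometry E g) (x : M) :
    (tderiv E E (g⁻¹ : Equiv.Perm M) x).inverse = tderiv E E g (g⁻¹ x) := by
  refine ContinuousLinearMap.inverse_eq ?_ ?_
  · ext v
    have := hg.tderiv_inv_apply (g⁻¹ x) v
    rwa [Equiv.Perm.coe_inv, Equiv.apply_symm_apply] at this
  · ext v
    exact hg.tderiv_apply_inv x v

theorem IsIsometry.evalAt_Ad {g : Equiv.Perm M} (hg : IsIsometry E g) (X : VectorFields E M)
    (x : M) : evalAt x (Ad g X) = tderiv E E g (g⁻¹ x) (evalAt (g⁻¹ x) X) :=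
  DFunLike.congr_fun (hg.inverse_tderiv_inv x) (X (g⁻¹ x))

theorem IsIsometry.evalAt_map_Ad {g : Equiv.Perm M} (hg : IsIsometry E g) (X : VectorFields E M)
    (x : M) : evalAt (g x) (Ad g X) = tderiv E E g x (evalAt x X) := by
  rw [hg.evalAt_Ad, Equiv.Perm.coe_inv, Equiv.symm_apply_apply]

theorem Ad_one (X : VectorFields E M) : Ad 1 X = X := by
  refine VectorFields.ext_evalAt fun x ↦ ?_
  rw [IsIsometry.one.evalAt_Ad, tderiv_one]
  rfl

theorem IsIsometry.Ad_mul {g g' : Equiv.Perm M} (hg : IsIsometry E g) (hg' : IsIsometry E g')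
    (X : VectorFields E M) : Ad (g * g') X = Ad g (Ad g' X) := by
  refine VectorFields.ext_evalAt fun x ↦ ?_
  obtain ⟨y, rfl⟩ := (g * g').surjective x
  rw [(hg.mul hg').evalAt_map_Ad, hg.tderiv_mul hg', Equiv.Perm.mul_apply, hg.evalAt_map_Ad,
    hg'.evalAt_map_Ad]

theorem IsIsometry.evalAt_Ad_inv {g : Equiv.Perm M} (hg : IsIsometry E g) (X : VectorFields E M)
    (x : M) : evalAt x (Ad g⁻¹ X) = tderiv E E (g⁻¹ : Equiv.Perm M) (g x) (evalAt (g x) X) := by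
  rw [hg.inv.evalAt_Ad, inv_inv]

/-- Conjugating a curve of transformations pushes its velocity forward. -/
theorem IsVelocityOf.conj {G : Subgroup (Equiv.Perm M)} {c : ℝ → Equiv.Perm M}
    {X : VectorFields E M} (h : IsVelocityOf G c X) {g : Equiv.Perm M} (hg : IsIsometry E g)
    (hG : ∀ t ∈ G, g * t * g⁻¹ ∈ G) : IsVelocityOf G (fun t ↦ g * c t * g⁻¹) (Ad g X) where
  mem t := hG _ (h.mem t)
  map_zero := by simp [h.map_zero]
  contMDiff := hg.contMDiff.comp
    (h.contMDiff.comp (contMDiff_fst.prodMk (hg.contMDiff_inv.comp contMDiff_snd)))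
  velocity x := by
    have h1 := tderiv_comp_apply (f := fun t ↦ c t (g⁻¹ x)) (hg.mdifferentiableAt (c 0 (g⁻¹ x)))
      (h.mdifferentiable_curve (g⁻¹ x) 0) (1 : ℝ)
    refine h1.trans ?_
    rw [h.tderiv_curve, h.map_zero]
    change tderiv E E g (g⁻¹ x) (evalAt (g⁻¹ x) X) = evalAt ((g * 1 * g⁻¹) x) (Ad g X)
    rw [mul_one, mul_inv_cancel, hg.evalAt_Ad]
    rfl

theorem Ad_mem_lieAlgebraOf {G : Subgroup (Equiv.Perm M)} {X : VectorFields E M}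
    (hX : X ∈ lieAlgebraOf E G) {g : Equiv.Perm M}
    (hg : IsIsometry E g) (hG : ∀ t ∈ G, g * t * g⁻¹ ∈ G) : Ad g X ∈ lieAlgebraOf E G := by
  obtain ⟨c, hc⟩ := hX
  exact ⟨_, hc.conj hg hG⟩

theorem Ad_mem_transvectionAlgebra {X : VectorFields E M} (hX : X ∈ transvectionAlgebra E M)
    {g : Equiv.Perm M} (hg : IsIsometry E g) : Ad g X ∈ transvectionAlgebra E M :=
  Ad_mem_lieAlgebraOf hX hg fun _ ↦ conj_mem_transvectionGroup hg

end Adjoint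

/-! ### Brackets as derivatives of the adjoint action. -/

section KillingField

open scoped Topology

variable {E : Type*} [NormedAddCommGroup E] [NormedSpace ℝ E] [FiniteDimensional ℝ E]
  {M : Type*} [EMetricSpace M] [ChartedSpace E M] [IsManifold 𝓘(ℝ, E) ∞ M]
  [RiemannianBundle (fun x : M ↦ TangentSpace 𝓘(ℝ, E) x)]
  {G : Subgroup (Equiv.Perm M)} {c : ℝ → Equiv.Perm M} {X : VectorFields E M}

/-- The Lie derivative along the velocity of a curve of isometries is the Lie bracket. -/
theorem IsVelocityOf.hasDerivAt_Ad_inv (hG : ∀ g ∈ G, IsIsometry E g) (h : IsVelocityOf G c X)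
    {Y : VectorFields E M} {x : M}
    (hY : DifferentiableAt ℝ (fieldRep x Y) (extChartAt 𝓘(ℝ, E) x x)) :
    HasDerivAt (fun t ↦ evalAt x (Ad (c t)⁻¹ Y))
      (evalAt x (VectorField.mlieBracket 𝓘(ℝ, E) X Y)) 0 := by
  set φ := extChartAt 𝓘(ℝ, E) x with hφ
  have hx : x ∈ φ.source := mem_extChartAt_source x
  have hc : ∀ t, IsIsometry E (c t) := fun t ↦ hG _ (h.mem t)
  have hcx : c 0 x = x := by rw [h.map_zero]; rfl
  have hev : ∀ᶠ t in 𝓝 (0 : ℝ), c t x ∈ φ.source := by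
    have := (h.contMDiff_curve x).continuous.tendsto 0
    rw [hcx] at this
    exact this.eventually (extChartAt_source_mem_nhds x)
  have hid : ∀ v, tderiv E E φ.symm (φ x) v = v := tderiv_extChartAt_symm_self x
  set A : ℝ → E →L[ℝ] E := fun t ↦ fderiv ℝ (chartRep E x x (c t)) (φ x) with hA
  have hA0 : A 0 = 1 := by
    ext v
    rw [hA]
    simp only
    rw [fderiv_chartRep_of_mem_source (hc 0) hx (by rwa [hcx]), hcx, h.map_zero, tderiv_one,
      tderiv_extChartAt_self, hid]
    rfl
  have hA1 : HasDerivAt A (fderiv ℝ (fieldRep x X) (φ x)) 0 :=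
    h.hasDerivAt_fderiv_chartRep (φ.map_source hx)
  -- In the chart at `x` the pulled-back field is `A(t)⁻¹ Y(c_t x)`, where `A(t)` is the derivative
  -- of `c_t` at `x`.
  have heq : ∀ᶠ t in 𝓝 (0 : ℝ), evalAt x (Ad (c t)⁻¹ Y) =
      Ring.inverse (A t) (fieldRep x Y (φ (c t x))) := by
    filter_upwards [hev] with t ht
    have h1 : (A t).inverse = (tderiv E E ((c t)⁻¹ : Equiv.Perm M) (c t x)).comp
        (tderiv E E φ.symm (φ (c t x))) := by
      have e1 : ∀ v, A t v = tderiv E E φ (c t x) (tderiv E E (c t) x v) := fun v ↦ by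
        rw [hA]
        simp only
        rw [fderiv_chartRep_of_mem_source (hc t) hx ht, hid]
      refine ContinuousLinearMap.inverse_eq ?_ ?_
      · ext v
        change A t (tderiv E E ((c t)⁻¹ : Equiv.Perm M) (c t x)
          (tderiv E E φ.symm (φ (c t x)) v)) = v
        have e3 := (hc t).tderiv_apply_inv (c t x) (tderiv E E φ.symm (φ (c t x)) v)
        rw [Equiv.Perm.coe_inv, Equiv.symm_apply_apply] at e3
        have e4 := tderiv_extChartAt_comp_symm (φ.map_source ht) v
        rw [φ.left_inv ht] at e4
        rw [e1, Equiv.Perm.coe_inv, e3, e4]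
      · ext v
        change tderiv E E ((c t)⁻¹ : Equiv.Perm M) (c t x)
          (tderiv E E φ.symm (φ (c t x)) (A t v)) = v
        rw [e1, tderiv_extChartAt_symm_comp ht, (hc t).tderiv_inv_apply]
    rw [ContinuousLinearMap.ringInverse_eq_inverse, h1, fieldRep_extChartAt Y ht,
      ContinuousLinearMap.comp_apply, tderiv_extChartAt_symm_comp ht, (hc t).evalAt_Ad_inv]
  -- Inversion has derivative `-id` at the identity `A 0`, which yields the term `-DX Y`; the chain
  -- rule for `Y(c_t x)` below yields `DY X`.
  have hinv : HasDerivAt (fun t ↦ Ring.inverse (A t)) (-fderiv ℝ (fieldRep x X) (φ x)) 0 := by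
    have h1 := hasFDerivAt_ringInverse (𝕜 := ℝ) (1 : (E →L[ℝ] E)ˣ)
    rw [Units.val_one, ← hA0] at h1
    refine (h1.comp_hasDerivAt 0 hA1).congr_deriv ?_
    rw [neg_apply, ContinuousLinearMap.mulLeftRight_apply, inv_one, Units.val_one, one_mul, mul_one]
  have hYc : HasDerivAt (fun t ↦ fieldRep x Y (φ (c t x)))
      (fderiv ℝ (fieldRep x Y) (φ x) (evalAt x X)) 0 := by
    have h1 := h.hasDerivAt_extChartAt hx
    rw [fieldRep_extChartAt_self] at h1
    have h2 : HasFDerivAt (fieldRep x Y) (fderiv ℝ (fieldRep x Y) (φ x)) (φ (c 0 x)) := by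
      rw [hcx]; exact hY.hasFDerivAt
    exact h2.comp_hasDerivAt 0 h1
  refine ((hinv.clm_apply hYc).congr_of_eventuallyEq heq).congr_deriv ?_
  rw [mlieBracket_eq_fieldRep, hA0, hcx, fieldRep_extChartAt_self, Ring.inverse_one, neg_apply,
    neg_add_eq_sub]
  rfl

/-- If a finite-dimensional space of vector fields contains the translates of `Y` by `G`, then it
contains the brackets of `Y` with the velocities of `G`. -/
theorem mlieBracket_mem_of_forall_Ad_mem (hG : ∀ g ∈ G, IsIsometry E g)
    {X : VectorFields E M} (hX : X ∈ lieAlgebraOf E G) {Y : VectorFields E M}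
    (hY : ∀ x, DifferentiableAt ℝ (fieldRep x Y) (extChartAt 𝓘(ℝ, E) x x))
    (W : Submodule ℝ (VectorFields E M)) [FiniteDimensional ℝ W] (hW : ∀ g ∈ G, Ad g Y ∈ W) :
    VectorField.mlieBracket 𝓘(ℝ, E) X Y ∈ W := by
  obtain ⟨c, hc⟩ := hX
  -- In `M → E` the topology is that of pointwise convergence. The finite-dimensional `W` is closed
  -- for it, so a pointwise limit of difference quotients in `W` stays in `W`.
  let W' : Submodule ℝ (M → E) := W
  have hfin : FiniteDimensional ℝ W' := ‹FiniteDimensional ℝ W›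
  have hclosed : IsClosed (W' : Set (M → E)) := W'.closed_of_finiteDimensional
  have hlim : Filter.Tendsto (fun t : ℝ ↦ (slope (fun t x ↦ evalAt x (Ad (c t)⁻¹ Y)) 0 t : M → E))
      (𝓝[≠] 0) (𝓝 (fun x ↦ evalAt x (VectorField.mlieBracket 𝓘(ℝ, E) X Y))) := by
    refine tendsto_pi_nhds.2 fun x ↦ ?_
    exact (hasDerivAt_iff_tendsto_slope.1 (hc.hasDerivAt_Ad_inv hG (hY x)))
  refine hclosed.mem_of_tendsto hlim (Filter.Eventually.of_forall fun t ↦ ?_)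
  exact W'.smul_mem _ (W'.sub_mem (hW _ (G.inv_mem (hc.mem t))) (hW _ (G.inv_mem (hc.mem 0))))

theorem Ad_mlieBracket {X Y : VectorFields E M} (hX : X ∈ lieAlgebraOf E G)
    (hY : Y ∈ lieAlgebraOf E G) {g : Equiv.Perm M} (hg : IsIsometry E g) :
    Ad g (VectorField.mlieBracket 𝓘(ℝ, E) X Y) =
      VectorField.mlieBracket 𝓘(ℝ, E) (Ad g X) (Ad g Y) := by
  have _ : IsManifold 𝓘(ℝ, E) (minSmoothness ℝ 2) M :=
    IsManifold.of_le (n := ∞) (minSmoothness_le_infty 2)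
  funext x
  exact VectorField.mpullback_mlieBracket (n := ∞) (mdifferentiableAt_of_mem_lieAlgebraOf hX _)
    (mdifferentiableAt_of_mem_lieAlgebraOf hY _) hg.contMDiff_inv.contMDiffAt
    (minSmoothness_le_infty 2)

end KillingField

/-! ### Killing fields are determined by their 1-jets; finite dimension and brackets. -/

section KillingFieldRigidity

open scoped Topology

variable {E : Type*} [NormedAddCommGroup E] [NormedSpace ℝ E] [FiniteDimensional ℝ E]
  {M : Type*} [EMetricSpace M] [ChartedSpace E M] [IsManifold 𝓘(ℝ, E) ∞ M]
  [RiemannianBundle (fun x : M ↦ TangentSpace 𝓘(ℝ, E) x)]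
  [IsContMDiffRiemannianBundle 𝓘(ℝ, E) ∞ E (fun x : M ↦ TangentSpace 𝓘(ℝ, E) x)]
  [IsRiemannianManifold 𝓘(ℝ, E) M]
  {G : Subgroup (Equiv.Perm M)}

/-- A velocity of isometries whose `1`-jet vanishes at a point vanishes nearby. -/
theorem exists_nhds_evalAt_eq_zero (hG : ∀ g ∈ G, IsIsometry E g) (x₀ : M) :
    ∃ U ∈ 𝓝 x₀, ∀ X ∈ lieAlgebraOf E G, ∀ q ∈ U,
      fieldRep x₀ X (extChartAt 𝓘(ℝ, E) x₀ q) = 0 →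
      fderiv ℝ (fieldRep x₀ X) (extChartAt 𝓘(ℝ, E) x₀ q) = 0 → ∀ x ∈ U, evalAt x X = 0 := by
  obtain ⟨U, hU, -, hUs, ε, hε, Φ, hΦ, h⟩ := exists_contDiff_eq_of_isIsometry (E := E) x₀ x₀
  refine ⟨U, hU, ?_⟩
  rintro X ⟨c, hc⟩ q hq h0 h1 x hx
  set φ := extChartAt 𝓘(ℝ, E) x₀ with hφ
  have hev : ∀ᶠ t in 𝓝 (0 : ℝ), edist (c t x₀) x₀ < ε := by
    have h2 := (hc.contMDiff_curve x₀).continuous.tendsto 0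
    rw [hc.map_zero] at h2
    exact h2.eventually (Metric.eball_mem_nhds x₀ hε)
  -- Differentiating this identity at `t = 0` expresses the field at `x` linearly in its 1-jet at
  -- `q`, which is zero.
  have heq : ∀ᶠ t in 𝓝 (0 : ℝ), φ (c t x) =
      Φ (φ q, φ x - φ q, φ (c t q), fderiv ℝ (chartRep E x₀ x₀ (c t)) (φ q)) := by
    filter_upwards [hev] with t ht
    exact (h (c t) (hG _ (hc.mem t)) ⟨x₀, mem_of_mem_nhds hU, ht⟩ x hx).2 q hq
  have d1 := hc.hasDerivAt_extChartAt (hUs hx)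
  have d2 := hc.hasDerivAt_extChartAt (hUs hq)
  have d3 := hc.hasDerivAt_fderiv_chartRep (φ.map_source (hUs hq))
  rw [h0] at d2
  rw [h1] at d3
  have d4 := (hasDerivAt_const (0 : ℝ) (φ q)).prodMk
    ((hasDerivAt_const (0 : ℝ) (φ x - φ q)).prodMk (d2.prodMk d3))
  have d5 := ((hΦ.differentiable (by simp)) _).hasFDerivAt.comp_hasDerivAt 0 d4
  have d6 := (d5.congr_of_eventuallyEq heq).unique d1
  rw [← fieldRep_eq_zero_iff X (hUs hx), ← d6]
  exact map_zero _

/-- A velocity of isometries is determined by its `1`-jet at a point. -/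
theorem eq_zero_of_fieldRep_eq_zero [PreconnectedSpace M] (hG : ∀ g ∈ G, IsIsometry E g)
    {X : VectorFields E M} (hX : X ∈ lieAlgebraOf E G) {p : M} (h0 : evalAt p X = 0)
    (h1 : fderiv ℝ (fieldRep p X) (extChartAt 𝓘(ℝ, E) p p) = 0) : X = 0 := by
  set S : Set M := {x | ∀ᶠ y in 𝓝 x, evalAt y X = 0} with hS
  have hopen : IsOpen S := isOpen_setOfPred_eventually_nhds
  have hclosed : IsClosed S := by
    refine isClosed_of_closure_subset fun x₀ hx₀ ↦ ?_
    obtain ⟨U, hU, h⟩ := exists_nhds_evalAt_eq_zero hG x₀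
    obtain ⟨q, ⟨hqU, hqs⟩, hq⟩ := mem_closure_iff_nhds.1 hx₀ _
      (Filter.inter_mem hU (extChartAt_source_mem_nhds (I := 𝓘(ℝ, E)) x₀))
    have hrep : fieldRep x₀ X =ᶠ[𝓝 (extChartAt 𝓘(ℝ, E) x₀ q)] fun _ ↦ 0 := by
      have h2 : Filter.Tendsto (extChartAt 𝓘(ℝ, E) x₀).symm
          (𝓝 (extChartAt 𝓘(ℝ, E) x₀ q)) (𝓝 q) := by
        have := (contMDiffAt_extChartAt_symm (E := E)
          ((extChartAt 𝓘(ℝ, E) x₀).map_source hqs)).continuousAt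
        rwa [ContinuousAt, (extChartAt 𝓘(ℝ, E) x₀).left_inv hqs] at this
      filter_upwards [h2.eventually hq] with z hz
      rw [fieldRep_apply, hz, map_zero]
    refine Filter.mem_of_superset hU fun x hx ↦ h X hX q hqU hrep.self_of_nhds ?_ x hx
    rw [hrep.fderiv_eq]
    exact fderiv_const_apply 0
  have hp : p ∈ S := by
    obtain ⟨U, hU, h⟩ := exists_nhds_evalAt_eq_zero hG p
    refine Filter.mem_of_superset hU fun x hx ↦ h X hX p (mem_of_mem_nhds hU) ?_ h1 x hx
    rw [fieldRep_extChartAt_self, h0]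
  have huniv : S = Set.univ := IsClopen.eq_univ ⟨hclosed, hopen⟩ ⟨p, hp⟩
  refine VectorFields.ext_evalAt fun x ↦ ?_
  have : x ∈ S := huniv ▸ Set.mem_univ x
  exact Filter.Eventually.self_of_nhds (p := fun y ↦ evalAt y X = 0) this

/-- By rigidity, taking the 1-jet at a point embeds the algebra into `E × (E →L[ℝ] E)`. -/
theorem finiteDimensional_lieAlgebraOf [Nonempty M] [PreconnectedSpace M]
    (hG : ∀ g ∈ G, IsIsometry E g) : FiniteDimensional ℝ (lieAlgebraOf E G) := by
  obtain ⟨p⟩ := ‹Nonempty M›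
  let J : lieAlgebraOf E G →ₗ[ℝ] E × (E →L[ℝ] E) :=
    { toFun X := (evalAt p X.1, fderiv ℝ (fieldRep p X.1) (extChartAt 𝓘(ℝ, E) p p))
      map_add' X Y := by
        refine Prod.ext (map_add _ _ _) ?_
        change fderiv ℝ (fieldRep p (X.1 + Y.1)) _ = _
        rw [map_add]
        exact fderiv_add (differentiableAt_fieldRep X.2 p) (differentiableAt_fieldRep Y.2 p)
      map_smul' a X := by
        refine Prod.ext (map_smul _ _ _) ?_
        change fderiv ℝ (fieldRep p (a • X.1)) _ = _
        rw [map_smul]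
        exact fderiv_const_smul (differentiableAt_fieldRep X.2 p) a }
  refine FiniteDimensional.of_injective J (LinearMap.ker_eq_bot.1 (LinearMap.ker_eq_bot'.2 ?_))
  intro X hX
  exact Subtype.ext (eq_zero_of_fieldRep_eq_zero hG X.2 (congrArg Prod.fst hX)
    (congrArg Prod.snd hX))

/-- `G` normalizes itself, so the translates of `Y` stay in the algebra. That space is
finite-dimensional, hence contains the limit of their difference quotients. The empty manifold is
set aside because it has no point at which to take jets. -/
theorem mlieBracket_mem_lieAlgebraOf [PreconnectedSpace M] (hG : ∀ g ∈ G, IsIsometry E g)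
    {X Y : VectorFields E M} (hX : X ∈ lieAlgebraOf E G) (hY : Y ∈ lieAlgebraOf E G) :
    VectorField.mlieBracket 𝓘(ℝ, E) X Y ∈ lieAlgebraOf E G := by
  rcases isEmpty_or_nonempty M with hM | hM
  · have : VectorField.mlieBracket 𝓘(ℝ, E) X Y = 0 := funext fun x ↦ (hM.false x).elim
    rw [this]
    exact Submodule.zero_mem _
  have := finiteDimensional_lieAlgebraOf (E := E) hG
  exact mlieBracket_mem_of_forall_Ad_mem hG hX (differentiableAt_fieldRep hY) _
    fun g hg ↦ Ad_mem_lieAlgebraOf hY (hG g hg) fun t ht ↦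
      G.mul_mem (G.mul_mem hg ht) (G.inv_mem hg)

end KillingFieldRigidity

/-! ### The transvection algebra as a Lie algebra. -/

section TransvectionLieAlgebra

variable {E : Type*} [NormedAddCommGroup E] [NormedSpace ℝ E] [FiniteDimensional ℝ E]
  {M : Type*} [EMetricSpace M] [ChartedSpace E M] [IsManifold 𝓘(ℝ, E) ∞ M]
  [RiemannianBundle (fun x : M ↦ TangentSpace 𝓘(ℝ, E) x)]
  [IsContMDiffRiemannianBundle 𝓘(ℝ, E) ∞ E (fun x : M ↦ TangentSpace 𝓘(ℝ, E) x)]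
  [IsRiemannianManifold 𝓘(ℝ, E) M] [PreconnectedSpace M]

instance [Nonempty M] : FiniteDimensional ℝ (transvectionAlgebra E M) :=
  finiteDimensional_lieAlgebraOf fun _ ↦ isIsometry_of_mem_transvectionGroup

/-- This is the bracket of vector fields, the opposite of the one coming from the group. Spans of
brackets, inclusions and the Killing form do not see the sign. -/
instance : Bracket (transvectionAlgebra E M) (transvectionAlgebra E M) where
  bracket X Y := ⟨VectorField.mlieBracket 𝓘(ℝ, E) X.1 Y.1,
    mlieBracket_mem_lieAlgebraOf (fun _ ↦ isIsometry_of_mem_transvectionGroup) X.2 Y.2⟩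

theorem coe_bracket (X Y : transvectionAlgebra E M) :
    (⁅X, Y⁆ : transvectionAlgebra E M).1 = VectorField.mlieBracket 𝓘(ℝ, E) X.1 Y.1 := rfl

instance : LieRing (transvectionAlgebra E M) where
  add_lie X Y _ := Subtype.ext <| funext fun x ↦
    have _ : IsManifold 𝓘(ℝ, E) (minSmoothness ℝ 2) M :=
      IsManifold.of_le (n := ∞) (minSmoothness_le_infty 2)
    VectorField.mlieBracket_add_left (mdifferentiableAt_of_mem_lieAlgebraOf X.2 x)
      (mdifferentiableAt_of_mem_lieAlgebraOf Y.2 x)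
  lie_add _ Y Z := Subtype.ext <| funext fun x ↦
    have _ : IsManifold 𝓘(ℝ, E) (minSmoothness ℝ 2) M :=
      IsManifold.of_le (n := ∞) (minSmoothness_le_infty 2)
    VectorField.mlieBracket_add_right (mdifferentiableAt_of_mem_lieAlgebraOf Y.2 x)
      (mdifferentiableAt_of_mem_lieAlgebraOf Z.2 x)
  lie_self _ := Subtype.ext VectorField.mlieBracket_self
  leibniz_lie X Y Z := Subtype.ext <|
    have _ : IsManifold 𝓘(ℝ, E) (minSmoothness ℝ 3) M :=
      IsManifold.of_le (n := ∞) (minSmoothness_le_infty 3)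
    VectorField.leibniz_identity_mlieBracket
      ((contMDiff_of_mem_lieAlgebraOf X.2).of_le (minSmoothness_le_infty 2))
      ((contMDiff_of_mem_lieAlgebraOf Y.2).of_le (minSmoothness_le_infty 2))
      ((contMDiff_of_mem_lieAlgebraOf Z.2).of_le (minSmoothness_le_infty 2))

instance : LieAlgebra ℝ (transvectionAlgebra E M) where
  lie_smul _ _ Y := Subtype.ext <| funext fun x ↦
    have _ : IsManifold 𝓘(ℝ, E) (minSmoothness ℝ 2) M :=
      IsManifold.of_le (n := ∞) (minSmoothness_le_infty 2)
    VectorField.mlieBracket_const_smul_right (mdifferentiableAt_of_mem_lieAlgebraOf Y.2 x)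

/-- The automorphism of the transvection algebra induced by an isometry. -/
def adEquiv (g : Equiv.Perm M) (hg : IsIsometry E g) :
    transvectionAlgebra E M ≃ₗ⁅ℝ⁆ transvectionAlgebra E M where
  toFun X := ⟨Ad g X.1, Ad_mem_transvectionAlgebra X.2 hg⟩
  invFun X := ⟨Ad g⁻¹ X.1, Ad_mem_transvectionAlgebra X.2 hg.inv⟩
  map_add' X Y := Subtype.ext (map_add (adMap g) X.1 Y.1)
  map_smul' a X := Subtype.ext (map_smul (adMap g) a X.1)
  map_lie' {X Y} := Subtype.ext (Ad_mlieBracket X.2 Y.2 hg)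
  left_inv X := Subtype.ext (by
    change Ad g⁻¹ (Ad g X.1) = X.1
    rw [← hg.inv.Ad_mul hg, inv_mul_cancel, Ad_one])
  right_inv X := Subtype.ext (by
    change Ad g (Ad g⁻¹ X.1) = X.1
    rw [← hg.Ad_mul hg.inv, mul_inv_cancel, Ad_one])

end TransvectionLieAlgebra

/-! ### The inverse function theorem on a neighbourhood. -/

section InverseFunction

open scoped Topology

/-- Invertible operators form an open set, so the derivative stays invertible near `a` and the local
inverse is smooth at all points near `f a`, not only at `f a`. -/
theorem exists_contDiffAt_rightInverse {E : Type*} [NormedAddCommGroup E] [NormedSpace ℝ E]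
    [CompleteSpace E] {f : E → E} {a : E} (hf : ∀ᶠ z in 𝓝 a, ContDiffAt ℝ ∞ f z) {f' : E ≃L[ℝ] E}
    (hf' : fderiv ℝ f a = f') :
    ∃ g : E → E, g (f a) = a ∧ ∀ᶠ y in 𝓝 (f a), ContDiffAt ℝ ∞ g y ∧ f (g y) = y := by
  have ha : ContDiffAt ℝ ∞ f a := hf.self_of_nhds
  have hd : HasFDerivAt f (f' : E →L[ℝ] E) a := hf' ▸ (ha.differentiableAt (by simp)).hasFDerivAt
  set e := ha.toOpenPartialHomeomorph f hd (by simp) with he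
  have hsrc : a ∈ e.source := ha.mem_toOpenPartialHomeomorph_source hd (by simp)
  have htar : f a ∈ e.target := ha.image_mem_toOpenPartialHomeomorph_target hd (by simp)
  have hsymm : e.symm (f a) = a := e.left_inv hsrc
  refine ⟨e.symm, hsymm, ?_⟩
  have hinv : ∀ᶠ z in 𝓝 a, fderiv ℝ f z ∈ Set.range ((↑) : (E ≃L[ℝ] E) → E →L[ℝ] E) := by
    have hc : ContinuousAt (fderiv ℝ f) a :=
      (ha.fderiv_right (m := 0) (by simp)).continuousAt
    refine hc.eventually ?_
    rw [hf']
    exact f'.nhds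
  have hcont : Filter.Tendsto e.symm (𝓝 (f a)) (𝓝 a) := by
    have := e.continuousAt_symm htar
    rwa [ContinuousAt, hsymm] at this
  filter_upwards [e.open_target.mem_nhds htar, hcont.eventually (hf.and hinv)] with y hy hz
  obtain ⟨hz, f'', hf''⟩ := hz
  refine ⟨e.contDiffAt_symm hy (f₀' := f'') ?_ hz, e.right_inv hy⟩
  rw [hf'']
  exact (hz.differentiableAt (by simp)).hasFDerivAt

end InverseFunction

/-! ### Midpoints, transitivity, and evaluation of the transvection algebra at a point. -/

section Transitivity

open scoped Topology

variable {E : Type*} [NormedAddCommGroup E] [NormedSpace ℝ E] [FiniteDimensional ℝ E]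
  {M : Type*} [EMetricSpace M] [ChartedSpace E M] [IsManifold 𝓘(ℝ, E) ∞ M]
  [RiemannianBundle (fun x : M ↦ TangentSpace 𝓘(ℝ, E) x)]
  [IsContMDiffRiemannianBundle 𝓘(ℝ, E) ∞ E (fun x : M ↦ TangentSpace 𝓘(ℝ, E) x)]
  [IsRiemannianManifold 𝓘(ℝ, E) M] [PreconnectedSpace M]

theorem IsSymmetricSpace.contMDiff_symm_apply (hM : IsSymmetricSpace E M) (p : M) :
    ContMDiff 𝓘(ℝ, E) 𝓘(ℝ, E) ∞ (fun q ↦ hM.symm q p) :=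
  hM.contMDiff_symm.comp (contMDiff_id.prodMk contMDiff_const)

/-- Differentiate `s_q(q) = q` at `q = p`: the two partial derivatives add up to the identity, and
the one in the moved point is `-id`. -/
theorem IsSymmetricSpace.tderiv_symm_apply (hM : IsSymmetricSpace E M) (p : M) (v : E) :
    tderiv E E (fun q ↦ hM.symm q p) p v = (2 : ℝ) • v := by
  have hF : MDifferentiableAt (𝓘(ℝ, E).prod 𝓘(ℝ, E)) 𝓘(ℝ, E)
      (fun z : M × M ↦ hM.symm z.1 z.2) (p, p) :=
    hM.contMDiff_symm.contMDiffAt.mdifferentiableAt (by simp)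
  have hd : MDifferentiableAt 𝓘(ℝ, E) (𝓘(ℝ, E).prod 𝓘(ℝ, E)) (fun q : M ↦ (q, q)) p :=
    mdifferentiableAt_id.prodMk mdifferentiableAt_id
  have h1 := mfderiv_comp_apply (f := fun q : M ↦ (q, q)) (g := fun z : M × M ↦ hM.symm z.1 z.2) p
    hF hd v
  have h2 : (fun z : M × M ↦ hM.symm z.1 z.2) ∘ (fun q : M ↦ (q, q)) = id := by
    ext q
    exact hM.symm_self q
  have hd' : mfderiv 𝓘(ℝ, E) (𝓘(ℝ, E).prod 𝓘(ℝ, E)) (fun q : M ↦ (q, q)) p =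
      (mfderiv 𝓘(ℝ, E) 𝓘(ℝ, E) (fun q : M ↦ q) p).prod
        (mfderiv 𝓘(ℝ, E) 𝓘(ℝ, E) (fun q : M ↦ q) p) :=
    MDifferentiableAt.mfderiv_prod (f := fun q : M ↦ q) (g := fun q : M ↦ q) mdifferentiableAt_id
      mdifferentiableAt_id
  rw [hd', mfderiv_prod_eq_add_apply hF] at h1
  have h3 : v = tderiv E E (fun q ↦ hM.symm q p) p (tderiv E E (id : M → M) p v) +
      tderiv E E (hM.symm p) p (tderiv E E (id : M → M) p v) := by
    refine Eq.trans ?_ h1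
    change v = tderiv E E ((fun z : M × M ↦ hM.symm z.1 z.2) ∘ (fun q : M ↦ (q, q))) p v
    rw [h2, tderiv_id]
    rfl
  rw [tderiv_id, ContinuousLinearMap.id_apply, (hM.isSymmetryAt p).tderiv_eq,
    ← sub_eq_add_neg] at h3
  rw [two_smul]
  exact (eq_add_of_sub_eq h3.symm)

/-- Near `p`, the point `y` is the image of `p` under the symmetry at a point that depends
smoothly on `y` (the midpoint of `p` and `y`). -/
theorem IsSymmetricSpace.exists_midpoint (hM : IsSymmetricSpace E M) (p : M) :
    ∃ V ∈ 𝓝 p, ∃ m : M → M, m p = p ∧ ∀ y ∈ V, ContMDiffAt 𝓘(ℝ, E) 𝓘(ℝ, E) ∞ m y ∧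
      hM.symm (m y) p = y := by
  set φ := extChartAt 𝓘(ℝ, E) p with hφ
  set f : E → E := chartRep E p p (fun q ↦ hM.symm q p) with hf
  have hp : p ∈ φ.source := mem_extChartAt_source p
  have hfp : f (φ p) = φ p := by
    rw [hf, chartRep_apply _ hp, hM.symm_self]
  have hinv : φ.symm (φ p) = p := φ.left_inv hp
  have hφs : ContinuousAt φ.symm (φ p) :=
    (contMDiffAt_extChartAt_symm (E := E) (φ.map_source hp)).continuousAt
  have hP := hM.contMDiff_symm_apply p
  have hsrc : ∀ᶠ z in 𝓝 (φ p), hM.symm (φ.symm z) p ∈ φ.source := by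
    have h1 : ContinuousAt (fun z ↦ hM.symm (φ.symm z) p) (φ p) :=
      hP.continuous.continuousAt.comp hφs
    refine h1.eventually ?_
    simp only [hinv, hM.symm_self]
    exact extChartAt_source_mem_nhds p
  have htar : ∀ᶠ z in 𝓝 (φ p), z ∈ φ.target := extChartAt_target_mem_nhds p
  have hsm : ∀ᶠ z in 𝓝 (φ p), ContDiffAt ℝ ∞ f z := by
    filter_upwards [hsrc, htar] with z hz hz'
    exact contDiffAt_chartRep hP hz' hz
  have hder : fderiv ℝ f (φ p) =
      (ContinuousLinearEquiv.smulLeft (Units.mk0 (2 : ℝ) two_ne_zero) : E ≃L[ℝ] E) := by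
    ext v
    rw [hf, fderiv_chartRep hP (φ.map_source hp) (by rw [hinv, hM.symm_self]; exact hp), hinv,
      hM.tderiv_symm_apply, hM.symm_self, tderiv_extChartAt_self, tderiv_extChartAt_symm_self]
    rfl
  obtain ⟨g, hg0, hg⟩ := exists_contDiffAt_rightInverse hsm hder
  rw [hfp] at hg0 hg
  have hgc : ContinuousAt g (φ p) := hg.self_of_nhds.1.continuousAt
  have hφc : ContinuousAt φ p := continuousAt_extChartAt p
  have hg2 : ∀ᶠ z in 𝓝 (φ p), g z ∈ φ.target ∧ hM.symm (φ.symm (g z)) p ∈ φ.source := by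
    rw [ContinuousAt, hg0] at hgc
    exact hgc.eventually (htar.and hsrc)
  refine ⟨_, (hφc.eventually (hg.and hg2)).and (extChartAt_source_mem_nhds (I := 𝓘(ℝ, E)) p),
    fun y ↦ φ.symm (g (φ y)), by simp only [hg0, hinv], ?_⟩
  rintro y ⟨⟨⟨h1, h2⟩, h3, h4⟩, hy⟩
  refine ⟨(contMDiffAt_extChartAt_symm (E := E) h3).comp y
    (h1.contMDiffAt.comp y (contMDiffAt_extChartAt_of_mem hy)), φ.injOn h4 hy ?_⟩
  exact h2

/-- With `m` the midpoint of `y` and a nearby `z`, the transvection `s_m s_y` sends `y` to `z`. So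
orbits are open and closed. -/
theorem exists_transvectionGroup_apply_eq (hM : IsSymmetricSpace E M) (x y : M) :
    ∃ g ∈ transvectionGroup E M, g x = y := by
  set S : Set M := {y | ∃ g ∈ transvectionGroup E M, g x = y} with hS
  have key : ∀ y : M, ∃ V ∈ 𝓝 y, ∀ z ∈ V, ∃ g ∈ transvectionGroup E M, g y = z := by
    intro y
    obtain ⟨V, hV, m, -, h⟩ := hM.exists_midpoint y
    refine ⟨V, hV, fun z hz ↦ ⟨_, hM.symm_mul_symm_mem (m z) y, ?_⟩⟩
    rw [Equiv.Perm.mul_apply, hM.symm_self, (h z hz).2]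
  have hopen : IsOpen S := by
    refine isOpen_iff_mem_nhds.2 ?_
    rintro y ⟨g, hg, rfl⟩
    obtain ⟨V, hV, h⟩ := key (g x)
    refine Filter.mem_of_superset hV fun z hz ↦ ?_
    obtain ⟨g', hg', rfl⟩ := h z hz
    exact ⟨g' * g, Subgroup.mul_mem _ hg' hg, rfl⟩
  have hclosed : IsClosed S := by
    refine isClosed_of_closure_subset fun y hy ↦ ?_
    obtain ⟨V, hV, h⟩ := key y
    obtain ⟨z, hzV, g, hg, hz⟩ := mem_closure_iff_nhds.1 hy V hV
    obtain ⟨g', hg', rfl⟩ := h z hzV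
    exact ⟨g'⁻¹ * g, Subgroup.mul_mem _ (Subgroup.inv_mem _ hg') hg, by
      rw [Equiv.Perm.mul_apply, hz, Equiv.Perm.coe_inv, Equiv.symm_apply_apply]⟩
  have huniv : S = Set.univ :=
    IsClopen.eq_univ ⟨hclosed, hopen⟩ ⟨x, 1, Subgroup.one_mem _, rfl⟩
  exact (huniv ▸ Set.mem_univ y : y ∈ S)

/-- Curves of transvections obtained by moving the second centre. -/
theorem IsSymmetricSpace.exists_isVelocityOf_symm_mul_symm (hM : IsSymmetricSpace E M) {q : ℝ → M}
    (hq : ContMDiff 𝓘(ℝ, ℝ) 𝓘(ℝ, E) ∞ q) :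
    ∃ Z : VectorFields E M,
      IsVelocityOf (transvectionGroup E M) (fun t ↦ hM.symm (q 0) * hM.symm (q t)) Z ∧
      ∀ x, evalAt x Z = tderiv ℝ E (fun t ↦ hM.symm (q 0) (hM.symm (q t) x)) 0 1 := by
  refine ⟨fun x ↦ tderiv ℝ E (fun t ↦ hM.symm (q 0) (hM.symm (q t) x)) 0 1, ?_, fun x ↦ rfl⟩
  refine ⟨fun t ↦ hM.symm_mul_symm_mem _ _, hM.symm_mul_self _,
    (hM.isIsometry_symm (q 0)).contMDiff.comp
      (hM.contMDiff_symm.comp ((hq.comp contMDiff_fst).prodMk contMDiff_snd)), fun x ↦ ?_⟩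
  rw [hM.symm_mul_self]
  rfl

theorem IsSymmetricSpace.tderiv_symm_symm_eq_zero (hM : IsSymmetricSpace E M) {q : ℝ → M}
    (hq : ContMDiff 𝓘(ℝ, ℝ) 𝓘(ℝ, E) ∞ q) (h0 : tderiv ℝ E q 0 1 = 0) (x : M) :
    tderiv ℝ E (fun t ↦ hM.symm (q 0) (hM.symm (q t) x)) 0 1 = 0 := by
  have h1 : MDifferentiableAt 𝓘(ℝ, E) 𝓘(ℝ, E) (fun y ↦ hM.symm (q 0) (hM.symm y x)) (q 0) :=
    ((hM.isIsometry_symm (q 0)).contMDiff.comp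
      (hM.contMDiff_symm_apply x)).contMDiffAt.mdifferentiableAt (by simp)
  have h2 : MDifferentiableAt 𝓘(ℝ, ℝ) 𝓘(ℝ, E) q 0 := hq.contMDiffAt.mdifferentiableAt (by simp)
  refine (tderiv_comp_apply h1 h2 1).trans ?_
  rw [h0, map_zero]

theorem exists_reparametrization {W : Set ℝ} (hW : W ∈ 𝓝 (0 : ℝ)) :
    ∃ ρ : ℝ → ℝ, ContDiff ℝ ∞ ρ ∧ ρ 0 = 0 ∧ HasDerivAt ρ 1 0 ∧ ∀ t, ρ t ∈ W := by
  obtain ⟨ε, hε, h⟩ := Metric.mem_nhds_iff.1 hW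
  -- A scaled sine has slope `1` at `0` and stays within `ε / 2` of `0`.
  refine ⟨fun t ↦ ε / 2 * Real.sin (t / (ε / 2)), ?_, by simp, ?_, fun t ↦ h ?_⟩
  · exact contDiff_const.mul (Real.contDiff_sin.comp (contDiff_id.div_const _))
  · have h1 : HasDerivAt (fun t : ℝ ↦ t / (ε / 2)) (1 / (ε / 2)) 0 :=
      (hasDerivAt_id (0 : ℝ)).div_const _
    have h2 := (h1.sin).const_mul (ε / 2)
    refine h2.congr_deriv ?_
    have : ε / 2 ≠ 0 := by positivity
    rw [zero_div, Real.cos_zero]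
    field_simp
  · rw [mem_ball_zero_iff, Real.norm_eq_abs, abs_mul, abs_of_pos (half_pos hε)]
    have := Real.abs_sin_le_one (t / (ε / 2))
    nlinarith

/-- Every tangent vector at `p` is the value of an element of the transvection algebra. -/
theorem exists_mem_transvectionAlgebra_evalAt_eq (hM : IsSymmetricSpace E M) (p : M) (v : E) :
    ∃ X ∈ transvectionAlgebra E M, evalAt p X = v := by
  obtain ⟨V, hV, m, hm0, h⟩ := hM.exists_midpoint p
  set φ := extChartAt 𝓘(ℝ, E) p with hφ
  have hinv : φ.symm (φ p) = p := φ.left_inv (mem_extChartAt_source p)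
  have hline : Continuous fun t : ℝ ↦ φ p + t • v := by fun_prop
  have hW : ∀ᶠ t in 𝓝 (0 : ℝ), φ p + t • v ∈ φ.target ∧ φ.symm (φ p + t • v) ∈ V := by
    have h1 : Filter.Tendsto (fun t : ℝ ↦ φ p + t • v) (𝓝 0) (𝓝 (φ p)) := by
      simpa using hline.tendsto 0
    have h2 : Filter.Tendsto φ.symm (𝓝 (φ p)) (𝓝 p) := by
      have := (contMDiffAt_extChartAt_symm (E := E) (mem_extChartAt_target p)).continuousAt
      rwa [ContinuousAt, hinv] at this
    exact h1.eventually (Filter.Eventually.and (extChartAt_target_mem_nhds p) (h2.eventually hV))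
  obtain ⟨ρ, hρ, hρ0, hρ1, hρW⟩ := exists_reparametrization hW
  set γ : ℝ → M := fun t ↦ φ.symm (φ p + ρ t • v) with hγ
  have hγ0 : γ 0 = p := by simp only [hγ, hρ0, zero_smul, add_zero, hinv]
  have hl : ContDiff ℝ ∞ fun t ↦ φ p + ρ t • v := contDiff_const.add (hρ.smul contDiff_const)
  have hγs : ContMDiff 𝓘(ℝ, ℝ) 𝓘(ℝ, E) ∞ γ := fun t ↦
    (contMDiffAt_extChartAt_symm (E := E) (hρW t).1).comp t hl.contMDiff.contMDiffAt
  have hq : ContMDiff 𝓘(ℝ, ℝ) 𝓘(ℝ, E) ∞ (m ∘ γ) := fun t ↦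
    ((h (γ t) (hρW t).2).1).comp t hγs.contMDiffAt
  have hq0 : (m ∘ γ) 0 = p := by simp only [Function.comp_apply, hγ0, hm0]
  obtain ⟨Z, hZ, hZx⟩ := hM.exists_isVelocityOf_symm_mul_symm hq
  -- The symmetry at the midpoint sends `p` to `γ t`, and `s_p` then reverses the velocity `v` of
  -- `γ` at `p`; hence the sign.
  refine ⟨-Z, Submodule.neg_mem _ ⟨_, hZ⟩, ?_⟩
  rw [map_neg, hZx]
  change -tderiv ℝ E (fun t ↦ hM.symm ((m ∘ γ) 0) (hM.symm (m (γ t)) p)) 0 1 = v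
  have h3 : (fun t ↦ hM.symm ((m ∘ γ) 0) (hM.symm (m (γ t)) p)) = hM.symm p ∘ γ := by
    funext t
    rw [(h (γ t) (hρW t).2).2, hq0]
    rfl
  have h4 : tderiv ℝ E γ 0 1 = v := by
    have h5 : HasDerivAt (fun t ↦ φ p + ρ t • v) v 0 := by
      simpa using (hρ1.smul_const v).const_add (φ p)
    have h6 : MDifferentiableAt 𝓘(ℝ, E) 𝓘(ℝ, E) φ.symm (φ p + ρ 0 • v) :=
      (contMDiffAt_extChartAt_symm (E := E) (hρW 0).1).mdifferentiableAt (by simp)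
    refine (tderiv_comp_apply (f := fun t : ℝ ↦ φ p + ρ t • v) h6
      h5.differentiableAt.mdifferentiableAt 1).trans ?_
    rw [tderiv_eq_fderiv, fderiv_apply_one_eq_deriv, h5.deriv, hρ0, zero_smul, add_zero,
      tderiv_extChartAt_symm_self]
  rw [h3, tderiv_comp_apply ((hM.isIsometry_symm p).mdifferentiableAt _)
    (hγs.contMDiffAt.mdifferentiableAt (by simp)), hγ0, h4, (hM.isSymmetryAt p).tderiv_eq, neg_neg]

/-- The elements of the transvection algebra that vanish at `p` are the velocities of the
isotropy group. -/
theorem mem_isotropyAlgebra_of_evalAt_eq_zero (hM : IsSymmetricSpace E M) {p : M}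
    {X : VectorFields E M} (hX : X ∈ transvectionAlgebra E M) (h0 : evalAt p X = 0) :
    X ∈ isotropyAlgebra E p := by
  obtain ⟨c, hc⟩ := hX
  obtain ⟨V, hV, m, hm0, h⟩ := hM.exists_midpoint p
  have hW : ∀ᶠ t in 𝓝 (0 : ℝ), c t p ∈ V := by
    have h1 := (hc.contMDiff_curve p).continuous.tendsto 0
    rw [hc.map_zero] at h1
    exact h1.eventually hV
  obtain ⟨ρ, hρ, hρ0, hρ1, hρW⟩ := exists_reparametrization hW
  have hd := hc.reparametrize hρ hρ0 hρ1
  -- The symmetry at the midpoint `q t` exchanges `p` and `c (ρ t) p`, so `s_p s_{q t} c (ρ t)`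
  -- fixes `p`. Since `X` vanishes at `p`, the midpoint has zero velocity, and the correcting factor
  -- leaves the velocity `X` unchanged.
  set q : ℝ → M := fun t ↦ m (c (ρ t) p) with hq
  have hqs : ContMDiff 𝓘(ℝ, ℝ) 𝓘(ℝ, E) ∞ q := fun t ↦
    ((h _ (hρW t)).1).comp t (hd.contMDiff_curve p).contMDiffAt
  have hq0 : q 0 = p := by simp only [hq, hρ0, hc.map_zero, Equiv.Perm.coe_one, id, hm0]
  have hq1 : tderiv ℝ E q 0 1 = 0 := by
    have h2 : MDifferentiableAt 𝓘(ℝ, E) 𝓘(ℝ, E) m (c (ρ 0) p) :=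
      (h _ (hρW 0)).1.mdifferentiableAt (by simp)
    refine (tderiv_comp_apply (f := fun t ↦ c (ρ t) p) h2 (hd.mdifferentiable_curve p 0) 1).trans ?_
    rw [hd.tderiv_curve, h0, map_zero]
  obtain ⟨Z, hZ, hZx⟩ := hM.exists_isVelocityOf_symm_mul_symm hqs
  have hprod := hZ.add hd
  have hX' : Z + X = X := by
    refine add_eq_right.2 (VectorFields.ext_evalAt fun x ↦ ?_)
    rw [hZx, hM.tderiv_symm_symm_eq_zero hqs hq1, map_zero]
  rw [hX'] at hprod
  refine ⟨_, ⟨fun t ↦ ⟨hprod.mem t, ?_⟩, hprod.map_zero, hprod.contMDiff, hprod.velocity⟩⟩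
  change hM.symm (q 0) (hM.symm (q t) (c (ρ t) p)) = p
  have h3 := hM.symm_symm_apply (q t) p
  rw [(h _ (hρW t)).2] at h3
  rw [h3, hq0, hM.symm_self]

end Transitivity

/-! ### The trace of the square of a skew endomorphism. -/

section SkewTrace

variable {V : Type*} [AddCommGroup V] [Module ℝ V] [FiniteDimensional ℝ V]

/-- The trace of the square of an endomorphism that is skew for a positive definite form is a
negative multiple of a sum of squares. -/
theorem trace_sq_of_skew (b : LinearMap.BilinForm ℝ V) (hsymm : ∀ v w, b v w = b w v)
    (hpos : ∀ v, v ≠ 0 → 0 < b v v) (A : V →ₗ[ℝ] V) (hA : ∀ v w, b (A v) w = -b v (A w)) :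
    LinearMap.trace ℝ V (A ∘ₗ A) ≤ 0 ∧ (LinearMap.trace ℝ V (A ∘ₗ A) = 0 → A = 0) := by
  obtain ⟨v, hv⟩ := LinearMap.BilinForm.exists_orthogonal_basis (B := b) ⟨hsymm⟩
  have hne : ∀ i, 0 < b (v i) (v i) := fun i ↦ hpos _ (v.ne_zero i)
  have hrepr : ∀ w i, b (v i) w = v.repr w i * b (v i) (v i) := by
    intro w i
    conv_lhs => rw [← v.sum_repr w]
    rw [map_sum, Finset.sum_eq_single i]
    · simp
    · intro j _ hj
      have : b (v i) (v j) = 0 := hv hj.symm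
      simp [this]
    · simp
  -- The `i`-th diagonal entry of `A²` in the orthogonal basis is `b(v i, A² v i) / b(v i, v i)`,
  -- and skewness moves one factor `A` across.
  have htr : LinearMap.trace ℝ V (A ∘ₗ A) = -∑ i, b (A (v i)) (A (v i)) / b (v i) (v i) := by
    rw [LinearMap.trace_eq_matrix_trace ℝ v, Matrix.trace, ← Finset.sum_neg_distrib]
    refine Finset.sum_congr rfl fun i _ ↦ ?_
    rw [Matrix.diag_apply, LinearMap.toMatrix_apply, eq_comm, ← neg_div, div_eq_iff (hne i).ne',
      ← hrepr, LinearMap.comp_apply, hA, neg_neg]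
  have hnn : ∀ w, 0 ≤ b w w := fun w ↦ by
    rcases eq_or_ne w 0 with rfl | hw
    · simp
    · exact (hpos w hw).le
  have hterm : ∀ i ∈ Finset.univ, 0 ≤ b (A (v i)) (A (v i)) / b (v i) (v i) := fun i _ ↦
    div_nonneg (hnn _) (hne i).le
  refine ⟨by rw [htr]; exact neg_nonpos.2 (Finset.sum_nonneg hterm), fun h ↦ v.ext fun i ↦ ?_⟩
  rw [htr, neg_eq_zero, Finset.sum_eq_zero_iff_of_nonneg hterm] at h
  have h1 := (div_eq_zero_iff.1 (h i (Finset.mem_univ i))).resolve_right (hne i).ne'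
  by_contra h2
  exact (hpos _ h2).ne' h1

end SkewTrace

/-! ### Orthogonal symmetric Lie algebras and their Killing form. -/

section OrthogonalSymmetric

variable {L V : Type*} [LieRing L] [LieAlgebra ℝ L] [AddCommGroup V] [Module ℝ V]

/-- An involutive automorphism `σ` of a Lie algebra `L` and a map `ev` from `L` onto a Euclidean
space `V` such that the fixed points of `σ` form the kernel of `ev` and act effectively on `V` by
skew endomorphisms. -/
structure IsOrthogonalSymmetric (ev : L →ₗ[ℝ] V) (σ : L ≃ₗ⁅ℝ⁆ L) (B : LinearMap.BilinForm ℝ V) :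
    Prop where
  surjective : Function.Surjective ev
  involutive : ∀ X, σ (σ X) = X
  apply_eq_iff : ∀ X, σ X = X ↔ ev X = 0
  symm : ∀ v w, B v w = B w v
  pos : ∀ v, v ≠ 0 → 0 < B v v
  skew : ∀ Z, ev Z = 0 → ∀ X Y, B (ev ⁅Z, X⁆) (ev Y) = -B (ev X) (ev ⁅Z, Y⁆)
  effective : ∀ Z, ev Z = 0 → (∀ X, ev ⁅Z, X⁆ = 0) → Z = 0

namespace IsOrthogonalSymmetric

variable {ev : L →ₗ[ℝ] V} {σ : L ≃ₗ⁅ℝ⁆ L} {B : LinearMap.BilinForm ℝ V}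

theorem ev_add (h : IsOrthogonalSymmetric ev σ B) (X : L) : ev (X + σ X) = 0 := by
  rw [← h.apply_eq_iff, map_add, h.involutive, add_comm]

theorem ev_lie (h : IsOrthogonalSymmetric ev σ B) {Z W : L} (hZ : ev Z = 0) (hW : ev W = 0) :
    ev ⁅Z, W⁆ = 0 := by
  rw [← h.apply_eq_iff] at hZ hW ⊢
  rw [LieEquiv.map_lie, hZ, hW]

/-- The Killing form is definite on the fixed points of `σ`. -/
theorem eq_zero_of_killingForm_self [FiniteDimensional ℝ L] [FiniteDimensional ℝ V]
    (h : IsOrthogonalSymmetric ev σ B) {Z : L} (hZ : ev Z = 0) (hκ : killingForm ℝ L Z Z = 0) :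
    Z = 0 := by
  -- A linear section of `ev`. For `Z` in `ker ev` the operator `D Z` below is the action of `ad Z`
  -- on `V`, independent of the section because `ker ev` is a subalgebra.
  obtain ⟨e, he⟩ := ev.exists_rightInverse_of_surjective (LinearMap.range_eq_top.2 h.surjective)
  have he' : ∀ v, ev (e v) = v := fun v ↦ DFunLike.congr_fun he v
  let D : L →ₗ[ℝ] V →ₗ[ℝ] V := LinearMap.mk₂ ℝ (fun X v ↦ ev ⁅X, e v⁆) (by simp) (by simp)
    (by simp) (by simp)
  have hDev : ∀ Z, ev Z = 0 → ∀ X, D Z (ev X) = ev ⁅Z, X⁆ := by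
    intro Z hZ X
    have h1 : ev ⁅Z, e (ev X) - X⁆ = 0 := h.ev_lie hZ (by rw [map_sub, he', sub_self])
    rw [lie_sub, map_sub, sub_eq_zero] at h1
    exact h1
  have hDskew : ∀ Z, ev Z = 0 → ∀ v w, B (D Z v) w = -B v (D Z w) := by
    intro Z hZ v w
    have := h.skew Z hZ (e v) (e w)
    rwa [he', he'] at this
  have hDlie : ∀ Z W, ev Z = 0 → ev W = 0 → D ⁅Z, W⁆ = D Z ∘ₗ D W - D W ∘ₗ D Z := by
    intro Z W hZ hW
    ext v
    obtain ⟨X, rfl⟩ := h.surjective v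
    simp only [LinearMap.sub_apply, LinearMap.comp_apply]
    rw [hDev _ (h.ev_lie hZ hW), hDev W hW, hDev Z hZ, hDev Z hZ, hDev W hW, lie_lie, map_sub]
  have hDinj : ∀ Z, ev Z = 0 → D Z = 0 → Z = 0 := fun Z hZ h0 ↦
    h.effective Z hZ fun X ↦ by rw [← hDev Z hZ, h0, LinearMap.zero_apply]
  let P : L →ₗ[ℝ] L := LinearMap.id + (σ : L →ₗ[ℝ] L)
  have hP : ∀ X, P X = X + σ X := fun X ↦ rfl
  have hPev : ∀ X, ev (P X) = 0 := h.ev_add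
  -- The metric `B` pulled back to `L`, plus the negative of the trace form of `D` on `ker ev`,
  -- reached through `P = 1 + σ`. It is positive definite because `D` is faithful and skew on `ker
  -- ev`, and `ad Z` is skew for it.
  let b : LinearMap.BilinForm ℝ L := LinearMap.mk₂ ℝ
    (fun X Y ↦ B (ev X) (ev Y) - LinearMap.trace ℝ V (D (P X) ∘ₗ D (P Y)))
    (fun X X' Y ↦ by simp only [map_add, LinearMap.add_apply, LinearMap.add_comp]; ring)
    (fun a X Y ↦ by simp only [map_smul, LinearMap.smul_apply, LinearMap.smul_comp, smul_sub])
    (fun X Y Y' ↦ by simp only [map_add, LinearMap.comp_add]; ring)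
    (fun a X Y ↦ by simp only [map_smul, LinearMap.comp_smul, smul_sub])
  have hb : ∀ X Y, b X Y = B (ev X) (ev Y) - LinearMap.trace ℝ V (D (P X) ∘ₗ D (P Y)) :=
    fun X Y ↦ rfl
  have hbsymm : ∀ X Y, b X Y = b Y X := fun X Y ↦ by
    rw [hb, hb, h.symm, LinearMap.trace_comp_comm']
  have hbpos : ∀ X, X ≠ 0 → 0 < b X X := by
    intro X hX
    rw [hb]
    obtain ⟨h1, h2⟩ := trace_sq_of_skew B h.symm h.pos (D (P X)) (hDskew _ (hPev X))
    by_cases hev : ev X = 0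
    · have h3 : σ X = X := (h.apply_eq_iff X).2 hev
      rw [hev, map_zero, zero_sub, neg_pos]
      refine lt_of_le_of_ne h1 fun h4 ↦ hX ?_
      have h5 := hDinj _ (hPev X) (h2 h4)
      rw [hP, h3, ← two_smul ℝ X] at h5
      exact (smul_eq_zero.1 h5).resolve_left two_ne_zero
    · linarith [h.pos _ hev]
  have hbskew : ∀ X Y, b (LieAlgebra.ad ℝ L Z X) Y = -b X (LieAlgebra.ad ℝ L Z Y) := by
    intro X Y
    have hPlie : ∀ X, P ⁅Z, X⁆ = ⁅Z, P X⁆ := fun X ↦ by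
      rw [hP, hP, LieEquiv.map_lie, (h.apply_eq_iff Z).2 hZ, lie_add]
    rw [LieAlgebra.ad_apply, LieAlgebra.ad_apply, hb, hb, h.skew Z hZ, hPlie, hPlie,
      hDlie _ _ hZ (hPev X), hDlie _ _ hZ (hPev Y)]
    simp only [LinearMap.sub_comp, LinearMap.comp_sub, map_sub]
    have c1 := LinearMap.trace_comp_comm' (D Z) (D (P X) ∘ₗ D (P Y))
    simp only [LinearMap.comp_assoc] at c1 ⊢
    rw [c1]
    ring
  have h1 := (trace_sq_of_skew b hbsymm hbpos _ hbskew).2 hκ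
  refine h.effective Z hZ fun X ↦ ?_
  have h2 : LieAlgebra.ad ℝ L Z X = 0 := by rw [h1, LinearMap.zero_apply]
  rw [LieAlgebra.ad_apply] at h2
  rw [h2, map_zero]

/-- A complement of `ker ev` whose brackets lie in `ker ev` is the `-1`-eigenspace of `σ`. -/
theorem map_eq_neg_of_mem_complement (h : IsOrthogonalSymmetric ev σ B) {m : Submodule ℝ L}
    (hsup : LinearMap.ker ev ⊔ m = ⊤) (hm : ∀ X ∈ m, ∀ Y ∈ m, ev ⁅X, Y⁆ = 0) {X : L}
    (hX : X ∈ m) : σ X = -X := by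
  have hevm : ∀ v, ∃ Y ∈ m, ev Y = v := by
    intro v
    obtain ⟨Y, rfl⟩ := h.surjective v
    obtain ⟨Z, hZ, W, hW, rfl⟩ := Submodule.mem_sup.1 (hsup ▸ Submodule.mem_top : Y ∈ _)
    exact ⟨W, hW, by rw [map_add, LinearMap.mem_ker.1 hZ, zero_add]⟩
  have hsub : ∀ X, ev (σ X) = -ev X := by
    intro X
    have := h.ev_add X
    rw [map_add] at this
    exact eq_neg_of_add_eq_zero_right this
  -- `[X, Y]`, `[σX, σY]` and `[X + σX, Y + σY]` all lie in `ker ev`, so the mixed terms cancel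
  -- there: `ev [σX, Y] = -ev [X, σY]`.
  have hcomm : ∀ X ∈ m, ∀ Y ∈ m, ev ⁅X + σ X, Y⁆ = ev ⁅Y + σ Y, X⁆ := by
    intro X hX Y hY
    have h1 := hm X hX Y hY
    have h2 : ev ⁅σ X, σ Y⁆ = 0 := by rw [← LieEquiv.map_lie, hsub, h1, neg_zero]
    have h3 := h.ev_lie (h.ev_add X) (h.ev_add Y)
    simp only [add_lie, lie_add, map_add, h1, h2] at h3 ⊢
    rw [zero_add, add_zero] at h3
    rw [← lie_skew Y X, ← lie_skew (σ Y) X, map_neg, map_neg, h1, neg_zero, zero_add, zero_add]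
    exact eq_neg_of_add_eq_zero_left h3
  -- A trilinear expression that is symmetric in the first two arguments and skew in the last two
  -- vanishes.
  have hT : ∀ X ∈ m, ∀ Y ∈ m, ∀ W ∈ m, B (ev ⁅X + σ X, Y⁆) (ev W) = 0 := by
    intro X hX Y hY W hW
    have e1 := h.skew _ (h.ev_add X) Y W
    have e2 := h.skew _ (h.ev_add Y) W X
    have e3 := h.skew _ (h.ev_add W) X Y
    rw [hcomm X hX W hW, h.symm] at e1
    rw [hcomm Y hY X hX, h.symm] at e2
    rw [hcomm W hW Y hY, h.symm] at e3
    linarith [h.symm (ev ⁅X + σ X, Y⁆) (ev W)]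
  have hzero : ∀ X ∈ m, ∀ Y, ev ⁅X + σ X, Y⁆ = 0 := by
    intro X hX Y
    obtain ⟨Z, hZ, Y, hY, rfl⟩ := Submodule.mem_sup.1 (hsup ▸ Submodule.mem_top : Y ∈ _)
    rw [lie_add, map_add, h.ev_lie (h.ev_add X) hZ, zero_add]
    by_contra hne
    obtain ⟨W, hW, hWe⟩ := hevm (ev ⁅X + σ X, Y⁆)
    have := hT X hX Y hY W hW
    rw [hWe] at this
    exact (h.pos _ hne).ne' this
  exact eq_neg_of_add_eq_zero_right (h.effective _ (h.ev_add X) (hzero X hX))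

/-- If the radical of the Killing form is central, then the brackets of the `-1`-eigenspace of `σ`
span its fixed points. -/
theorem ker_le_of_lie_mem [FiniteDimensional ℝ L] (h : IsOrthogonalSymmetric ev σ B)
    (hrad : ∀ R : L, (∀ Y, killingForm ℝ L R Y = 0) → ∀ X : L, ⁅X, R⁆ = 0) {K : Submodule ℝ L}
    (hKev : K ≤ LinearMap.ker ev) (hK : ∀ X Y, σ X = -X → σ Y = -Y → ⁅X, Y⁆ ∈ K) :
    LinearMap.ker ev ≤ K := by
  have hsplit : ∀ X : L, (2 : ℝ) • X = (X + σ X) + (X - σ X) := fun X ↦ by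
    rw [two_smul]; abel
  have hanti : ∀ X, σ (X - σ X) = -(X - σ X) := fun X ↦ by
    rw [map_sub, h.involutive, neg_sub]
  have key : ∀ Z, ev Z = 0 → (∀ W ∈ K, killingForm ℝ L Z W = 0) → Z = 0 := by
    intro Z hZ hZK
    have hσZ := (h.apply_eq_iff Z).2 hZ
    -- `[Z, X]` lies in the radical. Against the `-1`-eigenspace, invariance moves the bracket to an
    -- element of `K`; against the fixed points, `κ` vanishes because `σ` preserves it and the
    -- eigenvalues differ.
    have hR : ∀ X, σ X = -X → ∀ Y, killingForm ℝ L ⁅Z, X⁆ Y = 0 := by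
      intro X hX Y
      have h1 : killingForm ℝ L ⁅Z, X⁆ (Y - σ Y) = 0 := by
        rw [LieModule.traceForm_apply_lie_apply]
        exact hZK _ (hK _ _ hX (hanti Y))
      have h2 : killingForm ℝ L ⁅Z, X⁆ (Y + σ Y) = 0 := by
        have h3 := LieAlgebra.killingForm_of_equiv_apply σ ⁅Z, X⁆ (Y + σ Y)
        rw [LieEquiv.map_lie, hσZ, hX, (h.apply_eq_iff _).2 (h.ev_add Y), lie_neg, map_neg,
          LinearMap.neg_apply] at h3
        linarith
      have h4 : killingForm ℝ L ⁅Z, X⁆ ((2 : ℝ) • Y) = 0 := by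
        rw [hsplit, map_add, h1, h2, add_zero]
      rw [map_smul] at h4
      exact (smul_eq_zero.1 h4).resolve_left two_ne_zero
    -- `[Z, X]` is central, so `[Z, [Z, X]] = 0`, and skewness gives `B(ev [Z, X], ev [Z, X]) = 0`.
    have hD : ∀ X, σ X = -X → ev ⁅Z, X⁆ = 0 := by
      intro X hX
      have h1 := h.skew Z hZ X ⁅Z, X⁆
      rw [hrad _ (hR X hX) Z, map_zero, map_zero, neg_zero] at h1
      by_contra hne
      exact (h.pos _ hne).ne' h1
    refine h.effective Z hZ fun X ↦ ?_
    have h1 : (2 : ℝ) • ev ⁅Z, X⁆ = 0 := by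
      rw [← map_smul, ← lie_smul, hsplit, lie_add, map_add, h.ev_lie hZ (h.ev_add X),
        hD _ (hanti X), add_zero]
    exact (smul_eq_zero.1 h1).resolve_left two_ne_zero
  -- The Killing form embeds `ker ev` into the dual of its subspace `K`, which forces equality of
  -- dimensions.
  let T : LinearMap.ker ev →ₗ[ℝ] K →ₗ[ℝ] ℝ :=
    (killingForm ℝ L).compl₁₂ (LinearMap.ker ev).subtype K.subtype
  have hT : Function.Injective T := by
    refine LinearMap.ker_eq_bot.1 (LinearMap.ker_eq_bot'.2 fun Z hZ ↦ Subtype.ext ?_)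
    exact key Z.1 Z.2 fun W hW ↦ DFunLike.congr_fun hZ ⟨W, hW⟩
  have hrank := LinearMap.finrank_le_finrank_of_injective hT
  rw [Subspace.dual_finrank_eq] at hrank
  exact (Submodule.eq_of_le_of_finrank_le hKev hrank).ge

end IsOrthogonalSymmetric

end OrthogonalSymmetric

/-! ### Isotropy algebra and evaluation at the base point. -/

section Velocity

variable {E : Type*} [NormedAddCommGroup E] [NormedSpace ℝ E]
  {M : Type*} [TopologicalSpace M] [ChartedSpace E M]

theorem IsVelocityOf.unique {G G' : Subgroup (Equiv.Perm M)} {c : ℝ → Equiv.Perm M}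
    {X Y : VectorFields E M} (hX : IsVelocityOf G c X) (hY : IsVelocityOf G' c Y) : X = Y :=
  VectorFields.ext_evalAt fun x ↦ by rw [← hX.tderiv_curve, hY.tderiv_curve]

variable [RiemannianBundle (fun x : M ↦ TangentSpace 𝓘(ℝ, E) x)]

theorem isotropyAlgebra_le (p : M) : isotropyAlgebra E p ≤ transvectionAlgebra E M := by
  rintro X ⟨c, hc⟩
  exact ⟨c, fun t ↦ (hc.mem t).1, hc.map_zero, hc.contMDiff, hc.velocity⟩

theorem evalAt_eq_zero_of_mem_isotropyAlgebra {p : M} {X : VectorFields E M}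
    (hX : X ∈ isotropyAlgebra E p) : evalAt p X = 0 := by
  obtain ⟨c, hc⟩ := hX
  have h1 : (fun t ↦ c t p) = fun _ ↦ p := funext fun t ↦ (hc.mem t).2
  rw [← hc.tderiv_curve, h1, tderiv_const]
  rfl

theorem evalAt_Ad_symm (hM : IsSymmetricSpace E M) (p : M) (X : VectorFields E M) :
    evalAt p (Ad (hM.symm p) X) = -evalAt p X := by
  have h1 := (hM.isIsometry_symm p).evalAt_map_Ad X p
  rwa [hM.symm_self, (hM.isSymmetryAt p).tderiv_eq] at h1

/-- The evaluation at `p` on the transvection algebra. -/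
def transvectionEval (p : M) : transvectionAlgebra E M →ₗ[ℝ] E :=
  (evalAt p).comp (transvectionAlgebra E M).subtype

theorem transvectionEval_apply (p : M) (X : transvectionAlgebra E M) :
    transvectionEval p X = evalAt p X.1 := rfl

theorem transvectionEval_eq_zero {p : M} {X : transvectionAlgebra E M}
    (hX : X.1 ∈ isotropyAlgebra E p) : transvectionEval p X = 0 :=
  (transvectionEval_apply p X).trans (evalAt_eq_zero_of_mem_isotropyAlgebra hX)

variable (E) in
/-- The metric at `p`, as a bilinear form. -/
def metricBilinForm (p : M) : LinearMap.BilinForm ℝ E :=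
  (ContinuousLinearMap.coeLM ℝ).comp (metricForm E p : E →ₗ[ℝ] E →L[ℝ] ℝ)

end Velocity

/-! ### Skewness of the isotropy action. -/

section IsotropySkew

variable {E : Type*} [NormedAddCommGroup E] [NormedSpace ℝ E] [FiniteDimensional ℝ E]
  {M : Type*} [EMetricSpace M] [ChartedSpace E M] [IsManifold 𝓘(ℝ, E) ∞ M]
  [RiemannianBundle (fun x : M ↦ TangentSpace 𝓘(ℝ, E) x)]

/-- The elements of the isotropy algebra act on the tangent space at `p` by skew endomorphisms. -/
theorem metricForm_mlieBracket_of_mem_isotropyAlgebra {p : M} {Z : VectorFields E M}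
    (hZ : Z ∈ isotropyAlgebra E p) {X Y : VectorFields E M} (hX : X ∈ transvectionAlgebra E M)
    (hY : Y ∈ transvectionAlgebra E M) :
    metricForm E p (evalAt p (VectorField.mlieBracket 𝓘(ℝ, E) Z X)) (evalAt p Y) =
      -metricForm E p (evalAt p X) (evalAt p (VectorField.mlieBracket 𝓘(ℝ, E) Z Y)) := by
  obtain ⟨c, hc⟩ := hZ
  have hiso : ∀ g ∈ transvectionGroup E M ⊓ MulAction.stabilizer (Equiv.Perm M) p,
      IsIsometry E g := fun g hg ↦ isIsometry_of_mem_transvectionGroup hg.1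
  have dX := hc.hasDerivAt_Ad_inv hiso (differentiableAt_fieldRep hX p)
  have dY := hc.hasDerivAt_Ad_inv hiso (differentiableAt_fieldRep hY p)
  have h0 : ∀ W : VectorFields E M, evalAt p (Ad (c 0)⁻¹ W) = evalAt p W := fun W ↦ by
    rw [hc.map_zero, inv_one, Ad_one]
  have d1 := ((metricForm E p).hasFDerivAt.comp_hasDerivAt 0 dX).clm_apply dY
  -- Each `c t` fixes `p` and preserves the inner product there; the derivative of this constant
  -- function is the skewness relation.
  have d2 : (fun t ↦ metricForm E p (evalAt p (Ad (c t)⁻¹ X)) (evalAt p (Ad (c t)⁻¹ Y))) =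
      fun _ ↦ metricForm E p (evalAt p X) (evalAt p Y) := by
    funext t
    have hp : c t p = p := (hc.mem t).2
    have hg := hiso _ (hc.mem t)
    rw [hg.evalAt_Ad_inv, hg.evalAt_Ad_inv, hp]
    have h1 := hg.inv.metricForm_map p (evalAt p X) (evalAt p Y)
    have h2 : (c t)⁻¹ p = p := by rw [Equiv.Perm.inv_eq_iff_eq, hp]
    rwa [h2] at h1
  have d3 := (hasDerivAt_const (0 : ℝ) (metricForm E p (evalAt p X) (evalAt p Y)))
  rw [← d2] at d3
  have h4 := d1.unique d3
  simp only [Function.comp_apply, h0] at h4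
  linarith

end IsotropySkew

/-! ### The transvection algebra is orthogonal symmetric, and the Killing radical is central. -/

section Instantiation

open scoped Topology

variable {E : Type*} [NormedAddCommGroup E] [NormedSpace ℝ E] [FiniteDimensional ℝ E]
  {M : Type*} [EMetricSpace M] [ChartedSpace E M] [IsManifold 𝓘(ℝ, E) ∞ M]
  [RiemannianBundle (fun x : M ↦ TangentSpace 𝓘(ℝ, E) x)]
  [IsContMDiffRiemannianBundle 𝓘(ℝ, E) ∞ E (fun x : M ↦ TangentSpace 𝓘(ℝ, E) x)]
  [IsRiemannianManifold 𝓘(ℝ, E) M] [PreconnectedSpace M]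

theorem IsSymmetricSpace.commute_symm (hM : IsSymmetricSpace E M) {p : M} {g : Equiv.Perm M}
    (hg : IsIsometry E g) (hp : g p = p) : hM.symm p * g * (hM.symm p)⁻¹ = g := by
  have h1 := hM.conj_symm hg p
  rw [hp, mul_inv_eq_iff_eq_mul] at h1
  rw [← h1, mul_inv_cancel_right]

/-- The conjugate of `s_p` by an isometry fixing `p` is again the symmetry at `p`. So `s_p` commutes
with the isotropy group, and conjugation leaves a curve in it unchanged. -/
theorem Ad_symm_of_mem_isotropyAlgebra (hM : IsSymmetricSpace E M) {p : M} {X : VectorFields E M}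
    (hX : X ∈ isotropyAlgebra E p) : Ad (hM.symm p) X = X := by
  obtain ⟨c, hc⟩ := hX
  have h1 : ∀ t, hM.symm p * c t * (hM.symm p)⁻¹ = c t := fun t ↦
    hM.commute_symm (isIsometry_of_mem_transvectionGroup (hc.mem t).1) (hc.mem t).2
  -- In the full permutation group, closure under conjugation by `s_p` is automatic.
  have h2 : IsVelocityOf ⊤ c X :=
    ⟨fun _ ↦ Subgroup.mem_top _, hc.map_zero, hc.contMDiff, hc.velocity⟩
  have h3 := h2.conj (hM.isIsometry_symm p) fun _ _ ↦ Subgroup.mem_top _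
  simp only [h1] at h3
  exact h3.unique hc

theorem Ad_symm_Ad_symm (hM : IsSymmetricSpace E M) (p : M) (X : VectorFields E M) :
    Ad (hM.symm p) (Ad (hM.symm p) X) = X := by
  rw [← (hM.isIsometry_symm p).Ad_mul (hM.isIsometry_symm p), hM.symm_mul_self, Ad_one]

/-- The involution of the transvection algebra defined by the symmetry at `p`. -/
def IsSymmetricSpace.involution (hM : IsSymmetricSpace E M) (p : M) :
    transvectionAlgebra E M ≃ₗ⁅ℝ⁆ transvectionAlgebra E M :=
  adEquiv (hM.symm p) (hM.isIsometry_symm p)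

theorem IsSymmetricSpace.coe_involution (hM : IsSymmetricSpace E M) (p : M)
    (X : transvectionAlgebra E M) : (hM.involution p X).1 = Ad (hM.symm p) X.1 := rfl

theorem isOrthogonalSymmetric (hM : IsSymmetricSpace E M) (p : M) :
    IsOrthogonalSymmetric (transvectionEval (E := E) p) (hM.involution p)
      (metricBilinForm E p) where
  surjective v := by
    obtain ⟨X, hX, hv⟩ := exists_mem_transvectionAlgebra_evalAt_eq hM p v
    exact ⟨⟨X, hX⟩, hv⟩
  involutive X := Subtype.ext (Ad_symm_Ad_symm hM p X.1)
  apply_eq_iff X := by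
    rw [transvectionEval_apply]
    refine ⟨fun h ↦ ?_, fun h ↦ Subtype.ext (Ad_symm_of_mem_isotropyAlgebra hM
      (mem_isotropyAlgebra_of_evalAt_eq_zero hM X.2 h))⟩
    have h1 := evalAt_Ad_symm hM p X.1
    rw [← hM.coe_involution, h] at h1
    rw [← add_eq_zero_iff_eq_neg, ← two_smul ℝ] at h1
    exact (smul_eq_zero.1 h1).resolve_left two_ne_zero
  symm := metricForm_symm p
  pos _ := metricForm_pos p
  skew Z hZ X Y := metricForm_mlieBracket_of_mem_isotropyAlgebra
    (mem_isotropyAlgebra_of_evalAt_eq_zero hM Z.2 hZ) X.2 Y.2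
  effective Z hZ h := by
    -- If `Z` vanishes at `p`, then `[Z, X](p)` is `-DZ` applied to `X(p)`, and the vectors `X(p)`
    -- fill the tangent space. So the whole 1-jet of `Z` at `p` is zero.
    refine Subtype.ext (eq_zero_of_fieldRep_eq_zero
      (fun _ ↦ isIsometry_of_mem_transvectionGroup) Z.2 hZ ?_)
    ext v
    obtain ⟨X, hX, rfl⟩ := exists_mem_transvectionAlgebra_evalAt_eq hM p v
    have h1 := h ⟨X, hX⟩
    rw [transvectionEval_apply] at hZ h1
    rw [coe_bracket, mlieBracket_eq_fieldRep, hZ, map_zero, zero_sub, neg_eq_zero] at h1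
    exact h1

/-- The radical of the Killing form of the transvection algebra is central. -/
theorem lie_eq_zero_of_killingForm_eq_zero (hM : IsSymmetricSpace E M)
    {R : transvectionAlgebra E M} (hR : ∀ Y, killingForm ℝ (transvectionAlgebra E M) R Y = 0)
    (X : transvectionAlgebra E M) : ⁅X, R⁆ = 0 := by
  -- `R + σ_q R` is fixed by `σ_q` and still in the radical, in particular isotropic; definiteness
  -- on the fixed points makes it zero, for every point `q`.
  have hσ : ∀ q, Ad (hM.symm q) R.1 = -R.1 := by
    intro q
    have : Nonempty M := ⟨q⟩
    have h := isOrthogonalSymmetric hM q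
    have h1 : ∀ Y, killingForm ℝ (transvectionAlgebra E M) (hM.involution q R) Y = 0 := by
      intro Y
      rw [← h.involutive Y, LieAlgebra.killingForm_of_equiv_apply, hR]
    have h2 : ∀ Y, killingForm ℝ (transvectionAlgebra E M) (R + hM.involution q R) Y = 0 := by
      intro Y
      rw [map_add, LinearMap.add_apply, hR, h1, add_zero]
    have h3 : R + hM.involution q R = 0 := h.eq_zero_of_killingForm_self (h.ev_add R) (h2 _)
    exact congrArg Subtype.val (eq_neg_of_add_eq_zero_right h3)
  -- Two sign changes cancel on each generator `s_p s_q`.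
  have hAd : ∀ g ∈ transvectionGroup E M, Ad g R.1 = R.1 := by
    intro g hg
    induction hg using Subgroup.closure_induction with
    | mem t ht =>
      obtain ⟨p, q, s, s', hs, hs', rfl⟩ := ht
      rw [hs.unique (hM.isSymmetryAt p), hs'.unique (hM.isSymmetryAt q),
        (hM.isIsometry_symm p).Ad_mul (hM.isIsometry_symm q), hσ, ← neg_one_smul ℝ R.1,
        ← adMap_apply, map_smul, adMap_apply, hσ, neg_one_smul, neg_neg]
    | one => exact Ad_one _
    | mul x y hx hy hx' hy' =>
      rw [(isIsometry_of_mem_transvectionGroup hx).Ad_mul (isIsometry_of_mem_transvectionGroup hy),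
        hy', hx']
    | inv x hx hx' =>
      have hx := isIsometry_of_mem_transvectionGroup hx
      conv_lhs => rw [← hx', ← hx.inv.Ad_mul hx, inv_mul_cancel, Ad_one]
  obtain ⟨c, hc⟩ := X.2
  refine Subtype.ext (VectorFields.ext_evalAt fun x ↦ ?_)
  have h1 := hc.hasDerivAt_Ad_inv (fun _ ↦ isIsometry_of_mem_transvectionGroup)
    (differentiableAt_fieldRep R.2 x)
  have h2 : (fun t ↦ evalAt x (Ad (c t)⁻¹ R.1)) = fun _ ↦ evalAt x R.1 :=
    funext fun t ↦ by rw [hAd _ (Subgroup.inv_mem _ (hc.mem t))]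
  rw [h2] at h1
  exact h1.unique (hasDerivAt_const _ _)

end Instantiation

/-! ### Spans of brackets and reformulations. -/

section BracketSpan

variable {E : Type*} [NormedAddCommGroup E] [NormedSpace ℝ E]
  {M : Type*} [TopologicalSpace M] [ChartedSpace E M]

theorem mlieBracket_mem_bracketSpan {𝔞 𝔟 : Submodule ℝ (VectorFields E M)} {X Y : VectorFields E M}
    (hX : X ∈ 𝔞) (hY : Y ∈ 𝔟) : VectorField.mlieBracket 𝓘(ℝ, E) X Y ∈ bracketSpan 𝔞 𝔟 :=
  Submodule.subset_span ⟨X, hX, Y, hY, rfl⟩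

theorem bracketSpan_le {𝔞 𝔟 𝔠 : Submodule ℝ (VectorFields E M)}
    (h : ∀ X ∈ 𝔞, ∀ Y ∈ 𝔟, VectorField.mlieBracket 𝓘(ℝ, E) X Y ∈ 𝔠) : bracketSpan 𝔞 𝔟 ≤ 𝔠 := by
  refine Submodule.span_le.2 ?_
  rintro _ ⟨X, hX, Y, hY, rfl⟩
  exact h X hX Y hY

variable [RiemannianBundle (fun x : M ↦ TangentSpace 𝓘(ℝ, E) x)]
  {p : M} {𝔪 : Submodule ℝ (VectorFields E M)}

theorem IsSymmetricComplement.le (h : IsSymmetricComplement p 𝔪) : 𝔪 ≤ transvectionAlgebra E M :=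
  h.sup_eq ▸ le_sup_right

theorem isCanonicalForm_iff {Ω : OneForm E M (transvectionAlgebra E M)} :
    IsCanonicalForm p 𝔪 Ω ↔ ∀ g ∈ transvectionGroup E M, ∀ X ∈ 𝔪,
      (Ω (g p) (tderiv E E g p (evalAt p X) : E)).1 = Ad g X :=
  Iff.rfl

end BracketSpan

/-! ### Existence and uniqueness of the complement, and the span of its brackets. -/

section Complement

variable {E : Type*} [NormedAddCommGroup E] [NormedSpace ℝ E] [FiniteDimensional ℝ E]
  {M : Type*} [EMetricSpace M] [ChartedSpace E M] [IsManifold 𝓘(ℝ, E) ∞ M]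
  [RiemannianBundle (fun x : M ↦ TangentSpace 𝓘(ℝ, E) x)]
  [IsContMDiffRiemannianBundle 𝓘(ℝ, E) ∞ E (fun x : M ↦ TangentSpace 𝓘(ℝ, E) x)]
  [IsRiemannianManifold 𝓘(ℝ, E) M] [PreconnectedSpace M]
  {p : M} {𝔪 : Submodule ℝ (VectorFields E M)}

/-- Take the `-1`-eigenspace of the involution at `p`: the bracket relations are the sign rules for
an automorphism, and `X = ½(X + σX) + ½(X - σX)` is the decomposition. -/
theorem exists_isSymmetricComplement (hM : IsSymmetricSpace E M) (p : M) :
    ∃ 𝔪 : Submodule ℝ (VectorFields E M), IsSymmetricComplement p 𝔪 := by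
  set s := hM.symm p with hs
  have hiso := hM.isIsometry_symm p
  let 𝔪 : Submodule ℝ (VectorFields E M) :=
    transvectionAlgebra E M ⊓ LinearMap.ker (adMap s + LinearMap.id)
  have h𝔪 : ∀ X, X ∈ 𝔪 ↔ X ∈ transvectionAlgebra E M ∧ Ad s X = -X := fun X ↦ by
    rw [Submodule.mem_inf, LinearMap.mem_ker, LinearMap.add_apply, adMap_apply, LinearMap.id_apply,
      add_eq_zero_iff_eq_neg]
  have hfix : ∀ X ∈ transvectionAlgebra E M, Ad s X = X → X ∈ isotropyAlgebra E p := fun X hX h ↦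
    mem_isotropyAlgebra_of_evalAt_eq_zero hM hX
      (((isOrthogonalSymmetric hM p).apply_eq_iff ⟨X, hX⟩).1 (Subtype.ext h))
  refine ⟨𝔪, ?_, ?_, ?_, ?_⟩
  · refine (Submodule.eq_bot_iff _).2 fun X hX ↦ ?_
    have h1 := Ad_symm_of_mem_isotropyAlgebra hM hX.1
    rw [((h𝔪 X).1 hX.2).2] at h1
    have h2 : (2 : ℝ) • X = 0 := by rw [two_smul]; nth_rewrite 1 [← h1]; exact neg_add_cancel X
    exact (smul_eq_zero.1 h2).resolve_left two_ne_zero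
  · refine le_antisymm (sup_le (isotropyAlgebra_le p) inf_le_left) fun X hX ↦ ?_
    have hsX := Ad_mem_transvectionAlgebra hX hiso
    have h1 : X + Ad s X ∈ isotropyAlgebra E p := by
      refine hfix _ (Submodule.add_mem _ hX hsX) ?_
      rw [← adMap_apply, map_add, adMap_apply, adMap_apply, Ad_symm_Ad_symm, add_comm]
    have h2 : X - Ad s X ∈ 𝔪 := by
      refine (h𝔪 _).2 ⟨Submodule.sub_mem _ hX hsX, ?_⟩
      rw [← adMap_apply, map_sub, adMap_apply, adMap_apply, Ad_symm_Ad_symm, neg_sub]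
    have h3 : X = (2⁻¹ : ℝ) • ((X + Ad s X) + (X - Ad s X)) := by
      rw [add_add_sub_cancel, ← two_smul ℝ X, smul_smul, inv_mul_cancel₀ two_ne_zero, one_smul]
    rw [h3]
    exact Submodule.smul_mem _ _ (Submodule.add_mem_sup h1 h2)
  · refine bracketSpan_le fun X hX Y hY ↦ ?_
    obtain ⟨hX, hX'⟩ := (h𝔪 X).1 hX
    obtain ⟨hY, hY'⟩ := (h𝔪 Y).1 hY
    refine hfix _ (⁅(⟨X, hX⟩ : transvectionAlgebra E M), (⟨Y, hY⟩ : transvectionAlgebra E M)⁆).2 ?_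
    have h1 := LieEquiv.map_lie (hM.involution p) ⟨X, hX⟩ ⟨Y, hY⟩
    have h2 : hM.involution p ⟨X, hX⟩ = -⟨X, hX⟩ := Subtype.ext hX'
    have h3 : hM.involution p ⟨Y, hY⟩ = -⟨Y, hY⟩ := Subtype.ext hY'
    rw [h2, h3, neg_lie, lie_neg, neg_neg] at h1
    exact congrArg Subtype.val h1
  · refine bracketSpan_le fun X hX Y hY ↦ ?_
    obtain ⟨hX, hX'⟩ := (h𝔪 X).1 hX
    have hY' := Ad_symm_of_mem_isotropyAlgebra hM hY
    replace hY := isotropyAlgebra_le p hY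
    refine (h𝔪 _).2 ⟨(⁅(⟨X, hX⟩ : transvectionAlgebra E M),
      (⟨Y, hY⟩ : transvectionAlgebra E M)⁆).2, ?_⟩
    have h1 := LieEquiv.map_lie (hM.involution p) ⟨X, hX⟩ ⟨Y, hY⟩
    have h2 : hM.involution p ⟨X, hX⟩ = -⟨X, hX⟩ := Subtype.ext hX'
    have h3 : hM.involution p ⟨Y, hY⟩ = ⟨Y, hY⟩ := Subtype.ext hY'
    rw [h2, h3, neg_lie] at h1
    exact congrArg Subtype.val h1

/-- Any complement lies in the `-1`-eigenspace by `map_eq_neg_of_mem_complement`, and exhausts it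
because the 𝔥-component of an element there is both fixed and negated. So 𝔪 is unique. -/
theorem IsSymmetricComplement.mem_iff (hM : IsSymmetricSpace E M)
    (h : IsSymmetricComplement p 𝔪) {X : VectorFields E M} :
    X ∈ 𝔪 ↔ X ∈ transvectionAlgebra E M ∧ Ad (hM.symm p) X = -X := by
  have hO := isOrthogonalSymmetric hM p
  have hneg : ∀ X ∈ 𝔪, Ad (hM.symm p) X = -X := by
    intro X hX
    have hsup : LinearMap.ker (transvectionEval (E := E) p) ⊔
        𝔪.comap (transvectionAlgebra E M).subtype = ⊤ := by
      refine eq_top_iff.2 fun Y _ ↦ ?_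
      obtain ⟨Z, hZ, W, hW, hY⟩ := Submodule.mem_sup.1 (h.sup_eq.ge Y.2)
      have hYeq : Y = ⟨Z, isotropyAlgebra_le p hZ⟩ + ⟨W, h.le hW⟩ := Subtype.ext hY.symm
      rw [hYeq]
      exact Submodule.add_mem_sup (transvectionEval_eq_zero hZ) hW
    have h1 := hO.map_eq_neg_of_mem_complement hsup (X := ⟨X, h.le hX⟩) (fun Y hY W hW ↦
      transvectionEval_eq_zero (h.bracket_self (mlieBracket_mem_bracketSpan hY hW))) hX
    exact congrArg Subtype.val h1
  refine ⟨fun hX ↦ ⟨h.le hX, hneg X hX⟩, fun ⟨hX, hX'⟩ ↦ ?_⟩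
  obtain ⟨Z, hZ, W, hW, rfl⟩ := Submodule.mem_sup.1 (h.sup_eq.ge hX)
  have h1 := Ad_symm_of_mem_isotropyAlgebra hM hZ
  rw [← adMap_apply, map_add, adMap_apply, adMap_apply, h1, hneg W hW, neg_add, add_left_inj] at hX'
  have h2 : (2 : ℝ) • Z = 0 := by rw [two_smul]; nth_rewrite 1 [hX']; exact neg_add_cancel Z
  rwa [(smul_eq_zero.1 h2).resolve_left two_ne_zero, zero_add]

theorem IsSymmetricComplement.bracketSpan_eq (hM : IsSymmetricSpace E M)
    (h : IsSymmetricComplement p 𝔪) : bracketSpan 𝔪 𝔪 = isotropyAlgebra E p := by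
  have : Nonempty M := ⟨p⟩
  refine le_antisymm h.bracket_self fun Z hZ ↦ ?_
  have hK := (isOrthogonalSymmetric hM p).ker_le_of_lie_mem
    (fun R hR X ↦ lie_eq_zero_of_killingForm_eq_zero hM hR X)
    (K := (bracketSpan 𝔪 𝔪).comap (transvectionAlgebra E M).subtype)
    (fun X hX ↦ transvectionEval_eq_zero (h.bracket_self hX))
    (fun X Y hX hY ↦ mlieBracket_mem_bracketSpan
      ((h.mem_iff hM).2 ⟨X.2, congrArg Subtype.val hX⟩)
      ((h.mem_iff hM).2 ⟨Y.2, congrArg Subtype.val hY⟩))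
  exact hK (x := ⟨Z, isotropyAlgebra_le p hZ⟩) (transvectionEval_eq_zero hZ)

theorem IsSymmetricComplement.exists_evalAt_eq (hM : IsSymmetricSpace E M)
    (h : IsSymmetricComplement p 𝔪) (v : E) : ∃ X ∈ 𝔪, evalAt p X = v := by
  obtain ⟨X, hX, rfl⟩ := exists_mem_transvectionAlgebra_evalAt_eq hM p v
  obtain ⟨Z, hZ, W, hW, rfl⟩ := Submodule.mem_sup.1 (h.sup_eq.ge hX)
  exact ⟨W, hW, by rw [map_add, evalAt_eq_zero_of_mem_isotropyAlgebra hZ, zero_add]⟩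

theorem IsSymmetricComplement.eq_zero_of_evalAt_eq_zero (hM : IsSymmetricSpace E M)
    (h : IsSymmetricComplement p 𝔪) {X : VectorFields E M} (hX : X ∈ 𝔪) (h0 : evalAt p X = 0) :
    X = 0 :=
  (Submodule.eq_bot_iff _).1 h.disjoint X
    ⟨mem_isotropyAlgebra_of_evalAt_eq_zero hM (h.le hX) h0, hX⟩

/-- `g` commutes with `s_p`, hence `Ad g` preserves the eigenspaces of `Ad s_p`. This makes the
canonical form independent of the choice of group element. -/
theorem IsSymmetricComplement.Ad_mem (hM : IsSymmetricSpace E M) (h : IsSymmetricComplement p 𝔪)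
    {g : Equiv.Perm M} (hg : g ∈ transvectionGroup E M) (hp : g p = p) {X : VectorFields E M}
    (hX : X ∈ 𝔪) : Ad g X ∈ 𝔪 := by
  have hiso := isIsometry_of_mem_transvectionGroup hg
  have hs := hM.isIsometry_symm p
  have hcomm : hM.symm p * g = g * hM.symm p := by
    have h1 := hM.commute_symm hiso hp
    rwa [mul_inv_eq_iff_eq_mul] at h1
  rw [h.mem_iff hM] at hX ⊢
  refine ⟨Ad_mem_transvectionAlgebra hX.1 hiso, ?_⟩
  rw [← hs.Ad_mul hiso, hcomm, hiso.Ad_mul hs, hX.2]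
  exact map_neg (adMap g) X

/-- The evaluation at `p` identifies the complement with the tangent space at `p`. -/
def IsSymmetricComplement.evalEquiv (hM : IsSymmetricSpace E M) (h : IsSymmetricComplement p 𝔪) :
    𝔪 ≃ₗ[ℝ] E :=
  LinearEquiv.ofBijective ((evalAt p).comp 𝔪.subtype)
    ⟨LinearMap.ker_eq_bot.1 (LinearMap.ker_eq_bot'.2 fun X hX ↦
      Subtype.ext (h.eq_zero_of_evalAt_eq_zero hM X.2 hX)), fun v ↦ by
      obtain ⟨X, hX, rfl⟩ := h.exists_evalAt_eq hM v
      exact ⟨⟨X, hX⟩, rfl⟩⟩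

theorem IsSymmetricComplement.evalEquiv_symm_evalAt (hM : IsSymmetricSpace E M)
    (h : IsSymmetricComplement p 𝔪) {X : VectorFields E M} (hX : X ∈ 𝔪) :
    ((h.evalEquiv hM).symm (evalAt p X)).1 = X :=
  congrArg Subtype.val ((h.evalEquiv hM).symm_apply_apply ⟨X, hX⟩)

end Complement

/-! ### The canonical one-form: existence, uniqueness and fullness. -/

section CanonicalForm

variable {E : Type*} [NormedAddCommGroup E] [NormedSpace ℝ E] [FiniteDimensional ℝ E]
  {M : Type*} [EMetricSpace M] [ChartedSpace E M] [IsManifold 𝓘(ℝ, E) ∞ M]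
  [RiemannianBundle (fun x : M ↦ TangentSpace 𝓘(ℝ, E) x)]
  [IsContMDiffRiemannianBundle 𝓘(ℝ, E) ∞ E (fun x : M ↦ TangentSpace 𝓘(ℝ, E) x)]
  [IsRiemannianManifold 𝓘(ℝ, E) M] [PreconnectedSpace M]
  {p : M} {𝔪 : Submodule ℝ (VectorFields E M)}

/-- The one-form defined by a choice, for each point `x`, of an isometry `g x` mapping `p` to
`x`. -/
def IsSymmetricComplement.form (hM : IsSymmetricSpace E M) (h : IsSymmetricComplement p 𝔪)
    (g : M → Equiv.Perm M) (hg : ∀ x, g x ∈ transvectionGroup E M) :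
    OneForm E M (transvectionAlgebra E M) := fun x ↦
  ((adEquiv (g x) (isIsometry_of_mem_transvectionGroup (hg x)) :
      transvectionAlgebra E M →ₗ⁅ℝ⁆ transvectionAlgebra E M) :
      transvectionAlgebra E M →ₗ[ℝ] transvectionAlgebra E M) ∘ₗ
    (Submodule.inclusion h.le) ∘ₗ ((h.evalEquiv hM).symm : E →ₗ[ℝ] 𝔪) ∘ₗ
      (tderiv E E ((g x)⁻¹ : Equiv.Perm M) x : E →ₗ[ℝ] E)

theorem IsSymmetricComplement.form_apply (hM : IsSymmetricSpace E M)
    (h : IsSymmetricComplement p 𝔪) (g : M → Equiv.Perm M) (hg : ∀ x, g x ∈ transvectionGroup E M)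
    (x : M) (v : E) : (h.form hM g hg x v).1 =
      Ad (g x) ((h.evalEquiv hM).symm (tderiv E E ((g x)⁻¹ : Equiv.Perm M) x v)).1 := rfl

/-- Choose for each point some `k` carrying `p` there. Any other `g` with the same image differs
from `k` by the isotropy element `k⁻¹ g`, which preserves 𝔪, so `Ad_k Ad_{k⁻¹ g} X = Ad_g X` is the
value prescribed. -/
theorem IsSymmetricComplement.exists_isCanonicalForm (hM : IsSymmetricSpace E M)
    (h : IsSymmetricComplement p 𝔪) :
    ∃ Ω : OneForm E M (transvectionAlgebra E M), IsCanonicalForm p 𝔪 Ω := by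
  choose γ hγ hγp using exists_transvectionGroup_apply_eq hM p
  refine ⟨h.form hM γ hγ, isCanonicalForm_iff.2 fun g hg X hX ↦ ?_⟩
  set k := γ (g p) with hk
  have hkp : k p = g p := hγp (g p)
  have hkiso := isIsometry_of_mem_transvectionGroup (hγ (g p))
  have hgiso := isIsometry_of_mem_transvectionGroup hg
  have hmem : k⁻¹ * g ∈ transvectionGroup E M := Subgroup.mul_mem _ (Subgroup.inv_mem _ (hγ _)) hg
  have hfix : (k⁻¹ * g) p = p := by
    rw [Equiv.Perm.mul_apply, ← hkp, Equiv.Perm.coe_inv, Equiv.symm_apply_apply]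
  have hX' := h.Ad_mem hM hmem hfix hX
  have hval : tderiv E E (k⁻¹ : Equiv.Perm M) (g p) (tderiv E E g p (evalAt p X)) =
      evalAt p (Ad (k⁻¹ * g) X) := by
    have h1 := (hkiso.inv.mul hgiso).evalAt_map_Ad X p
    rw [hfix, hkiso.inv.tderiv_mul hgiso] at h1
    exact h1.symm
  rw [h.form_apply hM, ← hk, hval, h.evalEquiv_symm_evalAt hM hX',
    ← hkiso.Ad_mul (hkiso.inv.mul hgiso), mul_inv_cancel_left]

/-- Every tangent vector has the form `dg(X(p))` with `X` in 𝔪: `G` is transitive and 𝔪 evaluates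
onto the tangent space at `p`. -/
theorem IsSymmetricComplement.isCanonicalForm_unique (hM : IsSymmetricSpace E M)
    (h : IsSymmetricComplement p 𝔪) {Ω Ω' : OneForm E M (transvectionAlgebra E M)}
    (hΩ : IsCanonicalForm p 𝔪 Ω) (hΩ' : IsCanonicalForm p 𝔪 Ω') : Ω = Ω' := by
  rw [isCanonicalForm_iff] at hΩ hΩ'
  funext x
  refine LinearMap.ext fun (v : E) ↦ Subtype.ext ?_
  obtain ⟨g, hg, rfl⟩ := exists_transvectionGroup_apply_eq hM p x
  have hiso := isIsometry_of_mem_transvectionGroup hg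
  obtain ⟨X, hX, hXv⟩ := h.exists_evalAt_eq hM (tderiv E E (g⁻¹ : Equiv.Perm M) (g p) v)
  have hv : tderiv E E g p (evalAt p X) = v := by
    have h1 := hiso.tderiv_apply_inv (g p) v
    rwa [Equiv.Perm.coe_inv, Equiv.symm_apply_apply, ← Equiv.Perm.coe_inv, ← hXv] at h1
  have h1 := (hΩ g hg X hX).trans (hΩ' g hg X hX).symm
  rwa [hv] at h1

/-- The span contains every `Ad_g X` with `X` in 𝔪. With `g = 1` this gives 𝔪; being
finite-dimensional, it also contains the derivatives of such translates, which give `[𝔪, 𝔪] = 𝔥`. -/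
theorem IsSymmetricComplement.isFull (hM : IsSymmetricSpace E M)
    (h : IsSymmetricComplement p 𝔪) {Ω : OneForm E M (transvectionAlgebra E M)}
    (hΩ : IsCanonicalForm p 𝔪 Ω) : IsFull Ω := by
  have : Nonempty M := ⟨p⟩
  rw [isCanonicalForm_iff] at hΩ
  set S : Submodule ℝ (transvectionAlgebra E M) :=
    Submodule.span ℝ {u | ∃ (x : M) (v : TangentSpace 𝓘(ℝ, E) x), u = Ω x v} with hS
  set W : Submodule ℝ (VectorFields E M) := S.map (transvectionAlgebra E M).subtype with hW
  have hAd : ∀ X ∈ 𝔪, ∀ g ∈ transvectionGroup E M, Ad g X ∈ W := by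
    intro X hX g hg
    rw [← hΩ g hg X hX]
    exact Submodule.mem_map_of_mem (Submodule.subset_span ⟨_, _, rfl⟩)
  have h𝔪 : 𝔪 ≤ W := fun X hX ↦ by
    have := hAd X hX 1 (Subgroup.one_mem _)
    rwa [Ad_one] at this
  have h𝔥 : isotropyAlgebra E p ≤ W := by
    rw [← h.bracketSpan_eq hM]
    exact bracketSpan_le fun X hX Y hY ↦
      mlieBracket_mem_of_forall_Ad_mem (fun _ ↦ isIsometry_of_mem_transvectionGroup) (h.le hX)
        (differentiableAt_fieldRep (h.le hY)) W (hAd Y hY)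
  have htop : transvectionAlgebra E M ≤ W := h.sup_eq ▸ sup_le h𝔥 h𝔪
  refine eq_top_iff.2 fun X _ ↦ ?_
  obtain ⟨Y, hY, hYX⟩ := htop X.2
  rwa [← Subtype.ext hYX]

end CanonicalForm

end TransvectionGeometry

end

theorem lemmaL {E : Type*} [NormedAddCommGroup E] [NormedSpace ℝ E] [FiniteDimensional ℝ E]
    {M : Type*} [EMetricSpace M] [ChartedSpace E M] [IsManifold 𝓘(ℝ, E) ∞ M]
    [RiemannianBundle (fun x : M ↦ TangentSpace 𝓘(ℝ, E) x)]
    [IsContMDiffRiemannianBundle 𝓘(ℝ, E) ∞ E (fun x : M ↦ TangentSpace 𝓘(ℝ, E) x)]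
    [IsRiemannianManifold 𝓘(ℝ, E) M] [SimplyConnectedSpace M]
    (hM : IsSymmetricSpace E M) (p : M) :
    (∃ 𝔪 : Submodule ℝ (VectorFields E M), IsSymmetricComplement p 𝔪) ∧
    ∀ 𝔪 : Submodule ℝ (VectorFields E M), IsSymmetricComplement p 𝔪 →
      (∃! Ω : OneForm E M (transvectionAlgebra E M), IsCanonicalForm p 𝔪 Ω) ∧
      (∀ Ω : OneForm E M (transvectionAlgebra E M), IsCanonicalForm p 𝔪 Ω → IsFull Ω) ∧
      bracketSpan 𝔪 𝔪 = isotropyAlgebra E p := by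
  have h := exists_isSymmetricComplement hM p
  refine ⟨h, fun 𝔪 h𝔪 ↦ ⟨?_, fun Ω hΩ ↦ h𝔪.isFull hM hΩ, h𝔪.bracketSpan_eq hM⟩⟩
  obtain ⟨Ω, hΩ⟩ := h𝔪.exists_isCanonicalForm hM
  exact ⟨Ω, hΩ, fun Ω' hΩ' ↦ h𝔪.isCanonicalForm_unique hM hΩ' hΩ⟩
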